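/- Open-book polyhedra. Let $n\ge 2$ be an integer, $\theta\in(0,\pi/4]$, $\theta_n=\theta/(2n-1)$, $\eta=\theta\theta_n/(4\pi)$, $r_1=\cos(\theta_n/2+\eta)/\cos(\theta_n/2)$, $r_2=\sin\eta/\sin(\theta_n/2)$, and write $[r,\alpha,h]=(r\cos\alpha,r\sin\alpha,h)\in\mathbb R^3$. For $j=1,\dots,n$ put $y^{3j-2}=0$, $y^{3j-1}=[1,(2j-2)\theta_n,0]$, $y^{3j}=[1,(2j-1)\theta_n,0]$; put $z^1=(0,0,-1)$, $z^2=[r_1,0,-1]$, $z^{3n}=[r_1,\theta,-1]$; $z^{3j}=[1,(2j-1)\theta_n+\eta,-1]$ for $1\le j\le n-1$; and $z^{3j-2}=[r_2,(2j-\tfrac52)\theta_n,-1]$, $z^{3j-1}=[1,(2j-2)\theta_n-\eta,-1]$ for $2\le j\le n$. With $y^{3n+1}=y^1$, $z^{3n+1}=z^1$, let $\Gamma_{\theta,n}$ be the closed surface consisting of the quadrilaterals $\mathrm{conv}\{y^m,y^{m+1},z^m,z^{m+1}\}$, $m=1,\dots,3n$, the triangles $\mathrm{conv}\{y^{3j-2},y^{3j-1},y^{3j}\}$,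 $j=1,\dots,n$, and the closed plane polygonal region with successive vertices $z^1,\dots,z^{3n}$. The open-book polyhedron $\Omega_{\theta,n}$ is the bounded region enclosed by $\Gamma_{\theta,n}$. The operator and the norms. For $\Gamma=\Gamma_{\theta,n}$, let $s$ be surface measure on $\Gamma$, $\mathbf n$ the outward unit normal, and $\Theta(x)=\lim_{\delta\to0}|B_\delta(x)\cap\Omega_{\theta,n}|/|B_\delta(x)|$. The double-layer potential operator $D$ on the space $C(\Gamma)$ of continuous complex-valued functions on $\Gamma$ is $$D\phi(x)=\Big(\Theta(x)-\frac12\Big)\phi(x)+\frac1{4\pi}\int_\Gamma\frac{(x-y)\cdot\mathbf n(y)}{|x-y|^3}\,\phi(y)\,ds(y),\qquad x\in\Gamma .$$ A weight is a function $w\in L^\infty(\Gamma)$ such that, for some $c_->0$, $c_-\le w(x)\le 1$ for almost all $x\in\Gamma$. It defines the norm $\|\psi\|_{C_w(\Gamma)}=\operatorname{ess\,sup}_{x\in\Gamma}|\psi(x)/w(x)|$, the corresponding operator norm $\|T\|_{C_w(\Gamma)}=\sup\{\|T\phi\|_{C_w(\Gamma)}:\phi\in C(\Gamma),\ \|\phi\|_{C_w(\Gamma)}\le1\}$,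 and the essential norm $\|D\|_{C_w(\Gamma),\mathrm{ess}}=\inf\|D-K\|_{C_w(\Gamma)}$, the infimum being over all compact linear operators $K$ on $C(\Gamma)$. Theorem (Answer to Q3). Let $n\ge2$ be an integer. (i) For every $\varepsilon>0$ there exists $\theta_0\in(0,\pi/4]$ such that, if $0<\theta\le\theta_0$ and $\Gamma=\Gamma_{\theta,n}$, then for every weight $w$ on $\Gamma$ the norm $\|D\|_{C_w(\Gamma)}$ is finite and $$\|D\|_{C_w(\Gamma),\mathrm{ess}}\ \ge\ \frac{2n-1}{4}-\varepsilon .$$ (ii) Consequently there exists $\theta_0\in(0,\pi/4]$ such that, if $0<\theta\le\theta_0$ and $\Gamma=\Gamma_{\theta,n}$, there is no weight $w$ on $\Gamma$ with $\|D\|_{C_w(\Gamma),\mathrm{ess}}<1/2$. -/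

import Mathlib

noncomputable section

open MeasureTheory Filter Topology
open scoped ENNReal

namespace OpenBook

/-- Three-dimensional Euclidean space. -/
abbrev E3 : Type := EuclideanSpace ℝ (Fin 3)

/-! ### Double-layer potential operator of a closed surface -/

section Surface

/-- The region enclosed by a closed surface `Γ`: the union of the bounded connected components of
the complement of `Γ`. -/
def inside (Γ : Set E3) : Set E3 :=
  {x | x ∉ Γ ∧ Bornology.IsBounded (connectedComponentIn Γᶜ x)}

/-- Surface measure on `Γ`: the two-dimensional Hausdorff measure, normalised to be area on
planes, regarded as a measure on the subtype `Γ`. -/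
def surf (Γ : Set E3) : Measure Γ :=
  (Measure.euclideanHausdorffMeasure 2 : Measure E3).comap Subtype.val

/-- `ν` is the outward unit normal to the open set `Ω` at the point `y`, near which `Ω` is the open
half-space `{x | (x - y) · ν < 0}`. For a polyhedron such a `ν` exists, and is unique, exactly at
the boundary points that lie in the relative interior of a face. -/
def IsOutwardUnitNormal (Ω : Set E3) (y ν : E3) : Prop :=
  ‖ν‖ = 1 ∧ ∃ r > 0, ∀ x ∈ Metric.ball y r, x ∈ Ω ↔ inner ℝ (x - y) ν < 0

open Classical in
/-- The outward unit normal `n(y)` (zero where it does not exist, which on a polyhedral surface is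
a set of surface measure zero). -/
def normal (Ω : Set E3) (y : E3) : E3 :=
  if h : ∃ ν, IsOutwardUnitNormal Ω y ν then h.choose else 0

/-- The density of `Ω` at `x`: the limit of `|B_δ(x) ∩ Ω| / |B_δ(x)|` as `δ → 0+`. -/
def density (Ω : Set E3) (x : E3) : ℝ :=
  limUnder (𝓝[>] (0 : ℝ)) fun δ =>
    volume.real (Metric.ball x δ ∩ Ω) / volume.real (Metric.ball x δ)

/-- The kernel `∂Φ(x, y)/∂n(y)` of the double-layer potential, `Φ(x, y) = 1 / (4π|x - y|)`. -/
def kernel (Ω : Set E3) (x y : E3) : ℝ :=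
  inner ℝ (x - y) (normal Ω y) / (4 * Real.pi * ‖x - y‖ ^ 3)

/-- The double-layer potential operator on `C(Γ)`,
`Dφ(x) = (Θ(x) - 1/2) φ(x) + ∫_Γ ∂Φ(x, y)/∂n(y) φ(y) ds(y)`,
with `Θ` the density of the region enclosed by `Γ`. -/
def doubleLayer (Γ : Set E3) (φ : C(Γ, ℂ)) (x : Γ) : ℂ :=
  (density (inside Γ) x - 1 / 2) • φ x + ∫ y : Γ, kernel (inside Γ) x y • φ y ∂(surf Γ)

/-- `w` is (a representative of) an element of `L^∞(Γ)` with `c ≤ w ≤ 1` almost everywhere, for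
some `c > 0`. -/
def IsWeight (Γ : Set E3) (w : Γ → ℝ) : Prop :=
  AEMeasurable w (surf Γ) ∧ ∃ c > 0, ∀ᵐ x ∂(surf Γ), c ≤ w x ∧ w x ≤ 1

/-- The weighted norm `‖ψ‖_{C_w(Γ)} = ess sup |ψ / w|`. -/
def weightedNorm (Γ : Set E3) (w : Γ → ℝ) (ψ : Γ → ℂ) : ℝ≥0∞ :=
  essSup (fun x => ‖ψ x / (w x : ℂ)‖ₑ) (surf Γ)

/-- The operator norm of a map `T` defined on `C(Γ)`, with respect to `‖·‖_{C_w(Γ)}`. -/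
def weightedOpNorm (Γ : Set E3) (w : Γ → ℝ) (T : C(Γ, ℂ) → Γ → ℂ) : ℝ≥0∞ :=
  ⨆ (φ : C(Γ, ℂ)) (_ : weightedNorm Γ w φ ≤ 1), weightedNorm Γ w (T φ)

/-- The essential norm `‖T‖_{C_w(Γ),ess}`: the infimum of `‖T - K‖_{C_w(Γ)}` over all compact
linear operators `K` on `C(Γ)`. (For compact `Γ` the compact-open topology of `C(Γ, ℂ)` is that of
the supremum norm, and so that of every equivalent norm `‖·‖_{C_w(Γ)}`.) -/
def essNorm (Γ : Set E3) (w : Γ → ℝ) (T : C(Γ, ℂ) → Γ → ℂ) : ℝ≥0∞ :=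
  ⨅ (K : C(Γ, ℂ) →L[ℂ] C(Γ, ℂ)) (_ : IsCompactOperator K),
    weightedOpNorm Γ w fun φ x => T φ x - K φ x

end Surface

/-! ### The open-book polyhedra

The pages are numbered by `j = 1, …, n`. -/

section Book

/-- The point with cylindrical coordinates `(r, α, h)`. -/
def cyl (r α h : ℝ) : E3 := !₂[r * Real.cos α, r * Real.sin α, h]

/-- The angle `θ_n = θ / (2n - 1)`. -/
def pageAngle (θ : ℝ) (n : ℕ) : ℝ := θ / (2 * n - 1)

/-- The parameter `η = θ θ_n / (4π)`. -/
def eta (θ : ℝ) (n : ℕ) : ℝ := θ * pageAngle θ n / (4 * Real.pi)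

/-- The parameter `r₁ = cos (θ_n / 2 + η) / cos (θ_n / 2)`. -/
def r1 (θ : ℝ) (n : ℕ) : ℝ :=
  Real.cos (pageAngle θ n / 2 + eta θ n) / Real.cos (pageAngle θ n / 2)

/-- The parameter `r₂ = sin η / sin (θ_n / 2)`. -/
def r2 (θ : ℝ) (n : ℕ) : ℝ := Real.sin (eta θ n) / Real.sin (pageAngle θ n / 2)

/-- The top vertex `y^{3j-1}`. (The top vertices `y^{3j-2}` are all equal to the origin.) -/
def topFront (θ : ℝ) (n j : ℕ) : E3 := cyl 1 ((2 * j - 2) * pageAngle θ n) 0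

/-- The top vertex `y^{3j}`. -/
def topBack (θ : ℝ) (n j : ℕ) : E3 := cyl 1 ((2 * j - 1) * pageAngle θ n) 0

/-- The bottom vertex `z^{3j-2}`. -/
def botInner (θ : ℝ) (n j : ℕ) : E3 :=
  if j = 1 then cyl 0 0 (-1) else cyl (r2 θ n) ((2 * j - 5 / 2) * pageAngle θ n) (-1)

/-- The bottom vertex `z^{3j-1}`. -/
def botFront (θ : ℝ) (n j : ℕ) : E3 :=
  if j = 1 then cyl (r1 θ n) 0 (-1) else cyl 1 ((2 * j - 2) * pageAngle θ n - eta θ n) (-1)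

/-- The bottom vertex `z^{3j}`. -/
def botBack (θ : ℝ) (n j : ℕ) : E3 :=
  if j = n then cyl (r1 θ n) θ (-1) else cyl 1 ((2 * j - 1) * pageAngle θ n + eta θ n) (-1)

/-- The bottom vertex `z^{3j+1}` that follows `z^{3j}` cyclically, so `z^1` follows `z^{3n}`. -/
def botNext (θ : ℝ) (n j : ℕ) : E3 := botInner θ n (if j = n then 1 else j + 1)

/-- The front of page `j`. -/
def frontFace (θ : ℝ) (n j : ℕ) : Set E3 :=
  convexHull ℝ {0, topFront θ n j, botInner θ n j, botFront θ n j}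

/-- The end of page `j`. -/
def endFace (θ : ℝ) (n j : ℕ) : Set E3 :=
  convexHull ℝ {topFront θ n j, topBack θ n j, botFront θ n j, botBack θ n j}

/-- The back of page `j`. -/
def backFace (θ : ℝ) (n j : ℕ) : Set E3 :=
  convexHull ℝ {topBack θ n j, 0, botBack θ n j, botNext θ n j}

/-- The top face: a union of `n` congruent triangles with the common vertex `0`. -/
def topFace (θ : ℝ) (n : ℕ) : Set E3 :=
  ⋃ j ∈ Set.Icc 1 n, convexHull ℝ {0, topFront θ n j, topBack θ n j}

/-- The bottom face: the polygonal region with successive vertices `z^1, z^2, …, z^{3n}`. As the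
polar angle about `z^1 = (0, 0, -1)` is strictly increasing along `z^2, …, z^{3n}`, from `0` to
`θ ≤ π`, it is the union of the triangles spanned by `z^1` and the sides `[z^m, z^{m+1}]`. -/
def bottomFace (θ : ℝ) (n : ℕ) : Set E3 :=
  ⋃ j ∈ Set.Icc 1 n,
    convexHull ℝ {botInner θ n 1, botInner θ n j, botFront θ n j} ∪
      convexHull ℝ {botInner θ n 1, botFront θ n j, botBack θ n j} ∪
      convexHull ℝ {botInner θ n 1, botBack θ n j, botNext θ n j}

/-- The closed surface `Γ_{θ,n}`, the boundary of the open-book polyhedron `Ω_{θ,n}` with `n` pages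
and opening angle `θ`; the polyhedron itself is `inside (bookSurface θ n)`. -/
def bookSurface (θ : ℝ) (n : ℕ) : Set E3 :=
  topFace θ n ∪ bottomFace θ n ∪
    ⋃ j ∈ Set.Icc 1 n, frontFace θ n j ∪ endFace θ n j ∪ backFace θ n j

end Book

end OpenBook

end

noncomputable section

open MeasureTheory Filter Topology
open scoped ENNReal

/-! The fronts and backs of the `n` pages are `2n` plane pieces through the origin. Near it they are
almost vertical, and they stand about the spine at the angles `0, θ_n, …, (2n-1)θ_n = θ`. Fix a
small `τ`, then a far smaller `θ`. On each side take the disc of radius `τ t` whose centre has chart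
coordinates `(t, t)`, that is, distance `t` along the top edge and depth `t`.

Seen from a point `y` of one such patch, any other patch is a disc at height about `t|γ| ≤ t θ`,
where `γ` is the angle between the two sides. This height is negligible against the radius, and the
foot of `y` lies in the disc. Even when the foot is close to the rim, the disc fills nearly half of
the plane, and a half-plane tangent to the foot carries the mass `π` of the Poisson kernel. With the
factor `1/(4π)`, each of the other `2n-1` patches contributes almost `1/4` to the column integral of
the absolute kernel (`le_setIntegral_kernel`). The sides are tilted from the vertical by at most
`η`, which is of order `θ θ_n`, whereas distinct sides differ by an angle of at least `θ_n`; so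
tilting costs only a factor tending to one (`tiltLoss_mul_poisson_le`).

No weight can repair this. A nonnegative kernel whose column integrals are at least `μ` multiplies
total mass by at least `μ`. If it mapped every continuous `0 ≤ f ≤ w` below `lam * w` with `lam <
μ`, then dividing by `lam` would produce a function below `w` with more mass than the supremum of
such masses (`exists_continuousMap_not_ae_le`). The true kernel is signed, but its sign between two
patches is constant, so at the points of one fixed patch the absolute kernel is recovered by
changing the sign of `f` patch by patch.

No compact operator can repair it either. The picture is invariant under dilation, so it recurs at
infinitely many scales on disjoint patches. A compact operator is small on some member of a bounded
sequence with disjoint supports (`exists_norm_lt_of_isCompactOperator`). These facts combine in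
`ofReal_le_essNorm`.

What remains is geometric. To know the outward normal on the patches, the region enclosed by the
surface is described page by page through linear inequalities (`bookSurface_eq`,
`bookInterior_subset_inside`). Points beyond a side escape vertically upwards, since pages widen
downwards (`notMem_inside_of_forall`). Finiteness of the norm holds because the surface lies in
finitely many planes, each of which has kernel mass bounded independently of the point of
observation (`weightedOpNorm_ne_top`). -/

/-! ### Compact operators and positive kernels. -/

/-- A compact operator on `C(X)` cannot be bounded below on a sequence of functions with disjoint
supports that are bounded by one. -/
theorem exists_norm_lt_of_isCompactOperator {X : Type*} [TopologicalSpace X] [CompactSpace X]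
    (K : C(X, ℂ) →L[ℂ] C(X, ℂ)) (hK : IsCompactOperator K) (φ : ℕ → C(X, ℂ))
    (h1 : ∀ k x, ‖φ k x‖ ≤ 1) (hd : ∀ x k l, φ k x ≠ 0 → φ l x ≠ 0 → k = l)
    {δ : ℝ} (hδ : 0 < δ) : ∃ k, ‖K (φ k)‖ < δ := by
  by_contra! hcon
  have hcpt := IsCompactOperator.isCompact_closure_image_closedBall (f := K.toLinearMap) hK 1
  have hmem : ∀ k, K (φ k) ∈ closure (K.toLinearMap '' Metric.closedBall 0 1) := fun k =>
    subset_closure ⟨φ k, by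
      rw [mem_closedBall_zero_iff]
      exact (ContinuousMap.norm_le _ zero_le_one).2 (h1 k), rfl⟩
  obtain ⟨g, -, s, hs, hlim⟩ := hcpt.tendsto_subseq hmem
  have hg : δ ≤ ‖g‖ := ge_of_tendsto hlim.norm (Eventually.of_forall fun k => hcon _)
  have hev := (Metric.tendsto_atTop.1 hlim) (δ / 2) (by positivity)
  obtain ⟨N, hN⟩ := hev
  obtain ⟨m, hm⟩ := exists_nat_gt (‖K‖ / (δ / 2))
  -- Disjoint supports keep the norm of a sum of `m` functions at most one, while its image stays
  -- within `m * δ / 2` of `m • g`, where `‖g‖ ≥ δ`. The choice of `m` makes `m * δ / 2` exceed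
  -- `‖K‖`.
  set ψ : C(X, ℂ) := ∑ k ∈ Finset.Ico N (N + m), φ (s k) with hψ
  have hψ1 : ‖ψ‖ ≤ 1 := by
    refine (ContinuousMap.norm_le _ zero_le_one).2 fun x => ?_
    rw [hψ, ContinuousMap.sum_apply]
    by_cases hx : ∃ k ∈ Finset.Ico N (N + m), φ (s k) x ≠ 0
    · obtain ⟨k, hk, hkx⟩ := hx
      rw [Finset.sum_eq_single_of_mem k hk]
      · exact h1 _ _
      · intro l _ hl
        by_contra hne
        exact hl (hs.injective (hd x _ _ hne hkx))
    · push Not at hx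
      rw [Finset.sum_eq_zero hx]
      simp
  have hK1 : ‖K ψ‖ ≤ ‖K‖ := by
    calc ‖K ψ‖ ≤ ‖K‖ * ‖ψ‖ := K.le_opNorm _
      _ ≤ ‖K‖ := mul_le_of_le_one_right (norm_nonneg _) hψ1
  have hdiff : ‖K ψ - (m : ℝ) • g‖ ≤ m * (δ / 2) := by
    have : K ψ - (m : ℝ) • g = ∑ k ∈ Finset.Ico N (N + m), (K (φ (s k)) - g) := by
      rw [hψ, map_sum, Finset.sum_sub_distrib, Finset.sum_const]
      simp [Nat.cast_smul_eq_nsmul]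
    rw [this]
    refine (norm_sum_le _ _).trans ?_
    calc ∑ k ∈ Finset.Ico N (N + m), ‖K (φ (s k)) - g‖
        ≤ ∑ k ∈ Finset.Ico N (N + m), (δ / 2) := Finset.sum_le_sum fun k hk => by
          have := hN k (Finset.mem_Ico.1 hk).1
          rw [dist_eq_norm] at this
          exact this.le
      _ = m * (δ / 2) := by simp
  have hge : (m : ℝ) * δ ≤ ‖K ψ‖ + m * (δ / 2) := by
    calc (m : ℝ) * δ ≤ m * ‖g‖ := by gcongr
      _ = ‖(m : ℝ) • g‖ := by rw [norm_smul]; simp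
      _ ≤ ‖K ψ‖ + ‖K ψ - (m : ℝ) • g‖ := by
          have := norm_sub_le (K ψ) (K ψ - (m : ℝ) • g)
          simpa using this
      _ ≤ _ := by gcongr
  rw [div_lt_iff₀ (by positivity)] at hm
  nlinarith

/-- If a nonnegative kernel `G` has all its column integrals over `U` at least `μ`, and `lam < μ`,
then no weight `w` satisfies `∫ G f ≤ lam w` for all continuous `0 ≤ f ≤ w` supported in `U`. -/
theorem exists_continuousMap_not_ae_le {X : Type*} [MetricSpace X] [SecondCountableTopology X]
    [MeasurableSpace X] [BorelSpace X] (s : Measure X) {U : Set X} (hU : IsOpen U)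
    (hUc : Uᶜ.Nonempty) (hfin : s U ≠ ⊤) (hpos : s U ≠ 0) {w : X → ℝ} {c : ℝ} (hc : 0 < c)
    (hw : ∀ᵐ x ∂s, c ≤ w x ∧ w x ≤ 1) {G : X → X → ℝ} (hGm : Measurable (Function.uncurry G))
    (hG0 : ∀ x y, 0 ≤ G x y) {M : ℝ} (hGM : ∀ x ∈ U, ∀ y ∈ U, G x y ≤ M)
    (hGc : ∀ y ∈ U, ContinuousOn (fun x => G x y) U) {μ lam : ℝ} (hlam : 0 < lam) (hμ : lam < μ)
    (hcol : ∀ y ∈ U, μ ≤ ∫ x in U, G x y ∂s) :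
    ∃ f : C(X, ℝ), (∀ x, 0 ≤ f x ∧ f x ≤ 1) ∧ (∀ x ∉ U, f x = 0) ∧ (∀ᵐ x ∂s, f x ≤ w x) ∧
      ¬ ∀ᵐ x ∂(s.restrict U), ∫ y in U, G x y * f y ∂s ≤ lam * w x := by
  -- Consider the supremum `σ` of the masses over `U` of the admissible functions. If the bound
  -- always held, then for an almost optimal `f` the function `A / lam` would be admissible up to
  -- cut-offs, yet would have at least `μ / lam` times the mass of `f`.
  by_contra! hcon
  have : Fact (s U < ⊤) := ⟨hfin.lt_top⟩
  have hUm := hU.measurableSet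
  set S : Set C(X, ℝ) := {f | (∀ x, 0 ≤ f x ∧ f x ≤ 1) ∧ (∀ x ∉ U, f x = 0) ∧
    ∀ᵐ x ∂s, f x ≤ w x} with hS
  have hint : ∀ f : X → ℝ, Measurable f → (∀ x, 0 ≤ f x ∧ f x ≤ 1) →
      Integrable f (s.restrict U) := fun f hf h =>
    Integrable.of_bound hf.aestronglyMeasurable 1 (Eventually.of_forall fun x => by
      rw [Real.norm_eq_abs, abs_of_nonneg (h x).1]; exact (h x).2)
  have hwU : ∀ᵐ x ∂(s.restrict U), c ≤ w x ∧ w x ≤ 1 := ae_restrict_of_ae hw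
  -- cut-off functions
  set χ : ℕ → X → ℝ := fun N x => min 1 (N * Metric.infDist x Uᶜ) with hχ
  have hχc : ∀ N, Continuous (χ N) := fun N =>
    continuous_const.min (continuous_const.mul (Metric.continuous_infDist_pt _))
  have hχ0 : ∀ N x, 0 ≤ χ N x := fun N x =>
    le_min zero_le_one (mul_nonneg (Nat.cast_nonneg _) Metric.infDist_nonneg)
  have hχ1 : ∀ N x, χ N x ≤ 1 := fun N x => min_le_left _ _
  have hχU : ∀ N, ∀ x ∉ U, χ N x = 0 := fun N x hx => by
    have : Metric.infDist x Uᶜ = 0 := Metric.infDist_zero_of_mem hx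
    simp [hχ, this]
  have hdist : ∀ x ∈ U, 0 < Metric.infDist x Uᶜ := fun x hx =>
    (hU.isClosed_compl.notMem_iff_infDist_pos hUc).1 (by simpa using hx)
  have hχlim : ∀ x ∈ U, Tendsto (fun N => χ N x) atTop (𝓝 1) := fun x hx => by
    apply tendsto_const_nhds.congr'
    obtain ⟨N₀, hN₀⟩ := exists_nat_gt (1 / Metric.infDist x Uᶜ)
    filter_upwards [eventually_ge_atTop N₀] with N hN
    have h1 : (1 : ℝ) / Metric.infDist x Uᶜ < N := hN₀.trans_le (by exact_mod_cast hN)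
    rw [div_lt_iff₀ (hdist x hx)] at h1
    exact (min_eq_left h1.le).symm
  -- the supremum
  set I : C(X, ℝ) → ℝ := fun f => ∫ x in U, f x ∂s with hI
  have hbdd : BddAbove (I '' S) := by
    refine ⟨s.real U, ?_⟩
    rintro _ ⟨f, hf, rfl⟩
    have := integral_mono (hint f f.continuous.measurable hf.1)
      (integrable_const (1 : ℝ)) (fun x => (hf.1 x).2)
    simpa [hI] using this
  set σ := sSup (I '' S) with hσ
  have hσpos : 0 < σ := by
    set f : C(X, ℝ) := ⟨fun x => min c 1 * χ 1 x, continuous_const.mul (hχc 1)⟩ with hf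
    have hc1 : 0 < min c 1 := lt_min hc one_pos
    have hf0 : ∀ x, 0 ≤ f x ∧ f x ≤ 1 := fun x =>
      ⟨mul_nonneg hc1.le (hχ0 1 x), mul_le_one₀ (min_le_right _ _) (hχ0 1 x) (hχ1 1 x)⟩
    have hfS : f ∈ S := by
      refine ⟨hf0, fun x hx => ?_, ?_⟩
      · simp [hf, hχU 1 x hx]
      · filter_upwards [hw] with x hx
        calc f x ≤ min c 1 * 1 := mul_le_mul_of_nonneg_left (hχ1 1 x) hc1.le
          _ ≤ c := by rw [mul_one]; exact min_le_left _ _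
          _ ≤ w x := hx.1
    refine lt_of_lt_of_le ?_ (le_csSup hbdd ⟨f, hfS, rfl⟩)
    rw [hI]
    refine (setIntegral_pos_iff_support_of_nonneg_ae (Eventually.of_forall fun x => (hf0 x).1)
      (hint f f.continuous.measurable hf0)).2 ?_
    have : Function.support f ∩ U = U := by
      refine Set.inter_eq_right.2 fun x hx => ?_
      have h := hdist x hx
      refine (mul_pos hc1 (lt_min one_pos ?_)).ne'
      simpa using h
    rw [this]
    exact pos_iff_ne_zero.2 hpos
  have hμ0 : 0 < μ := hlam.trans hμ
  -- The threshold `σ * (lam / μ)` is the mass beyond which one application of `G / lam` exceeds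
  -- `σ`; it lies below `σ` because `lam < μ`.
  obtain ⟨_, ⟨f, hfS, rfl⟩, hfσ⟩ : ∃ z ∈ I '' S, σ * (lam / μ) < z := by
    refine exists_lt_of_lt_csSup ?_ ?_
    · by_contra hne
      rw [Set.not_nonempty_iff_eq_empty] at hne
      rw [hσ, hne, Real.sSup_empty] at hσpos
      exact lt_irrefl _ hσpos
    · exact mul_lt_of_lt_one_right hσpos ((div_lt_one hμ0).2 hμ)
  set A : X → ℝ := fun x => ∫ y in U, G x y * f y ∂s with hA
  have hle : ∀ᵐ x ∂(s.restrict U), A x ≤ lam * w x := hcon f hfS.1 hfS.2.1 hfS.2.2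
  have hA0 : ∀ x, 0 ≤ A x := fun x => integral_nonneg fun y => mul_nonneg (hG0 _ _) (hfS.1 y).1
  have hGf_meas : Measurable (fun z : X × X => G z.1 z.2 * f z.2) :=
    hGm.mul (f.continuous.measurable.comp measurable_snd)
  have hGf_bd : ∀ x ∈ U, ∀ y ∈ U, ‖G x y * f y‖ ≤ M := fun x hx y hy => by
    rw [Real.norm_eq_abs, abs_of_nonneg (mul_nonneg (hG0 _ _) (hfS.1 y).1)]
    exact (mul_le_of_le_one_right (hG0 _ _) (hfS.1 y).2).trans (hGM x hx y hy)
  have hAc : ContinuousOn A U := by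
    refine continuousOn_of_dominated (bound := fun _ => M) ?_ ?_ (integrable_const _) ?_
    · intro x hx
      exact (hGf_meas.comp (measurable_const.prodMk measurable_id)).aestronglyMeasurable
    · intro x hx
      filter_upwards [ae_restrict_mem hUm] with y hy using hGf_bd x hx y hy
    · filter_upwards [ae_restrict_mem hUm] with y hy
      exact (hGc y hy).mul continuousOn_const
  -- the iterates
  have hcont : ∀ N, Continuous fun x => χ N x * min 1 (A x / lam) := by
    intro N
    -- `A` is known to be continuous only on `U`. The cap at `1` bounds the factor, so the cut-off
    -- alone gives continuity at the other points. On `U` the cap is almost everywhere inactive,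
    -- since `A ≤ lam * w ≤ lam`.
    rw [continuous_iff_continuousAt]
    intro x
    by_cases hx : x ∈ U
    · exact (hχc N).continuousAt.mul (continuousAt_const.min
        ((hAc.continuousAt (hU.mem_nhds hx)).div_const _))
    · have hz : χ N x * min 1 (A x / lam) = 0 := by rw [hχU N x hx, zero_mul]
      rw [ContinuousAt, hz]
      have hlim : Tendsto (χ N) (𝓝 x) (𝓝 0) := by
        have := (hχc N).tendsto x
        rwa [hχU N x hx] at this
      refine squeeze_zero (fun y => mul_nonneg (hχ0 N y)
        (le_min zero_le_one (div_nonneg (hA0 y) hlam.le))) (fun y => ?_) hlim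
      exact mul_le_of_le_one_right (hχ0 N y) (min_le_left _ _)
  have hmin0 : ∀ x, 0 ≤ min 1 (A x / lam) := fun x =>
    le_min zero_le_one (div_nonneg (hA0 x) hlam.le)
  set h : ℕ → C(X, ℝ) := fun N => ⟨_, hcont N⟩ with hh
  have hhS : ∀ N, h N ∈ S := by
    intro N
    refine ⟨fun x => ⟨mul_nonneg (hχ0 N x) (hmin0 x),
      mul_le_one₀ (hχ1 N x) (hmin0 x) (min_le_left _ _)⟩, fun x hx => ?_, ?_⟩
    · simp [hh, hχU N x hx]
    · have hle' := (ae_restrict_iff' hUm).1 hle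
      filter_upwards [hw, hle'] with x hx hxA
      by_cases hxU : x ∈ U
      · calc h N x ≤ 1 * (A x / lam) :=
              mul_le_mul (hχ1 N x) (min_le_right _ _) (hmin0 x) zero_le_one
          _ ≤ w x := by
              rw [one_mul, div_le_iff₀ hlam, mul_comm]
              exact hxA hxU
      · have : h N x = 0 := by simp [hh, hχU N x hxU]
        rw [this]
        linarith [hx.1]
  have hlim : Tendsto (fun N => ∫ x in U, h N x ∂s) atTop (𝓝 (∫ x in U, A x / lam ∂s)) := by
    refine tendsto_integral_of_dominated_convergence (fun _ => 1)
      (fun N => (h N).continuous.aestronglyMeasurable) (integrable_const _) ?_ ?_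
    · intro N
      refine Eventually.of_forall fun x => ?_
      rw [Real.norm_eq_abs, abs_of_nonneg ((hhS N).1 x).1]
      exact ((hhS N).1 x).2
    · filter_upwards [ae_restrict_mem hUm, hle, hwU] with x hx hxA hxw
      have h1 : A x / lam ≤ 1 := by
        rw [div_le_one hlam]
        nlinarith [hxw.2]
      have e : A x / lam = 1 * min 1 (A x / lam) := by rw [min_eq_right h1, one_mul]
      rw [e]
      exact (hχlim x hx).mul_const (min 1 (A x / lam))
  have hup : ∫ x in U, A x / lam ∂s ≤ σ :=
    le_of_tendsto hlim (Eventually.of_forall fun N => le_csSup hbdd ⟨h N, hhS N, rfl⟩)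
  rw [integral_div, div_le_iff₀ hlam] at hup
  have hprod : Integrable (fun z : X × X => G z.1 z.2 * f z.2)
      ((s.restrict U).prod (s.restrict U)) := by
    refine Integrable.of_bound hGf_meas.aestronglyMeasurable M ?_
    have hν : (s.restrict U).prod (s.restrict U) =
        ((s.restrict U).prod (s.restrict U)).restrict (U ×ˢ U) := by
      rw [← Measure.prod_restrict, Measure.restrict_restrict hUm, Set.inter_self]
    rw [hν]
    filter_upwards [ae_restrict_mem (hUm.prod hUm)] with z hz using hGf_bd _ hz.1 _ hz.2
  -- Fubini turns the mass of `A` into an integral of `f` against the column integrals.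
  have hswap : ∫ x in U, A x ∂s = ∫ y in U, (∫ x in U, G x y ∂s) * f y ∂s := by
    rw [hA, integral_integral_swap hprod]
    exact integral_congr_ae (Eventually.of_forall fun y => integral_mul_const (f y) fun x => G x y)
  have hlow : μ * I f ≤ ∫ x in U, A x ∂s := by
    rw [hswap, hI, ← integral_const_mul]
    refine integral_mono_ae ((hint f f.continuous.measurable hfS.1).const_mul _) ?_ ?_
    · have := hprod.integral_prod_right
      exact this.congr (Eventually.of_forall fun y => integral_mul_const (f y) fun x => G x y)
    · filter_upwards [ae_restrict_mem hUm] with y hy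
      exact mul_le_mul_of_nonneg_right (hcol y hy) (hfS.1 y).1
  have : σ * lam < μ * I f := by
    have h1 := mul_lt_mul_of_pos_left hfσ hμ0
    calc σ * lam = μ * (σ * (lam / μ)) := by field_simp
      _ < _ := h1
  linarith

namespace OpenBook

/-! ### Outward normals and the density. -/

/-- A small step from `y` in the direction `ν' - ν` enters the half-space of `ν` and leaves that of
`ν'`, so the two descriptions of `Ω` near `y` cannot both hold. -/
theorem IsOutwardUnitNormal.unique {Ω : Set E3} {y ν ν' : E3} (h : IsOutwardUnitNormal Ω y ν)
    (h' : IsOutwardUnitNormal Ω y ν') : ν = ν' := by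
  obtain ⟨hν, r, hr, h⟩ := h
  obtain ⟨hν', r', hr', h'⟩ := h'
  by_contra hne
  have hlt : inner ℝ ν ν' < (1 : ℝ) := (inner_lt_one_iff_real_of_norm_eq_one hν hν').2 hne
  set v : E3 := ν' - ν with hv
  have hv0 : 0 < ‖v‖ := norm_pos_iff.2 (sub_ne_zero.2 (Ne.symm hne))
  set τ : ℝ := min r r' / 2 / ‖v‖ with hτ
  have hτ0 : 0 < τ := by positivity
  have hmin : 0 < min r r' := lt_min hr hr'
  have hnorm : ‖τ • v‖ = min r r' / 2 := by
    rw [norm_smul, Real.norm_of_nonneg hτ0.le, hτ, div_mul_cancel₀ _ hv0.ne']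
  have hx : ∀ ρ, min r r' ≤ ρ → y + τ • v ∈ Metric.ball y ρ := fun ρ hρ => by
    rw [mem_ball_iff_norm, add_sub_cancel_left, hnorm]
    linarith
  have h1 := h _ (hx r (min_le_left _ _))
  rw [h' _ (hx r' (min_le_right _ _)), add_sub_cancel_left, inner_smul_left, inner_smul_left] at h1
  have e1 : inner ℝ v ν = inner ℝ ν ν' - 1 := by
    rw [hv, inner_sub_left, real_inner_self_eq_norm_sq, hν, real_inner_comm]; norm_num
  have e2 : inner ℝ v ν' = 1 - inner ℝ ν ν' := by
    rw [hv, inner_sub_left, real_inner_self_eq_norm_sq, hν']; norm_num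
  rw [e1, e2] at h1
  have h2 : ¬ (starRingEnd ℝ) τ * (1 - inner ℝ ν ν') < 0 := not_lt.2
    (mul_nonneg hτ0.le (by linarith))
  exact h2 (h1.2 (mul_neg_of_pos_of_neg hτ0 (by linarith)))

theorem IsOutwardUnitNormal.normal_eq {Ω : Set E3} {y ν : E3} (h : IsOutwardUnitNormal Ω y ν) :
    normal Ω y = ν := by
  have hex : ∃ ν, IsOutwardUnitNormal Ω y ν := ⟨ν, h⟩
  rw [normal, dif_pos hex]
  exact hex.choose_spec.unique h

theorem volume_inner_eq_zero (y : E3) {ν : E3} (hν : ‖ν‖ = 1) :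
    volume {x : E3 | inner ℝ (x - y) ν = 0} = 0 := by
  have hset : {x : E3 | inner ℝ (x - y) ν = 0} = AffineSubspace.mk' y (ℝ ∙ ν)ᗮ := by
    ext x
    simp only [Set.mem_ofPred_eq, SetLike.mem_coe, AffineSubspace.mem_mk', vsub_eq_sub,
      Submodule.mem_orthogonal_singleton_iff_inner_left]
  rw [hset]
  refine Measure.addHaar_affineSubspace _ _ fun htop => ?_
  have : y + ν ∈ (AffineSubspace.mk' y (ℝ ∙ ν)ᗮ : AffineSubspace ℝ E3) := by
    rw [htop]; exact AffineSubspace.mem_top ℝ E3 _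
  rw [AffineSubspace.mem_mk', Submodule.mem_orthogonal_singleton_iff_inner_left] at this
  simp [hν] at this

/-- The reflection through `y` preserves the ball and exchanges the two open half-spaces; the plane
between them is null. -/
theorem volume_real_ball_inter_half (y : E3) {ν : E3} (hν : ‖ν‖ = 1) (δ : ℝ) :
    volume.real (Metric.ball y δ ∩ {x | inner ℝ (x - y) ν < 0}) =
      volume.real (Metric.ball y δ) / 2 := by
  set B := Metric.ball y δ
  set H := {x : E3 | inner ℝ (x - y) ν < 0} with hH
  have hHm : MeasurableSet H :=
    (isOpen_lt (f := fun x : E3 => (inner ℝ (x - y) ν : ℝ)) (by fun_prop)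
      continuous_const).measurableSet
  have hBm : MeasurableSet B := Metric.isOpen_ball.measurableSet
  have hfin : volume B ≠ ⊤ := measure_ball_lt_top.ne
  have hmp : MeasurePreserving (fun x : E3 => (y + y) - x) volume volume :=
    Measure.measurePreserving_sub_left volume (y + y)
  have hpre : (fun x : E3 => (y + y) - x) ⁻¹' (B ∩ H) = B ∩ {x | 0 < inner ℝ (x - y) ν} := by
    ext x
    have e1 : y + y - x - y = -(x - y) := by abel
    simp only [B, hH, Set.mem_preimage, Set.mem_inter_iff, Metric.mem_ball, dist_eq_norm, e1,
      norm_neg, Set.mem_ofPred_eq, inner_neg_left, Left.neg_neg_iff]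
  have heq : volume (B ∩ {x | 0 < inner ℝ (x - y) ν}) = volume (B ∩ H) := by
    rw [← hpre]
    exact hmp.measure_preimage (hBm.inter hHm).nullMeasurableSet
  have hdiff : volume (B \ H) = volume (B ∩ {x | 0 < inner ℝ (x - y) ν}) := by
    refine measure_congr (eventuallyEq_set.2 ?_)
    have h0 : ∀ᵐ x ∂(volume : Measure E3), x ∉ {x : E3 | inner ℝ (x - y) ν = 0} :=
      measure_eq_zero_iff_ae_notMem.1 (volume_inner_eq_zero y hν)
    filter_upwards [h0] with x hx
    simp only [hH, Set.mem_sdiff, Set.mem_inter_iff, Set.mem_ofPred_eq, not_lt]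
    refine and_congr_right fun _ => ?_
    exact ⟨fun h => lt_of_le_of_ne h (Ne.symm hx), le_of_lt⟩
  have hsum := measureReal_inter_add_sdiff (μ := volume) (s := B) hHm hfin
  have : volume.real (B \ H) = volume.real (B ∩ H) := by
    simp only [Measure.real, hdiff, heq]
  linarith

/-- As a consequence, the local term of the double-layer operator vanishes wherever an outward unit
normal exists. -/
theorem IsOutwardUnitNormal.density_eq {Ω : Set E3} {y ν : E3} (h : IsOutwardUnitNormal Ω y ν) :
    density Ω y = 1 / 2 := by
  obtain ⟨hν, r, hr, h⟩ := h
  refine Tendsto.limUnder_eq ?_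
  refine tendsto_const_nhds.congr' ?_
  filter_upwards [Ioo_mem_nhdsGT hr] with δ hδ
  have hset : Metric.ball y δ ∩ Ω = Metric.ball y δ ∩ {x | inner ℝ (x - y) ν < 0} := by
    ext x
    exact and_congr_right fun hx => h x (Metric.ball_subset_ball hδ.2.le hx)
  have hpos : 0 < volume.real (Metric.ball y δ) :=
    ENNReal.toReal_pos (Metric.measure_ball_pos _ _ hδ.1).ne' measure_ball_lt_top.ne
  rw [hset, volume_real_ball_inter_half y hν]
  field_simp

/-- Wherever the density exists it lies in `[0, 1]`; so its values are bounded. -/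
theorem exists_abs_density_le (Ω : Set E3) : ∃ C, ∀ x, |density Ω x| ≤ C := by
  refine ⟨max 1 |Classical.choice (inferInstance : Nonempty ℝ)|, fun x => ?_⟩
  by_cases hex : ∃ l, Tendsto (fun δ => volume.real (Metric.ball x δ ∩ Ω) /
      volume.real (Metric.ball x δ)) (𝓝[>] (0 : ℝ)) (𝓝 l)
  · have hlim := tendsto_nhds_limUnder hex
    refine le_max_of_le_left (abs_le.2 ⟨?_, ?_⟩)
    · exact (neg_nonpos.2 zero_le_one).trans (ge_of_tendsto hlim (Eventually.of_forall fun δ => by positivity))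
    · refine le_of_tendsto hlim (Eventually.of_forall fun δ => ?_)
      exact div_le_one_of_le₀ (measureReal_mono Set.inter_subset_left measure_ball_lt_top.ne)
        measureReal_nonneg
  -- Without a limit, `limUnder` returns a default value that does not depend on `x`; this is the
  -- second entry of the maximum.
  · refine le_max_of_le_right (le_of_eq ?_)
    simp only [density, limUnder, lim]
    congr 1
    unfold Classical.epsilon Classical.strongIndefiniteDescription
    rw [dif_neg]
    exact hex


/-! ### From column integrals to the essential norm. -/

/-- A lower bound for the essential norm of the double-layer operator, from families (one for each
`k`) of relatively open patches on which the outward normal is constant, such that the absolute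
values of the kernel have all their column integrals at least `μ`. -/
theorem ofReal_le_essNorm {Γ : Set E3} (hΓ : IsCompact Γ) {w : Γ → ℝ} (hw : IsWeight Γ w)
    {ι : Type*} [Fintype ι] [DecidableEq ι] (U : ℕ → ι → Set Γ) (N : ι → E3)
    (σ : ι → ι → ℝ) {μ : ℝ} (hμ : 0 < μ) (i₀ : ι)
    (hopen : ∀ k i, IsOpen (U k i))
    (hdisj : ∀ k l i j x, x ∈ U k i → x ∈ U l j → k = l ∧ i = j)
    (hfin : ∀ k i, surf Γ (U k i) ≠ ⊤) (hpos : ∀ k i, surf Γ (U k i) ≠ 0)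
    (hcompl : ∃ x, ∀ k i, x ∉ U k i)
    (hN : ∀ k i, ∀ x ∈ U k i, IsOutwardUnitNormal (inside Γ) x (N i))
    (hplane : ∀ k i, ∀ x ∈ U k i, ∀ y ∈ U k i, inner ℝ ((x : E3) - y) (N i) = 0)
    (hσ : ∀ i j, |σ i j| ≤ 1)
    (hsign : ∀ i j, i ≠ j → ∀ k, ∀ x ∈ U k i, ∀ y ∈ U k j,
      |inner ℝ ((x : E3) - y) (N j)| = σ i j * inner ℝ ((x : E3) - y) (N j))
    (hsep : ∀ k, ∃ r > 0, ∀ i j, i ≠ j → ∀ x ∈ U k i, ∀ y ∈ U k j, r ≤ ‖(x : E3) - y‖)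
    (hcol : ∀ k j, ∀ y ∈ U k j, μ ≤ ∑ i ∈ Finset.univ.erase j, ∫ x in U k i,
      |inner ℝ ((x : E3) - y) (N j)| / (4 * Real.pi * ‖(x : E3) - y‖ ^ 3) ∂(surf Γ)) :
    ENNReal.ofReal μ ≤ essNorm Γ w (doubleLayer Γ) := by
  have : CompactSpace Γ := isCompact_iff_compactSpace.1 hΓ
  refine le_iInf₂ fun K hK => le_of_not_gt fun hlt => ?_
  obtain ⟨L, hL0, hL1, hL2⟩ := ENNReal.lt_iff_exists_real_btwn.1 hlt
  have hLμ : L < μ := (ENNReal.ofReal_lt_ofReal_iff hμ).1 hL2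
  obtain ⟨-, c, hc, hwc⟩ := hw
  set s := surf Γ with hs
  -- The margin `lam - L = (μ - L) / 2` is reserved for the compact operator: `K φ` will be made at
  -- most `c * ((μ - L) / 2)`, hence at most `w * ((μ - L) / 2)` almost everywhere.
  set lam := (L + μ) / 2 with hlam
  have hlam0 : 0 < lam := by positivity
  have hlamμ : lam < μ := by linarith
  set g : ι → Γ → Γ → ℝ := fun j x y =>
    |inner ℝ ((x : E3) - y) (N j)| / (4 * Real.pi * ‖(x : E3) - y‖ ^ 3) with hg
  have hg0 : ∀ j x y, 0 ≤ g j x y := fun j x y => by positivity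
  set V : ℕ → Set Γ := fun k => ⋃ i, U k i with hV
  have hVo : ∀ k, IsOpen (V k) := fun k => isOpen_iUnion (hopen k)
  -- The indicator selects the normal of the patch that contains `y`. When both points lie on the
  -- same patch the kernel vanishes, since patches are plane; different patches are a positive
  -- distance apart. So `G k` is bounded on `V k`.
  set G : ℕ → Γ → Γ → ℝ := fun k x y => ∑ j, (U k j).indicator (fun _ => 1) y * g j x y with hG
  have hGj : ∀ k j x y, y ∈ U k j → G k x y = g j x y := fun k j x y hy => by
    simp only [hG]
    rw [Finset.sum_eq_single j]
    · rw [Set.indicator_of_mem hy, one_mul]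
    · intro l _ hl
      rw [Set.indicator_of_notMem, zero_mul]
      exact fun hy' => hl (hdisj k k l j y hy' hy).2
    · intro h; exact absurd (Finset.mem_univ j) h
  have hG0 : ∀ k x y, 0 ≤ G k x y := fun k x y => Finset.sum_nonneg fun j _ =>
    mul_nonneg (Set.indicator_nonneg (fun _ _ => zero_le_one) _) (hg0 _ _ _)
  have hgm : ∀ j, Measurable (fun z : Γ × Γ => g j z.1 z.2) := fun j => by
    have h1 : Continuous fun z : Γ × Γ => |inner ℝ ((z.1 : E3) - z.2) (N j)| := by fun_prop
    have h2 : Continuous fun z : Γ × Γ => 4 * Real.pi * ‖(z.1 : E3) - z.2‖ ^ 3 := by fun_prop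
    exact h1.measurable.div h2.measurable
  have hGm : ∀ k, Measurable (Function.uncurry (G k)) := fun k =>
    Finset.measurable_sum _ fun j _ =>
      (((measurable_const.indicator (hopen k j).measurableSet)).comp measurable_snd).mul (hgm j)
  have hgii : ∀ k i, ∀ x ∈ U k i, ∀ y ∈ U k i, g i x y = 0 := fun k i x hx y hy => by
    simp only [hg, hplane k i x hx y hy, abs_zero, zero_div]
  have hGbd : ∀ k, ∃ M, ∀ x ∈ V k, ∀ y ∈ V k, G k x y ≤ M := fun k => by
    obtain ⟨r, hr, hsepk⟩ := hsep k
    refine ⟨1 / (4 * Real.pi * r ^ 2), fun x hx y hy => ?_⟩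
    obtain ⟨i, hi⟩ := Set.mem_iUnion.1 hx
    obtain ⟨j, hj⟩ := Set.mem_iUnion.1 hy
    rw [hGj k j x y hj]
    by_cases hij : i = j
    · subst hij
      rw [hgii k i x hi y hj]
      positivity
    · have hd := hsepk i j hij x hi y hj
      have hNj : ‖N j‖ = 1 := (hN k j y hj).1
      have hd0 : 0 < ‖(x : E3) - y‖ := hr.trans_le hd
      have h1 : |inner ℝ ((x : E3) - y) (N j)| ≤ ‖(x : E3) - y‖ := by
        have := abs_real_inner_le_norm ((x : E3) - y) (N j)
        rwa [hNj, mul_one] at this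
      calc g j x y ≤ ‖(x : E3) - y‖ / (4 * Real.pi * ‖(x : E3) - y‖ ^ 3) := by
            simp only [hg]; gcongr
        _ = 1 / (4 * Real.pi * ‖(x : E3) - y‖ ^ 2) := by field_simp
        _ ≤ 1 / (4 * Real.pi * r ^ 2) := by gcongr
  have hGc : ∀ k, ∀ y ∈ V k, ContinuousOn (fun x => G k x y) (V k) := fun k y hy => by
    obtain ⟨r, hr, hsepk⟩ := hsep k
    obtain ⟨j, hj⟩ := Set.mem_iUnion.1 hy
    have : (fun x => G k x y) = fun x => g j x y := funext fun x => hGj k j x y hj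
    rw [this]
    intro x hx
    refine ContinuousAt.continuousWithinAt ?_
    obtain ⟨i, hi⟩ := Set.mem_iUnion.1 hx
    by_cases hij : i = j
    · subst hij
      have : (fun x => g i x y) =ᶠ[𝓝 x] fun _ => 0 := by
        filter_upwards [(hopen k i).mem_nhds hi] with z hz using hgii k i z hz y hj
      exact continuousAt_const.congr this.symm
    · have hd0 : 0 < ‖(x : E3) - y‖ := hr.trans_le (hsepk i j hij x hi y hj)
      refine ContinuousAt.div (by fun_prop) (by fun_prop) ?_
      positivity
  have hVfin : ∀ k, s (V k) ≠ ⊤ := fun k =>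
    ((measure_iUnion_fintype_le s (U k)).trans_lt
      (ENNReal.sum_lt_top.2 fun i _ => (hfin k i).lt_top)).ne
  have hcol' : ∀ k, ∀ y ∈ V k, μ ≤ ∫ x in V k, G k x y ∂s := fun k y hy => by
    obtain ⟨j, hj⟩ := Set.mem_iUnion.1 hy
    obtain ⟨M, hM⟩ := hGbd k
    have hint : ∀ i, IntegrableOn (fun x => G k x y) (U k i) s := fun i => by
      refine Measure.integrableOn_of_bounded (M := M) (hfin k i)
        ((hGm k).comp (measurable_id.prodMk measurable_const)).aestronglyMeasurable ?_
      filter_upwards [ae_restrict_mem (hopen k i).measurableSet] with x hx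
      rw [Real.norm_eq_abs, abs_of_nonneg (hG0 k x y)]
      exact hM x (Set.mem_iUnion.2 ⟨i, hx⟩) y hy
    rw [hV, integral_iUnion_fintype (fun i => (hopen k i).measurableSet) ?_ hint]
    · refine (hcol k j y hj).trans ?_
      have : ∀ i, ∫ x in U k i, G k x y ∂s = ∫ x in U k i, g j x y ∂s := fun i =>
        integral_congr_ae (Eventually.of_forall fun x => hGj k j x y hj)
      simp only [this]
      exact Finset.sum_le_sum_of_subset_of_nonneg (Finset.subset_univ _)
        fun i _ _ => integral_nonneg fun x => hg0 j x y
    · intro i l hil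
      exact Set.disjoint_left.2 fun x hx hx' => hil (hdisj k k i l x hx hx').2
  have hVpos : ∀ k, s (V k) ≠ 0 := fun k h0 =>
    hpos k i₀ (measure_mono_null (Set.subset_iUnion (U k) i₀) h0)
  have hVc : ∀ k, (V k)ᶜ.Nonempty := fun k => by
    obtain ⟨x, hx⟩ := hcompl
    exact ⟨x, fun h => by obtain ⟨i, hi⟩ := Set.mem_iUnion.1 h; exact hx k i hi⟩
  -- The bound fails on a non-null subset of `V k`, hence on a non-null subset of a single patch.
  -- This matters because the signs of a test function can be fitted to only one row of `σ`.
  have hex : ∀ k, ∃ (f : C(Γ, ℝ)) (i : ι), (∀ x, 0 ≤ f x ∧ f x ≤ 1) ∧ (∀ x ∉ V k, f x = 0) ∧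
      (∀ᵐ x ∂s, f x ≤ w x) ∧
      ¬ ∀ᵐ x ∂(s.restrict (U k i)), ∫ y in V k, G k x y * f y ∂s ≤ lam * w x := fun k => by
    obtain ⟨M, hM⟩ := hGbd k
    obtain ⟨f, hf1, hf2, hf3, hf4⟩ := exists_continuousMap_not_ae_le s (hVo k) (hVc k) (hVfin k)
      (hVpos k) hc hwc (hGm k) (hG0 k) hM (hGc k) hlam0 hlamμ (hcol' k)
    rw [hV, ae_restrict_iUnion_iff] at hf4
    push Not at hf4
    obtain ⟨i, hi⟩ := hf4
    exact ⟨f, i, hf1, hf2, hf3, fun h => hi.and_eventually h |>.exists.elim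
      fun x hx => absurd hx.2 (not_le.2 hx.1)⟩
  choose f e hf1 hf2 hf3 hf4 using hex
  -- the test functions
  have hindc : ∀ k j, Continuous ((U k j).indicator (f k)) := fun k j => by
    -- The patches are open and disjoint, so the frontier of one of them misses all patches of the
    -- same scale, and `f k` vanishes there.
    refine continuous_indicator (fun x hx => hf2 k x fun hxV => ?_) (f k).continuous.continuousOn
    obtain ⟨i, hi⟩ := Set.mem_iUnion.1 hxV
    rw [(hopen k j).frontier_eq] at hx
    have hij : i ≠ j := fun h => hx.2 (h ▸ hi)
    obtain ⟨z, hz1, hz2⟩ := mem_closure_iff.1 hx.1 _ (hopen k i) hi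
    exact hij (hdisj k k i j z hz1 hz2).2
  -- The signs belong to the row `e k`: at points of the patch `U k (e k)` the signed kernel acts on
  -- `φ k` as `G k` acts on `f k`. The modulus of `φ k` is at most `f k`.
  set φ : ℕ → C(Γ, ℂ) := fun k =>
    ⟨fun x => ((∑ j, σ (e k) j * (U k j).indicator (f k) x : ℝ) : ℂ),
      Complex.continuous_ofReal.comp (continuous_finsetSum _ fun j _ =>
        continuous_const.mul (hindc k j))⟩ with hφ
  have hφj : ∀ k j x, x ∈ U k j → φ k x = ((σ (e k) j * f k x : ℝ) : ℂ) := fun k j x hx => by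
    simp only [hφ, ContinuousMap.coe_mk]
    rw [Finset.sum_eq_single j, Set.indicator_of_mem hx]
    · intro l _ hl
      rw [Set.indicator_of_notMem, mul_zero]
      exact fun hx' => hl (hdisj k k l j x hx' hx).2
    · intro h; exact absurd (Finset.mem_univ j) h
  have hφV : ∀ k, ∀ x ∉ V k, φ k x = 0 := fun k x hx => by
    simp only [hφ, ContinuousMap.coe_mk]
    rw [Finset.sum_eq_zero, Complex.ofReal_zero]
    intro j _
    rw [Set.indicator_of_notMem, mul_zero]
    exact fun hx' => hx (Set.mem_iUnion.2 ⟨j, hx'⟩)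
  have hφf : ∀ k x, ‖φ k x‖ ≤ f k x := fun k x => by
    by_cases hx : x ∈ V k
    · obtain ⟨j, hj⟩ := Set.mem_iUnion.1 hx
      rw [hφj k j x hj, Complex.norm_real, Real.norm_eq_abs, abs_mul, abs_of_nonneg (hf1 k x).1]
      exact mul_le_of_le_one_left (hf1 k x).1 (hσ _ _)
    · rw [hφV k x hx, norm_zero]
      exact (hf1 k x).1
  obtain ⟨k, hk⟩ := exists_norm_lt_of_isCompactOperator K hK φ
    (fun k x => (hφf k x).trans (hf1 k x).2)
    (fun x k l hk hl => by
      have h1 : x ∈ V k := by by_contra h; exact hk (hφV k x h)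
      have h2 : x ∈ V l := by by_contra h; exact hl (hφV l x h)
      obtain ⟨i, hi⟩ := Set.mem_iUnion.1 h1
      obtain ⟨j, hj⟩ := Set.mem_iUnion.1 h2
      exact (hdisj k l i j x hi hj).1)
    (δ := c * ((μ - L) / 2)) (mul_pos hc (by linarith))
  have hφw : weightedNorm Γ w (φ k) ≤ 1 := by
    refine essSup_le_of_ae_le _ ?_
    filter_upwards [hf3 k, hwc] with x hx hxw
    have hw0 : 0 < w x := hc.trans_le hxw.1
    rw [← ofReal_norm, ENNReal.ofReal_le_one, norm_div, Complex.norm_real, Real.norm_of_nonneg hw0.le,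
      div_le_one hw0]
    exact (hφf k x).trans hx
  have hD : ∀ x ∈ U k (e k),
      doubleLayer Γ (φ k) x = ((∫ y in V k, G k x y * f k y ∂s : ℝ) : ℂ) := fun x hx => by
    rw [doubleLayer, (hN k _ x hx).density_eq, sub_self, zero_smul, zero_add,
      ← integral_indicator (hVo k).measurableSet, ← integral_complex_ofReal]
    refine integral_congr_ae (Eventually.of_forall fun y => ?_)
    simp only
    by_cases hy : y ∈ V k
    · rw [Set.indicator_of_mem hy]
      obtain ⟨j, hj⟩ := Set.mem_iUnion.1 hy
      rw [hφj k j y hj, hGj k j x y hj, kernel, (hN k j y hj).normal_eq, Complex.real_smul,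
        ← Complex.ofReal_mul]
      congr 1
      simp only [hg]
      by_cases hij : e k = j
      · subst hij
        rw [hplane k _ x hx y hj]
        simp
      · rw [hsign _ _ hij k x hx y hj]
        ring
    · rw [Set.indicator_of_notMem hy, hφV k y hy, smul_zero, Complex.ofReal_zero]
  have hTle : weightedNorm Γ w (fun x => doubleLayer Γ (φ k) x - K (φ k) x) ≤ ENNReal.ofReal L :=
    (le_iSup₂_of_le (f := fun (φ : C(Γ, ℂ)) (_ : weightedNorm Γ w φ ≤ 1) =>
      weightedNorm Γ w fun x => doubleLayer Γ φ x - K φ x) (φ k) hφw le_rfl).trans hL1.le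
  refine hf4 k ?_
  have hae : ∀ᵐ x ∂s, ‖(doubleLayer Γ (φ k) x - K (φ k) x) / (w x : ℂ)‖ₑ ≤ ENNReal.ofReal L :=
    (ENNReal.ae_le_essSup _).mono fun x hx => hx.trans hTle
  filter_upwards [ae_restrict_of_ae hae, ae_restrict_of_ae hwc,
    ae_restrict_mem (hopen k (e k)).measurableSet] with x hx hxw hxU
  have hw0 : 0 < w x := hc.trans_le hxw.1
  rw [← ofReal_norm, ENNReal.ofReal_le_ofReal_iff hL0, norm_div, Complex.norm_real,
    Real.norm_of_nonneg hw0.le, div_le_iff₀ hw0, hD x hxU] at hx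
  have h1 : ‖K (φ k) x‖ ≤ c * ((μ - L) / 2) := ((K (φ k)).norm_coe_le_norm x).trans hk.le
  have h2 : c * ((μ - L) / 2) ≤ w x * ((μ - L) / 2) :=
    mul_le_mul_of_nonneg_right hxw.1 (by linarith)
  set A := ∫ y in V k, G k x y * f k y ∂s
  have h3 : A ≤ ‖(A : ℂ)‖ := by rw [Complex.norm_real]; exact le_abs_self _
  have h4 := norm_sub_norm_le (A : ℂ) (K (φ k) x)
  have h5 : lam * w x = L * w x + w x * ((μ - L) / 2) := by rw [hlam]; ring
  linarith


/-! ### Poisson kernels of discs and half-planes. -/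

/-- The Poisson kernel of the half-space at height `d`, up to normalisation. -/
def poisson (d : ℝ) (v : ℂ) : ℝ := d / √(‖v‖ ^ 2 + d ^ 2) ^ 3

theorem poisson_nonneg {d : ℝ} (hd : 0 ≤ d) (v : ℂ) : 0 ≤ poisson d v := by
  unfold poisson; positivity

/-- The kernel is homogeneous of degree `-2` in `(v, d)`, which compensates the scaling of area and
makes the mass of a patch independent of its scale. -/
theorem poisson_smul {d : ℝ} (hd : 0 < d) (v : ℂ) : poisson d (d • v) = (d ^ 2)⁻¹ * poisson 1 v := by
  have h : √(‖d • v‖ ^ 2 + d ^ 2) = d * √(‖v‖ ^ 2 + 1 ^ 2) := by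
    rw [norm_smul, Real.norm_of_nonneg hd.le,
      show (d * ‖v‖) ^ 2 + d ^ 2 = d ^ 2 * (‖v‖ ^ 2 + 1 ^ 2) by ring,
      Real.sqrt_mul (by positivity), Real.sqrt_sq hd.le]
  have h1 : 0 < √(‖v‖ ^ 2 + 1 ^ 2) := by positivity
  rw [poisson, poisson, h]
  field_simp

theorem integrable_poisson_one : Integrable (poisson 1) := by
  have h := integrable_rpow_neg_one_add_norm_sq (E := ℂ) (μ := volume) (r := 3)
    (by simp; norm_num)
  refine h.congr (Eventually.of_forall fun v => ?_)
  simp only [poisson]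
  have h0 : (0 : ℝ) < 1 + ‖v‖ ^ 2 := by positivity
  have h1 : √(‖v‖ ^ 2 + 1 ^ 2) ^ 3 = (1 + ‖v‖ ^ 2) ^ (3 / 2 : ℝ) := by
    rw [Real.sqrt_eq_rpow, ← Real.rpow_natCast (_ ^ _) 3, ← Real.rpow_mul (by positivity), one_pow,
      add_comm]
    norm_num
  rw [h1, neg_div, Real.rpow_neg h0.le, one_div]

theorem integral_comp_affine {u : ℂ} (hu : ‖u‖ = 1) (d : ℝ) (p : ℂ) (f : ℂ → ℝ) :
    ∫ w, f (p + d • (u * w)) = (d ^ 2)⁻¹ * ∫ v, f v := by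
  have h1 : ∫ w, f (p + d • (u * w)) = ∫ w, f (p + d • w) := by
    set R := rotation (⟨u, mem_sphere_zero_iff_norm.2 hu⟩ : Circle)
    exact R.measurePreserving.integral_comp R.toHomeomorph.measurableEmbedding
      (fun w => f (p + d • w))
  rw [h1, Measure.integral_comp_smul volume (fun w => f (p + w)) d, integral_add_left_eq_self]
  simp

/-- In polar coordinates the radial integral equals one, as `r / √(r² + 1)³` is the derivative of
`-1 / √(r² + 1)`, and the half-plane contributes angles of total length `π`. -/
theorem pi_le_setIntegral_poisson : Real.pi ≤ ∫ v in {v : ℂ | 0 < v.re}, poisson 1 v := by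
  have hm : MeasurableSet {v : ℂ | 0 < v.re} := measurableSet_lt measurable_const Complex.measurable_re
  rw [← integral_indicator hm, ← Complex.integral_comp_polarCoord_symm]
  have hF : ∀ r ∈ Set.Ioi (0 : ℝ), HasDerivAt (fun r : ℝ => -(√(r ^ 2 + 1))⁻¹)
      (r / √(r ^ 2 + 1) ^ 3) r := fun r _ => by
    have h0 : (0 : ℝ) < r ^ 2 + 1 := by positivity
    have h1 : HasDerivAt (fun r : ℝ => r ^ 2 + 1) (2 * r) r := by
      simpa using ((hasDerivAt_pow 2 r).add_const (1 : ℝ))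
    have h2 : 0 < √(r ^ 2 + 1) := by positivity
    have h3 := ((h1.sqrt h0.ne').inv h2.ne').neg
    exact h3.congr_deriv (by field_simp)
  have hcont : ContinuousWithinAt (fun r : ℝ => -(√(r ^ 2 + 1))⁻¹) (Set.Ici 0) 0 := by
    refine ContinuousAt.continuousWithinAt ?_
    refine ContinuousAt.neg (ContinuousAt.inv₀ (by fun_prop) ?_)
    positivity
  have hlim : Tendsto (fun r : ℝ => -(√(r ^ 2 + 1))⁻¹) atTop (𝓝 0) := by
    rw [← neg_zero]
    refine Tendsto.neg (tendsto_inv_atTop_zero.comp ?_)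
    refine tendsto_atTop_mono (fun r => ?_) tendsto_id
    exact Real.le_sqrt_of_sq_le (by simp)
  have hrad : ∫ r in Set.Ioi (0 : ℝ), r / √(r ^ 2 + 1) ^ 3 = 1 := by
    rw [integral_Ioi_of_hasDerivAt_of_nonneg hcont hF
      (fun r hr => div_nonneg (le_of_lt hr) (by positivity)) hlim]
    simp
  set g : ℝ → ℝ := {t : ℝ | 0 < Real.cos t}.indicator fun _ => 1 with hg
  have hgm : MeasurableSet {t : ℝ | 0 < Real.cos t} :=
    measurableSet_lt measurable_const Real.measurable_cos
  have heq : ∫ p in polarCoord.target, p.1 • {v : ℂ | 0 < v.re}.indicator (poisson 1)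
      (Complex.polarCoord.symm p) =
      ∫ p in Set.Ioi (0 : ℝ) ×ˢ Set.Ioo (-Real.pi) Real.pi,
        p.1 / √(p.1 ^ 2 + 1) ^ 3 * g p.2 := by
    refine setIntegral_congr_fun (measurableSet_Ioi.prod measurableSet_Ioo) fun p hp => ?_
    have hp0 : 0 < p.1 := hp.1
    have hre : (Complex.polarCoord.symm p).re = p.1 * Real.cos p.2 := by
      simp [Complex.polarCoord_symm_apply, Complex.cos_ofReal_re]
    simp only [hg]
    by_cases hc : 0 < Real.cos p.2
    · rw [Set.indicator_of_mem (show p.2 ∈ {t : ℝ | 0 < Real.cos t} from hc),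
        Set.indicator_of_mem (show Complex.polarCoord.symm p ∈ {v : ℂ | 0 < v.re} by
          rw [Set.mem_ofPred_eq, hre]; positivity), poisson, Complex.norm_polarCoord_symm, sq_abs]
      simp only [smul_eq_mul, one_pow]
      ring
    · rw [Set.indicator_of_notMem (show p.2 ∉ {t : ℝ | 0 < Real.cos t} from hc),
        Set.indicator_of_notMem (show Complex.polarCoord.symm p ∉ {v : ℂ | 0 < v.re} by
          rw [Set.mem_ofPred_eq, hre]; exact fun h => hc (pos_of_mul_pos_right h hp0.le))]
      simp
  rw [heq, Measure.volume_eq_prod, setIntegral_prod_mul (fun r => r / √(r ^ 2 + 1) ^ 3) g, hrad,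
    one_mul, hg, integral_indicator hgm, Measure.restrict_restrict hgm, setIntegral_const, smul_eq_mul,
    mul_one]
  have hsub : Set.Ioo (-(Real.pi / 2)) (Real.pi / 2) ⊆
      {t : ℝ | 0 < Real.cos t} ∩ Set.Ioo (-Real.pi) Real.pi := fun t ht =>
    ⟨Real.cos_pos_of_mem_Ioo ht, by linarith [ht.1, Real.pi_pos], by linarith [ht.2, Real.pi_pos]⟩
  have hfin : volume ({t : ℝ | 0 < Real.cos t} ∩ Set.Ioo (-Real.pi) Real.pi) ≠ ⊤ :=
    measure_ne_top_of_subset Set.inter_subset_right (by simp)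
  have := measureReal_mono hsub hfin
  rw [Real.volume_real_Ioo_of_le (by linarith [Real.pi_pos])] at this
  linarith

/-- Seen from the origin at height one, a large disc tangent to an axis fills almost half of the
plane. -/
theorem exists_forall_le_setIntegral_poisson {κ : ℝ} (hκ : 0 < κ) :
    ∃ R₀ : ℝ, 0 < R₀ ∧ ∀ R ≥ R₀, Real.pi - κ ≤ ∫ v in Metric.ball (R : ℂ) R, poisson 1 v := by
  have hmono : ∀ R R' : ℝ, R ≤ R' → Metric.ball (R : ℂ) R ⊆ Metric.ball (R' : ℂ) R' := by
    intro R R' h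
    refine Metric.ball_subset_ball' ?_
    rw [Complex.dist_eq, ← Complex.ofReal_sub, Complex.norm_real, Real.norm_eq_abs, abs_sub_comm,
      abs_of_nonneg (sub_nonneg.2 h)]
    linarith
  -- The discs tangent to the imaginary axis at `0` increase to the open right half-plane, so their
  -- masses converge to that of the half-plane.
  have hU : ⋃ n : ℕ, Metric.ball ((n : ℝ) : ℂ) (n : ℝ) = {v : ℂ | 0 < v.re} := by
    ext v
    simp only [Set.mem_iUnion, Metric.mem_ball, Complex.dist_eq, Set.mem_ofPred_eq]
    have key : ∀ n : ℕ, ‖v - ((n : ℝ) : ℂ)‖ < n ↔ ‖v‖ ^ 2 < 2 * v.re * n := fun n => by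
      have e : ‖v - ((n : ℝ) : ℂ)‖ ^ 2 = ‖v‖ ^ 2 - 2 * v.re * n + (n : ℝ) ^ 2 := by
        rw [← Complex.normSq_eq_norm_sq, ← Complex.normSq_eq_norm_sq, Complex.normSq_apply,
          Complex.normSq_apply]
        simp
        ring
      rw [← sq_lt_sq₀ (norm_nonneg _) (Nat.cast_nonneg n), e]
      constructor <;> intro h <;> linarith
    constructor
    · rintro ⟨n, hn⟩
      rw [key] at hn
      have hn0 : (0 : ℝ) ≤ n := Nat.cast_nonneg n
      by_contra h
      nlinarith [sq_nonneg ‖v‖, mul_nonneg hn0 (neg_nonneg.2 (not_lt.1 h))]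
    · intro h
      obtain ⟨n, hn⟩ := exists_nat_gt (‖v‖ ^ 2 / (2 * v.re))
      refine ⟨n, (key n).2 ?_⟩
      rw [div_lt_iff₀ (by positivity)] at hn
      linarith
  have hlim := tendsto_setIntegral_of_monotone (μ := volume) (f := poisson 1)
    (s := fun n : ℕ => Metric.ball ((n : ℝ) : ℂ) (n : ℝ)) (fun n => measurableSet_ball)
    (fun n m h => hmono n m (by exact_mod_cast h)) integrable_poisson_one.integrableOn
  rw [hU] at hlim
  have hev := hlim.eventually (eventually_gt_nhds
    (show Real.pi - κ < ∫ v in {v : ℂ | 0 < v.re}, poisson 1 v by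
      linarith [pi_le_setIntegral_poisson]))
  obtain ⟨n, hn, hn1⟩ := (hev.and (eventually_ge_atTop 1)).exists
  refine ⟨n, by exact_mod_cast hn1, fun R hR => hn.le.trans ?_⟩
  exact setIntegral_mono_set integrable_poisson_one.integrableOn
    (Eventually.of_forall fun v => poisson_nonneg zero_le_one v)
    (hmono _ _ hR).eventuallyLE

theorem integrable_poisson {d : ℝ} (hd : 0 < d) (p : ℂ) :
    Integrable fun v => poisson d (v - p) := by
  refine Integrable.comp_sub_right (f := poisson d) ?_ p
  rw [← integrable_comp_smul_iff volume (poisson d) hd.ne']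
  simp only [poisson_smul hd]
  exact integrable_poisson_one.const_mul _

theorem integral_poisson {d : ℝ} (hd : 0 < d) (p : ℂ) :
    ∫ v, poisson d (v - p) = ∫ v, poisson 1 v := by
  have h := integral_comp_affine (u := 1) (by simp) d p (fun v => poisson d (v - p))
  simp only [add_sub_cancel_left, one_mul, poisson_smul hd, integral_const_mul] at h
  exact (mul_left_cancel₀ (by positivity) h).symm

/-- Seen from a point at height `d` above a disc, the disc is at least as large as a disc of half
the radius that touches the foot of the point. -/
theorem setIntegral_poisson_le {c p : ℂ} {ρ d : ℝ} (hp : p ∈ Metric.ball c ρ) (hd : 0 < d) :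
    ∫ w in Metric.ball ((ρ / (2 * d) : ℝ) : ℂ) (ρ / (2 * d)), poisson 1 w ≤
      ∫ v in Metric.ball c ρ, poisson d (v - p) := by
  rw [mem_ball_iff_norm] at hp
  have hρ : 0 < ρ := (norm_nonneg _).trans_lt hp
  obtain ⟨u, hu, hcu⟩ : ∃ u : ℂ, ‖u‖ = 1 ∧ c - p = ‖p - c‖ * u := by
    by_cases h : p - c = 0
    · exact ⟨1, by simp, by rw [h, norm_zero, ← neg_sub, h]; simp⟩
    · have h0 : (‖p - c‖ : ℂ) ≠ 0 := by simpa using h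
      refine ⟨(c - p) / ‖p - c‖, ?_, by field_simp⟩
      rw [norm_div, norm_sub_rev c p]
      simp only [Complex.norm_real, norm_norm]
      exact div_self (by simpa using h)
  -- Of the discs of radius `ρ / 2` that touch `p`, the one on the side of the centre `c` fits into
  -- the large disc. The substitution `v = p + d u w` then moves `p` to `0`, turns `u` into the
  -- positive axis and reduces the height to one.
  have hsub : Metric.ball (p + (ρ / 2 : ℝ) * u) (ρ / 2) ⊆ Metric.ball c ρ := by
    refine Metric.ball_subset_ball' ?_
    have e : p + (ρ / 2 : ℝ) * u - c = ((ρ / 2 - ‖p - c‖ : ℝ) : ℂ) * u := by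
      rw [show c = p + ‖p - c‖ * u by rw [← hcu]; ring]
      have : ‖p - (p + ‖p - c‖ * u)‖ = ‖p - c‖ := by rw [← hcu]; congr 1; ring
      rw [this]
      push_cast
      ring
    rw [dist_eq_norm, e, norm_mul, hu, mul_one, Complex.norm_real, Real.norm_eq_abs]
    have : |ρ / 2 - ‖p - c‖| ≤ ρ / 2 := abs_le.2 ⟨by linarith, by linarith [norm_nonneg (p - c)]⟩
    linarith
  refine le_trans (le_of_eq ?_) (setIntegral_mono_set (integrable_poisson hd p).integrableOn
    (Eventually.of_forall fun v => poisson_nonneg hd.le _) hsub.eventuallyLE)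
  rw [← integral_indicator measurableSet_ball, ← integral_indicator measurableSet_ball]
  have h := integral_comp_affine hu d p ((Metric.ball (p + (ρ / 2 : ℝ) * u) (ρ / 2)).indicator
    fun v => poisson d (v - p))
  have hpt : ∀ w, (Metric.ball (p + (ρ / 2 : ℝ) * u) (ρ / 2)).indicator
      (fun v => poisson d (v - p)) (p + d • (u * w)) = (d ^ 2)⁻¹ *
      (Metric.ball ((ρ / (2 * d) : ℝ) : ℂ) (ρ / (2 * d))).indicator (poisson 1) w := fun w => by
    have hmem : p + d • (u * w) ∈ Metric.ball (p + (ρ / 2 : ℝ) * u) (ρ / 2) ↔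
        w ∈ Metric.ball ((ρ / (2 * d) : ℝ) : ℂ) (ρ / (2 * d)) := by
      rw [mem_ball_iff_norm, mem_ball_iff_norm]
      have e : p + d • (u * w) - (p + (ρ / 2 : ℝ) * u) =
          (d : ℂ) * u * (w - ((ρ / (2 * d) : ℝ) : ℂ)) := by
        have : (d : ℂ) ≠ 0 := by exact_mod_cast hd.ne'
        rw [Complex.real_smul]
        push_cast
        field_simp
        ring
      rw [e, norm_mul, norm_mul, hu, mul_one, Complex.norm_real, Real.norm_of_nonneg hd.le,
        show ρ / 2 = d * (ρ / (2 * d)) by field_simp]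
      exact mul_lt_mul_iff_right₀ hd
    by_cases hw : w ∈ Metric.ball ((ρ / (2 * d) : ℝ) : ℂ) (ρ / (2 * d))
    · have hn : poisson 1 (u * w) = poisson 1 w := by simp only [poisson, norm_mul, hu, one_mul]
      rw [Set.indicator_of_mem (hmem.2 hw), Set.indicator_of_mem hw, add_sub_cancel_left,
        poisson_smul hd, hn]
    · rw [Set.indicator_of_notMem (hmem.not.2 hw), Set.indicator_of_notMem hw, mul_zero]
  simp only [hpt, integral_const_mul] at h
  exact mul_left_cancel₀ (by positivity) h


/-! ### Plane pieces, normals of polyhedral surfaces, and boundedness of the operator. -/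

/-- Isometries preserve Hausdorff measure, and its two-dimensional normalisation on `ℂ` is Lebesgue
measure. All surface integrals are computed in isometric charts through this identity. -/
theorem restrict_range_eq_map {Φ : ℂ → E3} (hΦ : Isometry Φ) :
    (Measure.euclideanHausdorffMeasure 2 : Measure E3).restrict (Set.range Φ) =
      (volume : Measure ℂ).map Φ := by
  rw [← hΦ.map_euclideanHausdorffMeasure]
  congr 1
  have := InnerProductSpace.euclideanHausdorffMeasure_eq_volume (V := ℂ)
  rwa [Complex.finrank_real_complex] at this

theorem exists_linearIsometry_orthogonal {N : E3} (hN : ‖N‖ = 1) :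
    ∃ L : ℂ →ₗᵢ[ℝ] E3, ∀ x : E3, x ∈ Set.range L ↔ inner ℝ x N = 0 := by
  have hN0 : N ≠ 0 := fun h => by simp [h] at hN
  have : Fact (Module.finrank ℝ E3 = 2 + 1) := ⟨by simp⟩
  have hdim : Module.finrank ℝ (ℝ ∙ N)ᗮ = 2 := Submodule.finrank_orthogonal_span_singleton hN0
  let e : ℂ ≃ₗᵢ[ℝ] (ℝ ∙ N)ᗮ := (stdOrthonormalBasis ℝ ℂ).equiv (stdOrthonormalBasis ℝ (ℝ ∙ N)ᗮ)
    (finCongr (by rw [hdim, Complex.finrank_real_complex]))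
  refine ⟨(ℝ ∙ N)ᗮ.subtypeₗᵢ.comp e.toLinearIsometry, fun x => ?_⟩
  rw [← Submodule.mem_orthogonal_singleton_iff_inner_left]
  constructor
  · rintro ⟨v, rfl⟩
    exact (e v).2
  · intro hx
    exact ⟨e.symm ⟨x, hx⟩, by simp⟩

/-- The double-layer kernel of a whole plane is integrable, uniformly in the position. -/
theorem lintegral_plane_le {N : E3} (hN : ‖N‖ = 1) (c : ℝ) (x : E3) :
    ∫⁻ y in {y : E3 | inner ℝ y N = c}, ENNReal.ofReal (|inner ℝ (x - y) N| / ‖x - y‖ ^ 3)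
      ∂(Measure.euclideanHausdorffMeasure 2) ≤ ENNReal.ofReal (∫ v, poisson 1 v) := by
  obtain ⟨L, hL⟩ := exists_linearIsometry_orthogonal hN
  set d : ℝ := inner ℝ x N - c with hd
  set Φ : ℂ → E3 := fun v => (x - d • N) + L v with hΦ
  have hiso : Isometry Φ := (isometry_add_left (x - d • N)).comp L.isometry
  have hNN : (inner ℝ N N : ℝ) = 1 := by rw [real_inner_self_eq_norm_sq, hN, one_pow]
  have hfoot : (inner ℝ (x - d • N) N : ℝ) = c := by
    rw [inner_sub_left, real_inner_smul_left, hNN, hd]; ring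
  have hrange : {y : E3 | inner ℝ y N = c} = Set.range Φ := by
    ext y
    rw [Set.mem_ofPred_eq]
    constructor
    · intro hy
      obtain ⟨v, hv⟩ := (hL (y - (x - d • N))).2 (by rw [inner_sub_left, hy, hfoot, sub_self])
      exact ⟨v, by simp only [hΦ, hv]; abel⟩
    · rintro ⟨v, rfl⟩
      simp only [hΦ]
      rw [inner_add_left, hfoot, (hL (L v)).1 ⟨v, rfl⟩, add_zero]
  have hmeas : Measurable fun y : E3 => ENNReal.ofReal (|inner ℝ (x - y) N| / ‖x - y‖ ^ 3) := by
    refine ENNReal.measurable_ofReal.comp (Measurable.div ?_ ?_)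
    · exact Continuous.measurable (by fun_prop)
    · exact Continuous.measurable (by fun_prop)
  rw [hrange, restrict_range_eq_map hiso, lintegral_map hmeas hiso.continuous.measurable]
  have hsub : ∀ v, x - Φ v = d • N - L v := fun v => by simp only [hΦ]; abel
  have hin : ∀ v, (inner ℝ (x - Φ v) N : ℝ) = d := fun v => by
    rw [hsub, inner_sub_left, real_inner_smul_left, hNN, (hL (L v)).1 ⟨v, rfl⟩]; ring
  have hnorm : ∀ v, ‖x - Φ v‖ = √(‖v‖ ^ 2 + |d| ^ 2) := fun v => by
    rw [hsub, eq_comm, Real.sqrt_eq_iff_mul_self_eq (by positivity) (norm_nonneg _),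
      norm_sub_mul_self_real, real_inner_smul_left, real_inner_comm, (hL (L v)).1 ⟨v, rfl⟩,
      norm_smul, hN, L.norm_map, Real.norm_eq_abs]
    ring
  have hpt : ∀ v, |inner ℝ (x - Φ v) N| / ‖x - Φ v‖ ^ 3 = poisson |d| (v - 0) := fun v => by
    rw [hin, hnorm, sub_zero, poisson]
  simp only [hpt]
  -- A point of the plane itself sees a zero kernel; from any other point the total mass is the
  -- same, by dilation.
  rcases eq_or_lt_of_le (abs_nonneg d) with h0 | h0
  · simp [← h0, poisson]
  · rw [← integral_poisson h0 0, ofReal_integral_eq_lintegral_ofReal (integrable_poisson h0 0)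
      (Eventually.of_forall fun v => poisson_nonneg h0.le _)]

theorem mem_inside_of_segment {Γ : Set E3} {x y : E3} (h : segment ℝ x y ⊆ Γᶜ)
    (hy : y ∈ inside Γ) : x ∈ inside Γ := by
  have hcon : connectedComponentIn Γᶜ x = connectedComponentIn Γᶜ y := by
    refine connectedComponentIn_eq ?_
    exact (convex_segment x y).isPreconnected.subset_connectedComponentIn (left_mem_segment ℝ x y) h
      (right_mem_segment ℝ x y)
  exact ⟨h (left_mem_segment ℝ x y), by rw [hcon]; exact hy.2⟩

/-- If a point of the tangent plane were off `Γ`, a short segment avoiding `Γ` would join it to a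
point on the negative side. It would then be inside, although the linear form is not negative there.
-/
theorem IsOutwardUnitNormal.exists_ball_plane_subset {Γ : Set E3} (hΓ : IsClosed Γ) {y ν : E3}
    (h : IsOutwardUnitNormal (inside Γ) y ν) :
    ∃ r > 0, ∀ x ∈ Metric.ball y r, inner ℝ (x - y) ν = 0 → x ∈ Γ := by
  obtain ⟨hν, r, hr, h⟩ := h
  refine ⟨r, hr, fun x hx hx0 => ?_⟩
  by_contra hxΓ
  obtain ⟨ρ, hρ, hsub⟩ := Metric.mem_nhds_iff.1
    (Filter.inter_mem (hΓ.isOpen_compl.mem_nhds hxΓ) (Metric.isOpen_ball.mem_nhds hx))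
  set z := x - (ρ / 2) • ν with hz
  have hzρ : z ∈ Metric.ball x ρ := by
    rw [mem_ball_iff_norm, hz, sub_sub_cancel_left, norm_neg, norm_smul, hν,
      Real.norm_of_nonneg (by positivity)]
    linarith
  have hzin : z ∈ inside Γ := by
    refine (h z (hsub hzρ).2).2 ?_
    have : z - y = (x - y) - (ρ / 2) • ν := by rw [hz]; abel
    rw [this, inner_sub_left, hx0, real_inner_smul_left, real_inner_self_eq_norm_sq, hν]
    linarith
  have hseg : segment ℝ x z ⊆ Γᶜ := fun u hu =>
    (hsub ((convex_ball x ρ).segment_subset (Metric.mem_ball_self hρ) hzρ hu)).1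
  have := (h x hx).1 (mem_inside_of_segment hseg hzin)
  linarith

/-- If a closed surface lies in finitely many planes, then a unit normal at a point is normal to one
of the planes through that point. -/
theorem IsOutwardUnitNormal.exists_plane {Γ : Set E3} (hΓ : IsClosed Γ) {κ : Type*} [Finite κ]
    {N : κ → E3} {c : κ → ℝ} (hN : ∀ k, ‖N k‖ = 1) (hcov : ∀ x ∈ Γ, ∃ k, inner ℝ x (N k) = c k)
    {y ν : E3} (h : IsOutwardUnitNormal (inside Γ) y ν) :
    ∃ k, inner ℝ y (N k) = c k ∧ (ν = N k ∨ ν = -N k) := by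
  obtain ⟨r, hr, hsub⟩ := h.exists_ball_plane_subset hΓ
  have hν := h.1
  -- Planes that miss `y` also miss a neighbourhood of `y`, so only those through `y` matter.
  have hev : ∀ᶠ x in 𝓝 y, ∀ k, inner ℝ y (N k) ≠ c k → inner ℝ x (N k) ≠ c k := by
    refine eventually_all.2 fun k => ?_
    by_cases hk : inner ℝ y (N k) = c k
    · exact Eventually.of_forall fun _ h => absurd hk h
    · have hc : Continuous fun x : E3 => (inner ℝ x (N k) : ℝ) := by fun_prop
      filter_upwards [hc.continuousAt.eventually_ne hk] with x hx _ using hx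
  obtain ⟨ρ, hρ, hball⟩ := Metric.eventually_nhds_iff_ball.1 hev
  have hW : ∀ v : (ℝ ∙ ν)ᗮ, ∃ k, inner ℝ y (N k) = c k ∧ inner ℝ (v : E3) (N k) = 0 := by
    intro v
    set τ : ℝ := min r ρ / (‖(v : E3)‖ + 1) with hτ
    have hm : 0 < min r ρ := lt_min hr hρ
    have hτ0 : 0 < τ := by positivity
    have hlt : ‖τ • (v : E3)‖ < min r ρ := by
      rw [norm_smul, Real.norm_of_nonneg hτ0.le, hτ, div_mul_eq_mul_div, div_lt_iff₀ (by positivity)]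
      nlinarith
    have hx : ∀ R, min r ρ ≤ R → y + τ • (v : E3) ∈ Metric.ball y R := fun R hR => by
      rw [mem_ball_iff_norm, add_sub_cancel_left]
      exact hlt.trans_le hR
    have hvν : (inner ℝ (v : E3) ν : ℝ) = 0 :=
      (Submodule.mem_orthogonal_singleton_iff_inner_left).1 v.2
    have hΓx := hsub _ (hx r (min_le_left _ _)) (by
      rw [add_sub_cancel_left, real_inner_smul_left, hvν, mul_zero])
    obtain ⟨k, hk⟩ := hcov _ hΓx
    have hyk : inner ℝ y (N k) = c k := by
      by_contra hne
      exact hball _ (hx ρ (min_le_right _ _)) k hne hk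
    refine ⟨k, hyk, ?_⟩
    rw [inner_add_left, hyk, real_inner_smul_left, add_eq_left] at hk
    exact (mul_eq_zero.1 hk).resolve_left hτ0.ne'
  -- The tangent plane at `y` is covered by its intersections with finitely many planes. A real
  -- vector space is not a finite union of proper subspaces, so one intersection is the whole
  -- tangent plane.
  set p : κ → Submodule ℝ (ℝ ∙ ν)ᗮ := fun k => (ℝ ∙ N k)ᗮ.comap (ℝ ∙ ν)ᗮ.subtype with hp
  have hfin : {q | ∃ k, inner ℝ y (N k) = c k ∧ p k = q}.Finite :=
    (Set.finite_range p).subset fun q ⟨k, _, hk⟩ => ⟨k, hk⟩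
  have htop : (⊤ : Submodule ℝ (ℝ ∙ ν)ᗮ) ∈ hfin.toFinset := by
    by_contra hnot
    refine Subspace.biUnion_ne_univ_of_top_notMem hnot (Set.eq_univ_of_forall fun v => ?_)
    obtain ⟨k, hk, hv⟩ := hW v
    refine Set.mem_iUnion₂.2 ⟨p k, hfin.mem_toFinset.2 ⟨k, hk, rfl⟩, ?_⟩
    exact (Submodule.mem_orthogonal_singleton_iff_inner_left).2 hv
  obtain ⟨k, hk, hpk⟩ := hfin.mem_toFinset.1 htop
  refine ⟨k, hk, ?_⟩
  have hNk : N k ∈ (ℝ ∙ ν)ᗮᗮ := by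
    rw [Submodule.mem_orthogonal]
    intro u hu
    have : (⟨u, hu⟩ : (ℝ ∙ ν)ᗮ) ∈ p k := by rw [hpk]; exact Submodule.mem_top
    exact (Submodule.mem_orthogonal_singleton_iff_inner_left).1 this
  rw [Submodule.orthogonal_orthogonal, Submodule.mem_span_singleton] at hNk
  obtain ⟨a, ha⟩ := hNk
  have habs : |a| = 1 := by
    have := hN k
    rwa [← ha, norm_smul, hν, mul_one, Real.norm_eq_abs] at this
  rcases (abs_eq zero_le_one).1 habs with h1 | h1
  · left; rw [← ha, h1, one_smul]
  · right; rw [← ha, h1, neg_smul, one_smul, neg_neg]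

/-- The double-layer operator of a closed surface that lies in finitely many planes is bounded in
every weighted norm. -/
theorem weightedOpNorm_ne_top {Γ : Set E3} (hΓ : IsClosed Γ) {κ : Type*} [Fintype κ]
    {N : κ → E3} {c : κ → ℝ} (hN : ∀ k, ‖N k‖ = 1) (hcov : ∀ x ∈ Γ, ∃ k, inner ℝ x (N k) = c k)
    {w : Γ → ℝ} (hw : IsWeight Γ w) : weightedOpNorm Γ w (doubleLayer Γ) ≠ ⊤ := by
  obtain ⟨-, b, hb, hwb⟩ := hw
  obtain ⟨C, hC⟩ := exists_abs_density_le (inside Γ)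
  set P : κ → Set E3 := fun k => {y | inner ℝ y (N k) = c k} with hP
  set I : ℝ := ∫ v, poisson 1 v with hI
  have hI0 : 0 ≤ I := integral_nonneg fun v => poisson_nonneg zero_le_one v
  have hC0 : 0 ≤ C := (abs_nonneg _).trans (hC 0)
  have hPm : ∀ k, MeasurableSet (P k) := fun k =>
    (isClosed_eq (f := fun y : E3 => (inner ℝ y (N k) : ℝ)) (by fun_prop)
      continuous_const).measurableSet
  -- The normal at `y` is one of the `± N k` with `y` in the plane `k`, so the kernel of the surface
  -- is dominated by the sum of the kernels of the full planes. The factor `1 / (4π)` is dropped.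
  have hker : ∀ x y : E3, ‖kernel (inside Γ) x y‖ₑ ≤
      ∑ k, (P k).indicator (fun y => ENNReal.ofReal (|inner ℝ (x - y) (N k)| / ‖x - y‖ ^ 3)) y := by
    intro x y
    by_cases hex : ∃ ν, IsOutwardUnitNormal (inside Γ) y ν
    · obtain ⟨ν, hν⟩ := hex
      obtain ⟨k, hk, hνk⟩ := hν.exists_plane hΓ hN hcov
      refine le_trans ?_ (Finset.single_le_sum (fun _ _ => zero_le) (Finset.mem_univ k))
      rw [Set.indicator_of_mem (show y ∈ P k from hk), ← ofReal_norm, kernel, hν.normal_eq]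
      refine ENNReal.ofReal_le_ofReal ?_
      have habs : |inner ℝ (x - y) ν| = |inner ℝ (x - y) (N k)| := by
        rcases hνk with h | h
        · rw [h]
        · rw [h, inner_neg_right, abs_neg]
      rw [norm_div, Real.norm_eq_abs, habs, Real.norm_of_nonneg (by positivity)]
      rcases eq_or_lt_of_le (norm_nonneg (x - y)) with h0 | h0
      · rw [← h0]; simp
      · have h4 : 1 ≤ 4 * Real.pi := by linarith [Real.pi_gt_three]
        gcongr
        exact le_mul_of_one_le_left (by positivity) h4
    · have : kernel (inside Γ) x y = 0 := by
        rw [kernel, normal, dif_neg hex, inner_zero_right, zero_div]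
      rw [this, enorm_zero]
      exact zero_le
  have hkint : ∀ x : E3, ∫⁻ y : Γ, ‖kernel (inside Γ) x y‖ₑ ∂(surf Γ) ≤
      Fintype.card κ * ENNReal.ofReal I := by
    intro x
    have hmk : ∀ k, Measurable fun y : E3 => ENNReal.ofReal (|inner ℝ (x - y) (N k)| / ‖x - y‖ ^ 3) :=
      fun k => by
        refine ENNReal.measurable_ofReal.comp (Measurable.div ?_ ?_)
        · exact Continuous.measurable (by fun_prop)
        · exact Continuous.measurable (by fun_prop)
    calc ∫⁻ y : Γ, ‖kernel (inside Γ) x y‖ₑ ∂(surf Γ)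
        ≤ ∫⁻ y : Γ, ∑ k, (P k).indicator (fun y =>
            ENNReal.ofReal (|inner ℝ (x - y) (N k)| / ‖x - y‖ ^ 3)) y ∂(surf Γ) :=
          lintegral_mono fun y => hker x y
      _ = ∫⁻ y in Γ, ∑ k, (P k).indicator (fun y =>
            ENNReal.ofReal (|inner ℝ (x - y) (N k)| / ‖x - y‖ ^ 3)) y
            ∂(Measure.euclideanHausdorffMeasure 2) := by
          rw [surf, lintegral_subtype_comap hΓ.measurableSet fun y => ∑ k, (P k).indicator (fun y =>
            ENNReal.ofReal (|inner ℝ (x - y) (N k)| / ‖x - y‖ ^ 3)) y]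
      _ ≤ ∫⁻ y, ∑ k, (P k).indicator (fun y =>
            ENNReal.ofReal (|inner ℝ (x - y) (N k)| / ‖x - y‖ ^ 3)) y
            ∂(Measure.euclideanHausdorffMeasure 2) := setLIntegral_le_lintegral _ _
      _ = ∑ k, ∫⁻ y in P k, ENNReal.ofReal (|inner ℝ (x - y) (N k)| / ‖x - y‖ ^ 3)
            ∂(Measure.euclideanHausdorffMeasure 2) := by
          rw [lintegral_finsetSum _ fun k _ => (hmk k).indicator (hPm k)]
          exact Finset.sum_congr rfl fun k _ => lintegral_indicator (hPm k) _
      _ ≤ ∑ _k : κ, ENNReal.ofReal I := Finset.sum_le_sum fun k _ => lintegral_plane_le (hN k) _ x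
      _ = Fintype.card κ * ENNReal.ofReal I := by simp
  have hfin : (Fintype.card κ * ENNReal.ofReal I : ℝ≥0∞) ≠ ⊤ :=
    ENNReal.mul_ne_top (by simp) ENNReal.ofReal_ne_top
  -- `B` bounds the double layer of any density of modulus at most one. The weight enters twice: `w
  -- ≤ 1` bounds the density, and `w ≥ b` costs the factor `1 / b`.
  set B : ℝ := C + 1 / 2 + (Fintype.card κ * ENNReal.ofReal I : ℝ≥0∞).toReal with hB
  refine ne_top_of_le_ne_top (ENNReal.ofReal_ne_top (r := B / b)) (iSup₂_le fun φ hφ => ?_)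
  refine essSup_le_of_ae_le _ ?_
  have hφ1 : ∀ᵐ x ∂(surf Γ), ‖φ x‖ ≤ 1 := by
    filter_upwards [ENNReal.ae_le_essSup (μ := surf Γ) fun x => ‖φ x / (w x : ℂ)‖ₑ, hwb] with x hx hxw
    have hw0 : 0 < w x := hb.trans_le hxw.1
    have := hx.trans hφ
    rw [← ofReal_norm, ENNReal.ofReal_le_one, norm_div, Complex.norm_real,
      Real.norm_of_nonneg hw0.le, div_le_one hw0] at this
    exact this.trans hxw.2
  filter_upwards [hφ1, hwb] with x hx hxw
  have hw0 : 0 < w x := hb.trans_le hxw.1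
  rw [← ofReal_norm, norm_div, Complex.norm_real, Real.norm_of_nonneg hw0.le]
  refine ENNReal.ofReal_le_ofReal ?_
  refine div_le_div₀ (by positivity) ?_ hb hxw.1
  refine (norm_add_le _ _).trans (add_le_add ?_ ?_)
  · rw [norm_smul]
    refine (mul_le_of_le_one_right (norm_nonneg _) hx).trans ?_
    refine (norm_sub_le _ _).trans (add_le_add (hC _) (by norm_num))
  · rw [← ENNReal.ofReal_le_iff_le_toReal hfin, ofReal_norm]
    refine (enorm_integral_le_lintegral_enorm _).trans (le_trans (lintegral_mono_ae ?_) (hkint x))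
    filter_upwards [hφ1] with y hy
    rw [enorm_smul]
    refine mul_le_of_le_one_right zero_le ?_
    rw [← ofReal_norm, ENNReal.ofReal_le_one]
    exact hy


/-! ### Rotated coordinates -/

/-- The first horizontal coordinate after rotation by `-β`. -/
def along (β : ℝ) (x : E3) : ℝ := x 0 * Real.cos β + x 1 * Real.sin β

/-- The second horizontal coordinate after rotation by `-β`. -/
def across (β : ℝ) (x : E3) : ℝ := x 1 * Real.cos β - x 0 * Real.sin β

theorem along_add (β : ℝ) (x y : E3) : along β (x + y) = along β x + along β y := by
  simp [along]; ring

theorem across_add (β : ℝ) (x y : E3) : across β (x + y) = across β x + across β y := by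
  simp [across]; ring

theorem along_smul (β c : ℝ) (x : E3) : along β (c • x) = c * along β x := by
  simp [along]; ring

theorem across_smul (β c : ℝ) (x : E3) : across β (c • x) = c * across β x := by
  simp [across]; ring

theorem continuous_along (β : ℝ) : Continuous (along β) := by
  unfold along; fun_prop

theorem continuous_across (β : ℝ) : Continuous (across β) := by
  unfold across; fun_prop

@[simp] theorem along_zero (β : ℝ) : along β 0 = 0 := by simp [along]

@[simp] theorem across_zero (β : ℝ) : across β 0 = 0 := by simp [across]

@[simp] theorem cyl_apply_two (r φ h : ℝ) : cyl r φ h 2 = h := by simp [cyl]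

theorem along_cyl (β r φ h : ℝ) : along β (cyl r φ h) = r * Real.cos (φ - β) := by
  simp [along, cyl, Real.cos_sub]; ring

theorem across_cyl (β r φ h : ℝ) : across β (cyl r φ h) = r * Real.sin (φ - β) := by
  simp [across, cyl, Real.sin_sub]; ring

theorem ext_coords (β : ℝ) {x y : E3} (h0 : along β x = along β y) (h1 : across β x = across β y)
    (h2 : x 2 = y 2) : x = y := by
  have e0 : ∀ z : E3, z 0 = along β z * Real.cos β - across β z * Real.sin β := fun z => by
    simp only [along, across]; linear_combination (-z 0) * Real.sin_sq_add_cos_sq β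
  have e1 : ∀ z : E3, z 1 = along β z * Real.sin β + across β z * Real.cos β := fun z => by
    simp only [along, across]; linear_combination (-z 1) * Real.sin_sq_add_cos_sq β
  ext i
  fin_cases i
  · change x 0 = y 0; rw [e0, e0 y, h0, h1]
  · change x 1 = y 1; rw [e1, e1 y, h0, h1]
  · exact h2

theorem along_add_angle (β ψ : ℝ) (x : E3) :
    along (β + ψ) x = along β x * Real.cos ψ + across β x * Real.sin ψ := by
  simp only [along, across, Real.cos_add, Real.sin_add]; ring

theorem across_add_angle (β ψ : ℝ) (x : E3) :
    across (β + ψ) x = across β x * Real.cos ψ - along β x * Real.sin ψ := by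
  simp only [along, across, Real.cos_add, Real.sin_add]; ring

/-- The argument measured from `γ₁` lies in `[0, π]` by the first inequality. Were it beyond `γ₂`,
the second form would be the positive sine of an angle in `(0, π)`. Points on the axis have no
argument and receive the angle `γ₁`. -/
theorem exists_polar {γ₁ γ₂ : ℝ} (h12 : γ₁ < γ₂) {x : E3}
    (h1 : 0 ≤ across γ₁ x) (h2 : across γ₂ x ≤ 0) :
    ∃ ρ φ : ℝ, 0 ≤ ρ ∧ γ₁ ≤ φ ∧ φ ≤ γ₂ ∧ x = cyl ρ φ (x 2) := by
  set z : ℂ := ⟨along γ₁ x, across γ₁ x⟩ with hz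
  have hre : ‖z‖ * Real.cos z.arg = along γ₁ x := Complex.norm_mul_cos_arg z
  have him : ‖z‖ * Real.sin z.arg = across γ₁ x := Complex.norm_mul_sin_arg z
  have hx : x = cyl ‖z‖ (γ₁ + z.arg) (x 2) := by
    refine ext_coords γ₁ ?_ ?_ (cyl_apply_two _ _ _).symm
    · rw [along_cyl, add_sub_cancel_left, hre]
    · rw [across_cyl, add_sub_cancel_left, him]
  rcases eq_or_lt_of_le (norm_nonneg z) with h0 | h0
  · refine ⟨0, γ₁, le_rfl, le_rfl, h12.le, ?_⟩
    rw [← h0] at hx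
    rw [hx]
    simp [cyl]
  · have harg : 0 ≤ z.arg := Complex.arg_nonneg_iff.2 h1
    refine ⟨‖z‖, γ₁ + z.arg, h0.le, by linarith, ?_, hx⟩
    by_contra! hlt
    rw [hx, across_cyl] at h2
    have : 0 < Real.sin (γ₁ + z.arg - γ₂) :=
      Real.sin_pos_of_pos_of_lt_pi (by linarith) (by linarith [Complex.arg_le_pi z])
    exact absurd h2 (not_le.2 (mul_pos h0 this))

/-! ### Pages and their sides -/

/-- The sign of a side of a page: `-1` for the front (`false`), `1` for the back (`true`). -/
def sg (b : Bool) : ℝ := if b then 1 else -1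

@[simp] theorem sg_true : sg true = 1 := rfl

@[simp] theorem sg_false : sg false = -1 := rfl

theorem sg_mul_self (b : Bool) : sg b * sg b = 1 := by cases b <;> simp

theorem cos_sg_mul (b : Bool) (ψ : ℝ) : Real.cos (sg b * ψ) = Real.cos ψ := by cases b <;> simp

theorem sin_sg_mul (b : Bool) (ψ : ℝ) : Real.sin (sg b * ψ) = sg b * Real.sin ψ := by
  cases b <;> simp

/-- The angle bisecting page `j`. -/
def mid (θ : ℝ) (n j : ℕ) : ℝ := (2 * j - 3 / 2) * pageAngle θ n

/-- Half the angle of a page. -/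
def half (θ : ℝ) (n : ℕ) : ℝ := pageAngle θ n / 2

/-- The front of the first page and the back of the last one. -/
def IsOuter (n j : ℕ) (b : Bool) : Prop := j = if b then n else 1

instance (n j : ℕ) (b : Bool) : Decidable (IsOuter n j b) := by unfold IsOuter; infer_instance

/-- The widening of a page at the bottom. -/
def sideEta (θ : ℝ) (n j : ℕ) (b : Bool) : ℝ := if IsOuter n j b then 0 else eta θ n

/-- The angle between a page and the middle of the adjacent gap. -/
def gap (θ : ℝ) (n j : ℕ) (b : Bool) : ℝ := if IsOuter n j b then 0 else half θ n

/-- The radius of the inner bottom vertex of a side. -/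
def innerRadius (θ : ℝ) (n j : ℕ) (b : Bool) : ℝ := if IsOuter n j b then 0 else r2 θ n

/-- The radius of the outer bottom vertex of a side. -/
def outerRadius (θ : ℝ) (n j : ℕ) (b : Bool) : ℝ := if IsOuter n j b then r1 θ n else 1

/-- The angle of the top edge of a side. -/
def sideAngle (θ : ℝ) (n j : ℕ) (b : Bool) : ℝ := mid θ n j + sg b * half θ n

/-- The angle of the middle of the gap adjacent to a side. -/
def sectorAngle (θ : ℝ) (n j : ℕ) (b : Bool) : ℝ := mid θ n j + sg b * (half θ n + gap θ n j b)

/-- The outer top vertex of a side. -/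
def topVertex (θ : ℝ) (n j : ℕ) (b : Bool) : E3 := cyl 1 (sideAngle θ n j b) 0

/-- The inner bottom vertex of a side. -/
def innerVertex (θ : ℝ) (n j : ℕ) (b : Bool) : E3 :=
  cyl (innerRadius θ n j b) (sectorAngle θ n j b) (-1)

/-- The outer bottom vertex of a side. -/
def outerVertex (θ : ℝ) (n j : ℕ) (b : Bool) : E3 :=
  cyl (outerRadius θ n j b) (mid θ n j + sg b * (half θ n + sideEta θ n j b)) (-1)

/-- The linear form that vanishes on a side and is negative on the page. -/
def sideForm (θ : ℝ) (n j : ℕ) (b : Bool) (x : E3) : ℝ :=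
  sg b * across (sideAngle θ n j b) x + Real.sin (sideEta θ n j b) * x 2

/-- The linear form that is negative on the sector of page `j` and vanishes on one of its sides. -/
def sectorForm (θ : ℝ) (n j : ℕ) (b : Bool) (x : E3) : ℝ := sg b * across (sectorAngle θ n j b) x

/-- The affine form that vanishes on the end of a page and is negative on the page. -/
def endForm (θ : ℝ) (n j : ℕ) (x : E3) : ℝ :=
  along (mid θ n j) x - Real.cos (half θ n) +
    x 2 * (Real.cos (half θ n + eta θ n) - Real.cos (half θ n))

/-- One of the quadrilateral sides of a page. -/
def sideFace (θ : ℝ) (n j : ℕ) (b : Bool) : Set E3 :=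
  convexHull ℝ {0, topVertex θ n j b, innerVertex θ n j b, outerVertex θ n j b}

/-- The closed part of the polyhedron in the sector of page `j`. -/
def pageSet (θ : ℝ) (n j : ℕ) : Set E3 :=
  {x | (∀ b, sectorForm θ n j b x ≤ 0) ∧ (∀ b, sideForm θ n j b x ≤ 0) ∧ endForm θ n j x ≤ 0 ∧
    -1 ≤ x 2 ∧ x 2 ≤ 0}

theorem sideForm_eq (θ : ℝ) (n j : ℕ) (b : Bool) (x : E3) : sideForm θ n j b x =
    sg b * across (mid θ n j) x * Real.cos (half θ n) - along (mid θ n j) x * Real.sin (half θ n) +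
      Real.sin (sideEta θ n j b) * x 2 := by
  rw [sideForm, sideAngle, across_add_angle, cos_sg_mul, sin_sg_mul]
  linear_combination (-along (mid θ n j) x * Real.sin (half θ n)) * sg_mul_self b

theorem sectorForm_eq (θ : ℝ) (n j : ℕ) (b : Bool) (x : E3) : sectorForm θ n j b x =
    sg b * across (mid θ n j) x * Real.cos (half θ n + gap θ n j b) -
      along (mid θ n j) x * Real.sin (half θ n + gap θ n j b) := by
  rw [sectorForm, sectorAngle, across_add_angle, cos_sg_mul, sin_sg_mul]
  linear_combination (-along (mid θ n j) x * Real.sin (half θ n + gap θ n j b)) * sg_mul_self b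

/-- The two outer sides are vertical and bound the sector themselves: they have neither a gap nor a
widening. -/
theorem sectorForm_eq_sideForm {θ : ℝ} {n j : ℕ} {b : Bool} (h : IsOuter n j b) (x : E3) :
    sectorForm θ n j b x = sideForm θ n j b x := by
  simp [sectorForm, sideForm, sectorAngle, sideAngle, gap, sideEta, h]

theorem continuous_sideForm (θ : ℝ) (n j : ℕ) (b : Bool) : Continuous (sideForm θ n j b) := by
  have := continuous_across (sideAngle θ n j b)
  unfold sideForm; fun_prop

theorem continuous_sectorForm (θ : ℝ) (n j : ℕ) (b : Bool) : Continuous (sectorForm θ n j b) := by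
  have := continuous_across (sectorAngle θ n j b)
  unfold sectorForm; fun_prop

theorem continuous_endForm (θ : ℝ) (n j : ℕ) : Continuous (endForm θ n j) := by
  have := continuous_along (mid θ n j)
  unfold endForm; fun_prop

theorem isClosed_pageSet (θ : ℝ) (n j : ℕ) : IsClosed (pageSet θ n j) := by
  have h1 : Continuous fun x : E3 => x 2 := by fun_prop
  have e : pageSet θ n j = (⋂ b, {x | sectorForm θ n j b x ≤ 0}) ∩ ((⋂ b, {x | sideForm θ n j b x ≤ 0})
      ∩ ({x | endForm θ n j x ≤ 0} ∩ ({x | -1 ≤ x 2} ∩ {x | x 2 ≤ 0}))) := by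
    ext x; simp [pageSet]
  rw [e]
  exact (isClosed_iInter fun b => isClosed_le (continuous_sectorForm θ n j b) continuous_const).inter
    ((isClosed_iInter fun b => isClosed_le (continuous_sideForm θ n j b) continuous_const).inter
    ((isClosed_le (continuous_endForm θ n j) continuous_const).inter
    ((isClosed_le continuous_const h1).inter (isClosed_le h1 continuous_const))))

/-! ### The vertices in terms of pages and sides -/

theorem pageAngle_mul {n : ℕ} (hn : 2 ≤ n) (θ : ℝ) : (2 * n - 1) * pageAngle θ n = θ := by
  have : (2 : ℝ) ≤ n := by exact_mod_cast hn
  rw [pageAngle]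
  field_simp [show (2 * (n : ℝ) - 1) ≠ 0 by linarith]

theorem topFront_eq (θ : ℝ) (n j : ℕ) : topFront θ n j = topVertex θ n j false := by
  rw [topFront, topVertex, sideAngle, mid, half]; congr 1; simp; ring

theorem topBack_eq (θ : ℝ) (n j : ℕ) : topBack θ n j = topVertex θ n j true := by
  rw [topBack, topVertex, sideAngle, mid, half]; congr 1; simp; ring

theorem botInner_eq (θ : ℝ) (n j : ℕ) : botInner θ n j = innerVertex θ n j false := by
  by_cases h : j = 1
  · simp [botInner, innerVertex, innerRadius, IsOuter, h, cyl]
  · simp only [botInner, innerVertex, innerRadius, IsOuter, h, sectorAngle, gap, half, mid]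
    simp only [Bool.false_eq_true, if_false, h, sg_false]
    congr 1; ring

theorem botFront_eq (θ : ℝ) (n j : ℕ) : botFront θ n j = outerVertex θ n j false := by
  by_cases h : j = 1
  · subst h
    simp only [botFront, outerVertex, outerRadius, IsOuter, sideEta, half, mid]
    simp only [Bool.false_eq_true, if_false, if_true, sg_false]
    congr 1; push_cast; ring
  · simp only [botFront, outerVertex, outerRadius, IsOuter, sideEta, half, mid]
    simp only [Bool.false_eq_true, if_false, h, sg_false]
    congr 1; ring

theorem botBack_eq {n : ℕ} (hn : 2 ≤ n) (θ : ℝ) (j : ℕ) : botBack θ n j = outerVertex θ n j true := by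
  by_cases h : j = n
  · subst h
    simp only [botBack, outerVertex, outerRadius, IsOuter, sideEta, half, mid]
    simp only [if_true, sg_true]
    congr 1
    nth_rw 1 [← pageAngle_mul hn θ]
    ring
  · simp only [botBack, outerVertex, outerRadius, IsOuter, sideEta, half, mid]
    simp only [if_true, h, if_false, sg_true]
    congr 1; ring

theorem botNext_eq {n j : ℕ} (hj : 1 ≤ j) (θ : ℝ) : botNext θ n j = innerVertex θ n j true := by
  by_cases h : j = n
  · simp [botNext, botInner, innerVertex, innerRadius, IsOuter, h, cyl]
  · have h' : j ≠ 0 := by omega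
    simp only [botNext, botInner, innerVertex, innerRadius, IsOuter, h, sectorAngle, gap, half, mid]
    simp only [if_true, if_false, h, sg_true, Nat.add_eq_right, h']
    congr 1; push_cast; ring

theorem frontFace_eq (θ : ℝ) (n j : ℕ) : frontFace θ n j = sideFace θ n j false := by
  rw [frontFace, sideFace, topFront_eq, botInner_eq, botFront_eq]

theorem backFace_eq {n j : ℕ} (hn : 2 ≤ n) (hj : 1 ≤ j) (θ : ℝ) :
    backFace θ n j = sideFace θ n j true := by
  rw [backFace, sideFace, topBack_eq, botBack_eq hn, botNext_eq hj]
  congr 1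
  ext x
  simp only [Set.mem_insert_iff, Set.mem_singleton_iff]
  tauto

/-! ### Elementary estimates for the parameters -/

theorem half_pos {θ : ℝ} (hθ : 0 < θ) {n : ℕ} (hn : 2 ≤ n) : 0 < half θ n := by
  have : (2 : ℝ) ≤ n := by exact_mod_cast hn
  have : 0 < pageAngle θ n := div_pos hθ (by linarith)
  unfold half; positivity

theorem half_mul_le {θ : ℝ} (hθ : 0 < θ) {n : ℕ} (hn : 2 ≤ n) : 6 * half θ n ≤ θ := by
  have h := pageAngle_mul hn θ
  have h2 : (2 : ℝ) ≤ n := by exact_mod_cast hn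
  have := half_pos hθ hn
  have e : pageAngle θ n = 2 * half θ n := by unfold half; ring
  rw [e] at h
  nlinarith

theorem eta_eq (θ : ℝ) (n : ℕ) : eta θ n = θ / (2 * Real.pi) * half θ n := by
  unfold eta half
  field_simp
  norm_num

theorem eta_pos {θ : ℝ} (hθ : 0 < θ) {n : ℕ} (hn : 2 ≤ n) : 0 < eta θ n := by
  rw [eta_eq]
  have := half_pos hθ hn
  have := Real.pi_pos
  positivity

theorem eta_le {θ : ℝ} (hθ : 0 < θ) (hθ' : θ ≤ Real.pi / 4) {n : ℕ} (hn : 2 ≤ n) :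
    8 * eta θ n ≤ half θ n := by
  rw [eta_eq]
  have h1 := half_pos hθ hn
  have h2 : θ / (2 * Real.pi) ≤ 1 / 8 := by
    rw [div_le_iff₀ (by positivity)]; linarith
  nlinarith


/-! ### Convex combinations and admissible parameters. -/

theorem combination_mem_convexHull {p q r t : E3} {a b c d : ℝ} (ha : 0 ≤ a) (hb : 0 ≤ b)
    (hc : 0 ≤ c) (hd : 0 ≤ d) (h : a + b + c + d = 1) :
    a • p + b • q + c • r + d • t ∈ convexHull ℝ ({p, q, r, t} : Set E3) := by
  have := (convex_convexHull ℝ ({p, q, r, t} : Set E3)).sum_mem (t := Finset.univ)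
    (w := ![a, b, c, d]) (z := ![p, q, r, t]) (by
      intro i _; fin_cases i <;> assumption) (by simp [Fin.sum_univ_four, h]) (by
      intro i _
      refine subset_convexHull ℝ _ ?_
      fin_cases i <;> simp)
  simpa [Fin.sum_univ_four] using this

theorem combination_mem_convexHull_three {p q r : E3} {a b c : ℝ} (ha : 0 ≤ a) (hb : 0 ≤ b)
    (hc : 0 ≤ c) (h : a + b + c = 1) :
    a • p + b • q + c • r ∈ convexHull ℝ ({p, q, r} : Set E3) := by
  have := combination_mem_convexHull (p := p) (q := q) (r := r) (t := r) ha hb hc le_rfl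
    (by rw [h, add_zero])
  simpa using this

theorem exists_eq_combination {l u h : ℝ} (h1 : l ≤ u) (h2 : u ≤ h) :
    ∃ t : ℝ, 0 ≤ t ∧ t ≤ 1 ∧ u = (1 - t) * l + t * h := by
  rcases eq_or_lt_of_le (h1.trans h2) with he | hlt
  · exact ⟨0, le_rfl, zero_le_one, by linarith⟩
  · have : 0 < h - l := by linarith
    refine ⟨(u - l) / (h - l), by apply div_nonneg <;> linarith, ?_, ?_⟩
    · rw [div_le_one this]; linarith
    · field_simp; ring

/-- The parameters of an open book are admissible. -/
structure Admissible (θ : ℝ) (n : ℕ) : Prop where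
  pos : 0 < θ
  le : θ ≤ Real.pi / 4
  two_le : 2 ≤ n

variable {θ : ℝ} {n : ℕ}

namespace Admissible

theorem half_pos (hA : Admissible θ n) : 0 < half θ n := OpenBook.half_pos hA.pos hA.two_le

theorem half_le (hA : Admissible θ n) : half θ n ≤ Real.pi / 24 := by
  have := half_mul_le hA.pos hA.two_le
  linarith [hA.le]

theorem eta_pos (hA : Admissible θ n) : 0 < eta θ n := OpenBook.eta_pos hA.pos hA.two_le

theorem eta_le (hA : Admissible θ n) : 8 * eta θ n ≤ half θ n := OpenBook.eta_le hA.pos hA.le hA.two_le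

theorem sin_pos (_hA : Admissible θ n) {ψ : ℝ} (h0 : 0 < ψ) (h1 : ψ ≤ Real.pi / 2) : 0 < Real.sin ψ :=
  Real.sin_pos_of_pos_of_lt_pi h0 (by linarith [Real.pi_pos])

theorem sin_half_pos (hA : Admissible θ n) : 0 < Real.sin (half θ n) :=
  hA.sin_pos hA.half_pos (by linarith [hA.half_le, Real.pi_pos])

theorem cos_half_pos (hA : Admissible θ n) : 0 < Real.cos (half θ n) :=
  Real.cos_pos_of_mem_Ioo ⟨by linarith [hA.half_pos, Real.pi_pos],
    by linarith [hA.half_le, Real.pi_pos]⟩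

theorem cos_half_add_eta_pos (hA : Admissible θ n) : 0 < Real.cos (half θ n + eta θ n) :=
  Real.cos_pos_of_mem_Ioo ⟨by linarith [hA.half_pos, hA.eta_pos, Real.pi_pos],
    by linarith [hA.half_le, hA.eta_le, hA.half_pos, Real.pi_pos]⟩

theorem sin_eta_pos (hA : Admissible θ n) : 0 < Real.sin (eta θ n) :=
  hA.sin_pos hA.eta_pos (by linarith [hA.half_pos, hA.eta_le, hA.half_le, Real.pi_pos])

theorem gap_nonneg (hA : Admissible θ n) (j : ℕ) (b : Bool) : 0 ≤ gap θ n j b := by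
  unfold gap; split_ifs; exacts [le_rfl, hA.half_pos.le]

theorem gap_le (hA : Admissible θ n) (j : ℕ) (b : Bool) : gap θ n j b ≤ half θ n := by
  unfold gap; split_ifs; exacts [hA.half_pos.le, le_rfl]

theorem sideEta_nonneg (hA : Admissible θ n) (j : ℕ) (b : Bool) : 0 ≤ sideEta θ n j b := by
  unfold sideEta; split_ifs; exacts [le_rfl, hA.eta_pos.le]

theorem sideEta_le (hA : Admissible θ n) (j : ℕ) (b : Bool) : sideEta θ n j b ≤ eta θ n := by
  unfold sideEta; split_ifs; exacts [hA.eta_pos.le, le_rfl]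

theorem sideEta_le_gap (hA : Admissible θ n) (j : ℕ) (b : Bool) : sideEta θ n j b ≤ gap θ n j b := by
  unfold sideEta gap; split_ifs; exacts [le_rfl, by linarith [hA.eta_le, hA.eta_pos]]

theorem sin_sideEta_nonneg (hA : Admissible θ n) (j : ℕ) (b : Bool) :
    0 ≤ Real.sin (sideEta θ n j b) := by
  unfold sideEta; split_ifs; exacts [by simp, hA.sin_eta_pos.le]

theorem r2_mul (hA : Admissible θ n) : r2 θ n * Real.sin (half θ n) = Real.sin (eta θ n) := by
  unfold r2
  have := hA.sin_half_pos
  exact div_mul_cancel₀ _ this.ne'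

theorem r2_nonneg (hA : Admissible θ n) : 0 ≤ r2 θ n := by
  have := hA.sin_half_pos
  have := hA.sin_eta_pos
  exact div_nonneg hA.sin_eta_pos.le hA.sin_half_pos.le

theorem r2_le_one (hA : Admissible θ n) : r2 θ n ≤ 1 := by
  refine (div_le_one hA.sin_half_pos).2 (Real.sin_le_sin_of_le_of_le_pi_div_two ?_ ?_ ?_)
  · linarith [hA.eta_pos, Real.pi_pos]
  · exact (by linarith [hA.half_le, Real.pi_pos] : half θ n ≤ Real.pi / 2)
  · exact (by linarith [hA.eta_le, hA.eta_pos] : eta θ n ≤ half θ n)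

theorem r1_mul (hA : Admissible θ n) :
    r1 θ n * Real.cos (half θ n) = Real.cos (half θ n + eta θ n) :=
  div_mul_cancel₀ _ hA.cos_half_pos.ne'

theorem r1_pos (hA : Admissible θ n) : 0 < r1 θ n := div_pos hA.cos_half_add_eta_pos hA.cos_half_pos

theorem innerRadius_nonneg (hA : Admissible θ n) (j : ℕ) (b : Bool) : 0 ≤ innerRadius θ n j b := by
  unfold innerRadius; split_ifs; exacts [le_rfl, hA.r2_nonneg]

theorem outerRadius_pos (hA : Admissible θ n) (j : ℕ) (b : Bool) : 0 < outerRadius θ n j b := by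
  unfold outerRadius; split_ifs; exacts [hA.r1_pos, one_pos]

/-- This identity, by the choice of `r2`, puts the inner bottom vertex on the plane of the side. The
next two put the outer bottom vertex on the plane of the end, by the choice of `r1`, and on the
plane of the side. -/
theorem innerRadius_mul (hA : Admissible θ n) (j : ℕ) (b : Bool) :
    innerRadius θ n j b * Real.sin (gap θ n j b) = Real.sin (sideEta θ n j b) := by
  unfold innerRadius gap sideEta; split_ifs; exacts [by simp, hA.r2_mul]

theorem outerRadius_mul (hA : Admissible θ n) (j : ℕ) (b : Bool) :
    outerRadius θ n j b * Real.cos (half θ n + sideEta θ n j b) =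
      Real.cos (half θ n + eta θ n) := by
  unfold outerRadius sideEta; split_ifs
  · rw [add_zero, hA.r1_mul]
  · rw [one_mul]

theorem outerRadius_mul_sin (θ : ℝ) (n j : ℕ) (b : Bool) :
    outerRadius θ n j b * Real.sin (sideEta θ n j b) = Real.sin (sideEta θ n j b) := by
  unfold outerRadius sideEta; split_ifs <;> simp

end Admissible

/-! ### The faces are contained in the pages -/

theorem cyl_zero (φ h : ℝ) : cyl 0 φ h = !₂[0, 0, h] := by simp [cyl]

theorem sideForm_comb (θ : ℝ) (n j : ℕ) (b : Bool) (a c : ℝ) (x y : E3) :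
    sideForm θ n j b (a • x + c • y) = a * sideForm θ n j b x + c * sideForm θ n j b y := by
  simp [sideForm, across_add, across_smul]; ring

theorem sectorForm_comb (θ : ℝ) (n j : ℕ) (b : Bool) (a c : ℝ) (x y : E3) :
    sectorForm θ n j b (a • x + c • y) = a * sectorForm θ n j b x + c * sectorForm θ n j b y := by
  simp [sectorForm, across_add, across_smul]; ring

theorem endForm_comb (θ : ℝ) (n j : ℕ) {a c : ℝ} (h : a + c = 1) (x y : E3) :
    endForm θ n j (a • x + c • y) = a * endForm θ n j x + c * endForm θ n j y := by
  simp only [endForm, along_add, along_smul, PiLp.add_apply, PiLp.smul_apply, smul_eq_mul]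
  linear_combination (Real.cos (half θ n)) * h

theorem convex_pageSet (θ : ℝ) (n j : ℕ) : Convex ℝ (pageSet θ n j) := by
  rintro x ⟨hx1, hx2, hx3, hx4, hx5⟩ y ⟨hy1, hy2, hy3, hy4, hy5⟩ a c ha hc h
  refine ⟨fun b => ?_, fun b => ?_, ?_, ?_, ?_⟩
  · rw [sectorForm_comb]; nlinarith [hx1 b, hy1 b]
  · rw [sideForm_comb]; nlinarith [hx2 b, hy2 b]
  · rw [endForm_comb θ n j h]; nlinarith
  · simp only [PiLp.add_apply, PiLp.smul_apply, smul_eq_mul]; nlinarith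
  · simp only [PiLp.add_apply, PiLp.smul_apply, smul_eq_mul]; nlinarith

/-- For `ψ ≥ 0` the point lies in the half of the page next to the side `b`, where the conditions
for the opposite side hold automatically. Only the side `b` and the end have to be checked. -/
theorem cyl_mem_pageSet (hA : Admissible θ n) {j : ℕ} {b : Bool} {r ψ h : ℝ} (hr : 0 ≤ r)
    (hψ : 0 ≤ ψ) (hψ' : ψ ≤ half θ n + gap θ n j b)
    (hside : r * Real.sin (ψ - half θ n) + Real.sin (sideEta θ n j b) * h ≤ 0)
    (hend : r * Real.cos ψ - Real.cos (half θ n) +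
      h * (Real.cos (half θ n + eta θ n) - Real.cos (half θ n)) ≤ 0) (h1 : -1 ≤ h) (h0 : h ≤ 0) :
    cyl r (mid θ n j + sg b * ψ) h ∈ pageSet θ n j := by
  have hπ := Real.pi_pos
  have hα := hA.half_pos
  have hα' := hA.half_le
  have hX : along (mid θ n j) (cyl r (mid θ n j + sg b * ψ) h) = r * Real.cos ψ := by
    rw [along_cyl, add_sub_cancel_left, cos_sg_mul]
  have hY : across (mid θ n j) (cyl r (mid θ n j + sg b * ψ) h) = r * (sg b * Real.sin ψ) := by
    rw [across_cyl, add_sub_cancel_left, sin_sg_mul]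
  have hother : ∀ b', b' ≠ b → sg b' * sg b = -1 := by
    intro b' hb; cases b <;> cases b' <;> simp_all
  refine ⟨fun b' => ?_, fun b' => ?_, ?_, ?_, ?_⟩
  · have hg := hA.gap_le j b'
    have hg0 := hA.gap_nonneg j b'
    have hgb := hA.gap_le j b
    rw [sectorForm_eq, hX, hY]
    by_cases hb : b' = b
    · subst hb
      have : sg b' * (r * (sg b' * Real.sin ψ)) * Real.cos (half θ n + gap θ n j b') -
          r * Real.cos ψ * Real.sin (half θ n + gap θ n j b') =
          r * Real.sin (ψ - (half θ n + gap θ n j b')) := by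
        rw [Real.sin_sub]
        linear_combination (r * Real.sin ψ * Real.cos (half θ n + gap θ n j b')) * sg_mul_self b'
      rw [this]
      exact mul_nonpos_of_nonneg_of_nonpos hr
        (Real.sin_nonpos_of_nonpos_of_neg_pi_le (by linarith) (by linarith))
    · have : sg b' * (r * (sg b * Real.sin ψ)) * Real.cos (half θ n + gap θ n j b') -
          r * Real.cos ψ * Real.sin (half θ n + gap θ n j b') =
          -(r * Real.sin (ψ + (half θ n + gap θ n j b'))) := by
        rw [Real.sin_add ψ]
        linear_combination (r * Real.sin ψ * Real.cos (half θ n + gap θ n j b')) * hother b' hb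
      rw [this, neg_nonpos]
      exact mul_nonneg hr (Real.sin_nonneg_of_nonneg_of_le_pi (by linarith) (by linarith))
  · have hgb := hA.gap_le j b
    rw [sideForm_eq, hX, hY, cyl_apply_two]
    by_cases hb : b' = b
    · subst hb
      have : sg b' * (r * (sg b' * Real.sin ψ)) * Real.cos (half θ n) -
          r * Real.cos ψ * Real.sin (half θ n) = r * Real.sin (ψ - half θ n) := by
        rw [Real.sin_sub]
        linear_combination (r * Real.sin ψ * Real.cos (half θ n)) * sg_mul_self b'
      rw [this]
      exact hside
    · have : sg b' * (r * (sg b * Real.sin ψ)) * Real.cos (half θ n) -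
          r * Real.cos ψ * Real.sin (half θ n) = -(r * Real.sin (ψ + half θ n)) := by
        rw [Real.sin_add]
        linear_combination (r * Real.sin ψ * Real.cos (half θ n)) * hother b' hb
      rw [this]
      have h1 := mul_nonneg hr (Real.sin_nonneg_of_nonneg_of_le_pi (x := ψ + half θ n)
        (by linarith) (by linarith))
      have h2 := mul_nonneg (hA.sin_sideEta_nonneg j b') (neg_nonneg.2 h0)
      linarith
  · rw [endForm, hX, cyl_apply_two]
    exact hend
  · rwa [cyl_apply_two]
  · rwa [cyl_apply_two]

theorem topVertex_mem (hA : Admissible θ n) (j : ℕ) (b : Bool) :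
    topVertex θ n j b ∈ pageSet θ n j :=
  cyl_mem_pageSet hA zero_le_one hA.half_pos.le (by linarith [hA.gap_nonneg j b]) (by simp)
    (by simp) (by norm_num) le_rfl

theorem cyl_zero_mem (hA : Admissible θ n) (j : ℕ) (φ : ℝ) {h : ℝ} (h1 : -1 ≤ h) (h0 : h ≤ 0) :
    cyl 0 φ h ∈ pageSet θ n j := by
  have e : cyl 0 φ h = cyl 0 (mid θ n j + sg true * 0) h := by rw [cyl_zero, cyl_zero]
  have hs := mul_nonneg (hA.sin_sideEta_nonneg j true) (neg_nonneg.2 h0)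
  rw [e]
  refine cyl_mem_pageSet hA le_rfl le_rfl (by linarith [hA.gap_nonneg j true, hA.half_pos])
    (by linarith) ?_ h1 h0
  have := hA.cos_half_pos
  have := hA.cos_half_add_eta_pos
  nlinarith

theorem zero_mem_pageSet (hA : Admissible θ n) (j : ℕ) : (0 : E3) ∈ pageSet θ n j := by
  have h := cyl_zero_mem hA j 0 (h := 0) (by norm_num) le_rfl
  rwa [show cyl 0 0 0 = 0 by ext i; fin_cases i <;> simp [cyl]] at h

theorem innerVertex_mem (hA : Admissible θ n) (j : ℕ) (b : Bool) :
    innerVertex θ n j b ∈ pageSet θ n j := by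
  have hg := hA.gap_nonneg j b
  have hα := hA.half_pos
  refine cyl_mem_pageSet hA (hA.innerRadius_nonneg j b) (by linarith) le_rfl ?_ ?_ le_rfl (by norm_num)
  · rw [add_sub_cancel_left, hA.innerRadius_mul]; linarith
  · have hc := hA.cos_half_add_eta_pos
    have : innerRadius θ n j b * Real.cos (half θ n + gap θ n j b) ≤
        Real.cos (half θ n + eta θ n) := by
      unfold innerRadius gap
      split_ifs
      · rw [zero_mul]; exact hc.le
      · have h1 : Real.cos (half θ n + half θ n) ≤ Real.cos (half θ n + eta θ n) :=
          Real.cos_le_cos_of_nonneg_of_le_pi (by linarith [hA.eta_pos])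
            (by linarith [hA.half_le, Real.pi_pos]) (by linarith [hA.eta_le, hA.eta_pos])
        have h2 : 0 ≤ Real.cos (half θ n + half θ n) := Real.cos_nonneg_of_mem_Icc
          ⟨by linarith [Real.pi_pos], by linarith [hA.half_le, Real.pi_pos]⟩
        exact (mul_le_of_le_one_left h2 hA.r2_le_one).trans h1
    linarith

theorem outerVertex_mem (hA : Admissible θ n) (j : ℕ) (b : Bool) :
    outerVertex θ n j b ∈ pageSet θ n j := by
  have hg := hA.sideEta_nonneg j b
  have hα := hA.half_pos
  refine cyl_mem_pageSet hA (hA.outerRadius_pos j b).le (by linarith)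
    (by linarith [hA.sideEta_le_gap j b]) ?_ ?_ le_rfl (by norm_num)
  · rw [add_sub_cancel_left, Admissible.outerRadius_mul_sin]; linarith
  · rw [hA.outerRadius_mul]; linarith

theorem sideForm_topVertex (θ : ℝ) (n j : ℕ) (b : Bool) :
    sideForm θ n j b (topVertex θ n j b) = 0 := by
  simp [sideForm, topVertex, across_cyl]

theorem sideForm_innerVertex (hA : Admissible θ n) (j : ℕ) (b : Bool) :
    sideForm θ n j b (innerVertex θ n j b) = 0 := by
  have e : sectorAngle θ n j b - sideAngle θ n j b = sg b * gap θ n j b := by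
    unfold sectorAngle sideAngle; ring
  rw [sideForm, innerVertex, across_cyl, cyl_apply_two, e, sin_sg_mul]
  linear_combination (innerRadius θ n j b * Real.sin (gap θ n j b)) * sg_mul_self b +
    hA.innerRadius_mul j b

theorem sideForm_outerVertex (θ : ℝ) (n j : ℕ) (b : Bool) :
    sideForm θ n j b (outerVertex θ n j b) = 0 := by
  have e : mid θ n j + sg b * (half θ n + sideEta θ n j b) - sideAngle θ n j b =
      sg b * sideEta θ n j b := by
    unfold sideAngle; ring
  rw [sideForm, outerVertex, across_cyl, cyl_apply_two, e, sin_sg_mul]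
  linear_combination (outerRadius θ n j b * Real.sin (sideEta θ n j b)) * sg_mul_self b +
    Admissible.outerRadius_mul_sin θ n j b

theorem endForm_topVertex (θ : ℝ) (n j : ℕ) (b : Bool) : endForm θ n j (topVertex θ n j b) = 0 := by
  simp [endForm, topVertex, along_cyl, sideAngle, cos_sg_mul]

theorem endForm_outerVertex (hA : Admissible θ n) (j : ℕ) (b : Bool) :
    endForm θ n j (outerVertex θ n j b) = 0 := by
  rw [endForm, outerVertex, along_cyl, cyl_apply_two, add_sub_cancel_left, cos_sg_mul,
    hA.outerRadius_mul]
  ring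

/-- The part of the boundary of the polyhedron in a page. -/
def pageBoundary (θ : ℝ) (n j : ℕ) : Set E3 :=
  {x ∈ pageSet θ n j | x 2 = 0 ∨ x 2 = -1 ∨ endForm θ n j x = 0 ∨ ∃ b, sideForm θ n j b x = 0}

/-- The four vertices satisfy the inequalities of the page and the equation of the side; both are
preserved by convex combinations. -/
theorem sideFace_subset (hA : Admissible θ n) (j : ℕ) (b : Bool) :
    sideFace θ n j b ⊆ pageBoundary θ n j := by
  have hconv : Convex ℝ {x | x ∈ pageSet θ n j ∧ sideForm θ n j b x = 0} := by
    rintro x ⟨hx, hx'⟩ y ⟨hy, hy'⟩ a c ha hc h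
    exact ⟨convex_pageSet θ n j hx hy ha hc h, by rw [sideForm_comb, hx', hy']; simp⟩
  refine (convexHull_min ?_ hconv).trans fun x hx => ⟨hx.1, Or.inr (Or.inr (Or.inr ⟨b, hx.2⟩))⟩
  rintro x (rfl | rfl | rfl | rfl)
  · exact ⟨zero_mem_pageSet hA j, by simp [sideForm]⟩
  · exact ⟨topVertex_mem hA j b, sideForm_topVertex θ n j b⟩
  · exact ⟨innerVertex_mem hA j b, sideForm_innerVertex hA j b⟩
  · exact ⟨outerVertex_mem hA j b, sideForm_outerVertex θ n j b⟩

theorem endFace_subset (hA : Admissible θ n) (j : ℕ) : endFace θ n j ⊆ pageBoundary θ n j := by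
  have hconv : Convex ℝ {x | x ∈ pageSet θ n j ∧ endForm θ n j x = 0} := by
    rintro x ⟨hx, hx'⟩ y ⟨hy, hy'⟩ a c ha hc h
    exact ⟨convex_pageSet θ n j hx hy ha hc h, by rw [endForm_comb θ n j h, hx', hy']; simp⟩
  rw [endFace, topFront_eq, topBack_eq, botFront_eq, botBack_eq hA.two_le]
  refine (convexHull_min ?_ hconv).trans fun x hx => ⟨hx.1, Or.inr (Or.inr (Or.inl hx.2))⟩
  rintro x (rfl | rfl | rfl | rfl)
  · exact ⟨topVertex_mem hA j _, endForm_topVertex θ n j _⟩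
  · exact ⟨topVertex_mem hA j _, endForm_topVertex θ n j _⟩
  · exact ⟨outerVertex_mem hA j _, endForm_outerVertex hA j _⟩
  · exact ⟨outerVertex_mem hA j _, endForm_outerVertex hA j _⟩

theorem convex_level (h : ℝ) (j : ℕ) : Convex ℝ {x | x ∈ pageSet θ n j ∧ x 2 = h} := by
  rintro x ⟨hx, hx'⟩ y ⟨hy, hy'⟩ a c ha hc hac
  refine ⟨convex_pageSet θ n j hx hy ha hc hac, ?_⟩
  simp only [PiLp.add_apply, PiLp.smul_apply, smul_eq_mul, hx', hy']
  rw [← add_mul, hac, one_mul]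

theorem bookSurface_subset (hA : Admissible θ n) :
    bookSurface θ n ⊆ ⋃ j ∈ Set.Icc 1 n, pageBoundary θ n j := by
  have hz : botInner θ n 1 = cyl 0 0 (-1) := by simp [botInner]
  rintro x ((hx | hx) | hx)
  · obtain ⟨j, hj, hx⟩ := Set.mem_iUnion₂.1 hx
    refine Set.mem_iUnion₂.2 ⟨j, hj, ?_⟩
    rw [topFront_eq, topBack_eq] at hx
    have := convexHull_min (t := {x | x ∈ pageSet θ n j ∧ x 2 = 0}) ?_ (convex_level 0 j) hx
    · exact ⟨this.1, Or.inl this.2⟩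
    · rintro x (rfl | rfl | rfl)
      · exact ⟨zero_mem_pageSet hA j, rfl⟩
      · exact ⟨topVertex_mem hA j _, by simp [topVertex]⟩
      · exact ⟨topVertex_mem hA j _, by simp [topVertex]⟩
  · obtain ⟨j, hj, hx⟩ := Set.mem_iUnion₂.1 hx
    refine Set.mem_iUnion₂.2 ⟨j, hj, ?_⟩
    have hsub : x ∈ {x | x ∈ pageSet θ n j ∧ x 2 = -1} := by
      have h1 : botInner θ n 1 ∈ {x | x ∈ pageSet θ n j ∧ x 2 = -1} := by
        rw [hz]; exact ⟨cyl_zero_mem hA j 0 le_rfl (by norm_num), by simp⟩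
      have h2 : ∀ b, innerVertex θ n j b ∈ {x | x ∈ pageSet θ n j ∧ x 2 = -1} := fun b =>
        ⟨innerVertex_mem hA j b, by simp [innerVertex]⟩
      have h3 : ∀ b, outerVertex θ n j b ∈ {x | x ∈ pageSet θ n j ∧ x 2 = -1} := fun b =>
        ⟨outerVertex_mem hA j b, by simp [outerVertex]⟩
      rw [botInner_eq θ n j, botFront_eq, botBack_eq hA.two_le, botNext_eq hj.1] at hx
      rcases hx with (hx | hx) | hx <;> refine convexHull_min ?_ (convex_level (-1) j) hx <;>
        rintro x (rfl | rfl | rfl)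
      exacts [h1, h2 _, h3 _, h1, h3 _, h3 _, h1, h3 _, h2 _]
    exact ⟨hsub.1, Or.inr (Or.inl hsub.2)⟩
  · obtain ⟨j, hj, hx⟩ := Set.mem_iUnion₂.1 hx
    refine Set.mem_iUnion₂.2 ⟨j, hj, ?_⟩
    rcases hx with (hx | hx) | hx
    · rw [frontFace_eq] at hx; exact sideFace_subset hA j _ hx
    · exact endFace_subset hA j hx
    · rw [backFace_eq hA.two_le hj.1] at hx; exact sideFace_subset hA j _ hx


/-! ### The boundary of the pages is contained in the faces -/

/-- A horizontal slice of the side is a segment whose ends interpolate linearly between the top edge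
and the bottom edge. The end inequality bounds the position `u` from above, the sector inequalities
bound it from below, and the resulting parameter `t`, together with the height, gives the four
convex weights. -/
theorem mem_sideFace (hA : Admissible θ n) {j : ℕ} {b : Bool} {x : E3} (hx : x ∈ pageSet θ n j)
    (h0 : sideForm θ n j b x = 0) : x ∈ sideFace θ n j b := by
  obtain ⟨hsec, hside, hend, hx1, hx0⟩ := hx
  set A := sideAngle θ n j b with hAdef
  set u := along A x with hu
  set o := Real.sin (sideEta θ n j b) with ho
  set δ := gap θ n j b with hδ
  have hα := hA.half_pos
  have hα' := hA.half_le
  have hπ := Real.pi_pos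
  have hcos := hA.cos_half_pos
  have hsg := sg_mul_self b
  have hv : across A x = -(sg b * o * x 2) := by
    rw [sideForm] at h0
    linear_combination (sg b) * h0 - (across A x) * hsg
  have hmid : mid θ n j = A + -(sg b * half θ n) := by rw [hAdef, sideAngle]; ring
  have hin := hA.innerRadius_mul j b
  have hout := hA.outerRadius_mul j b
  have houts := Admissible.outerRadius_mul_sin θ n j b
  set rin := innerRadius θ n j b
  set rf := outerRadius θ n j b
  set ηs := sideEta θ n j b
  have hup : u ≤ (1 + x 2) + -(x 2) * (rf * Real.cos ηs) := by
    rw [endForm, hmid, along_add_angle, Real.cos_neg, Real.sin_neg, cos_sg_mul, sin_sg_mul, hv] at hend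
    rw [← hout, Real.cos_add] at hend
    have e : sg b * o * x 2 * (sg b * Real.sin (half θ n)) = o * x 2 * Real.sin (half θ n) := by
      linear_combination (o * x 2 * Real.sin (half θ n)) * hsg
    have e2 : rf * (Real.cos (half θ n) * Real.cos ηs - Real.sin (half θ n) * Real.sin ηs) =
        rf * Real.cos ηs * Real.cos (half θ n) - o * Real.sin (half θ n) := by
      linear_combination (-Real.sin (half θ n)) * houts
    rw [e2] at hend
    refine le_of_mul_le_mul_right ?_ hcos
    nlinarith
  have hlow : -(x 2) * (rin * Real.cos δ) ≤ u := by
    -- On an outer side the lower bound is `0`, and it comes from the sector plane on the opposite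
    -- side of the page. On any other side it comes from the middle of the adjacent gap, which the
    -- side meets in its inner edge.
    by_cases hO : IsOuter n j b
    · have hrin : rin = 0 := if_pos hO
      have hηs : ηs = 0 := if_pos hO
      have ho0 : o = 0 := by rw [ho, hηs, Real.sin_zero]
      rw [hrin, zero_mul, mul_zero]
      have h1 := hsec (!b)
      have hg := hA.gap_nonneg j (!b)
      have hg' := hA.gap_le j (!b)
      have e1 : sectorAngle θ n j (!b) = A + -(sg b * (2 * half θ n + gap θ n j (!b))) := by
        rw [hAdef, sectorAngle, sideAngle]; cases b <;> simp <;> ring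
      have e2 : sg (!b) = -sg b := by cases b <;> simp
      rw [sectorForm, e1, e2, across_add_angle, Real.sin_neg, sin_sg_mul, hv, ho0] at h1
      have h2 : 0 < Real.sin (2 * half θ n + gap θ n j (!b)) :=
        Real.sin_pos_of_pos_of_lt_pi (by linarith) (by linarith)
      have h3 : -(u * Real.sin (2 * half θ n + gap θ n j (!b))) ≤ 0 := by
        refine le_trans (le_of_eq ?_) h1
        rw [← hu]
        linear_combination (u * Real.sin (2 * half θ n + gap θ n j (!b))) * hsg
      by_contra! hneg
      nlinarith
    · have h1 := hsec b
      have hδ' : δ = half θ n := if_neg hO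
      have e1 : sectorAngle θ n j b = A + sg b * δ := by
        rw [hAdef, sectorAngle, sideAngle]; ring
      rw [sectorForm, e1, across_add_angle, cos_sg_mul, sin_sg_mul, hv] at h1
      have h2 : 0 < Real.sin δ := by rw [hδ']; exact hA.sin_half_pos
      have h3 : -(o * x 2 * Real.cos δ) - u * Real.sin δ ≤ 0 := by
        refine le_trans (le_of_eq ?_) h1
        rw [← hu]
        linear_combination (o * x 2 * Real.cos δ + u * Real.sin δ) * hsg
      have hin' : rin * Real.sin δ = o := hin
      rw [← hin'] at h3
      refine le_of_mul_le_mul_right ?_ h2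
      nlinarith
  obtain ⟨t, ht0, ht1, ht⟩ := exists_eq_combination hlow hup
  have hcomb := combination_mem_convexHull (p := 0) (q := topVertex θ n j b)
    (r := innerVertex θ n j b) (t := outerVertex θ n j b) (a := (1 - t) * (1 + x 2))
    (b := t * (1 + x 2)) (c := (1 - t) * -(x 2)) (d := t * -(x 2))
    (mul_nonneg (by linarith) (by linarith)) (mul_nonneg ht0 (by linarith))
    (mul_nonneg (by linarith) (by linarith)) (mul_nonneg ht0 (by linarith)) (by ring)
  have ein : sectorAngle θ n j b - A = sg b * δ := by
    rw [hAdef, sectorAngle, sideAngle]; ring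
  have eout : mid θ n j + sg b * (half θ n + sideEta θ n j b) - A = sg b * ηs := by
    rw [hAdef, sideAngle]; ring
  refine Set.mem_of_eq_of_mem (ext_coords A ?_ ?_ ?_) hcomb
  · simp only [along_add, along_smul, along_zero, topVertex, innerVertex, outerVertex, along_cyl, ein,
      eout, cos_sg_mul, ← hAdef, sub_self, Real.cos_zero]
    rw [← hu, ht]
    ring
  · simp only [across_add, across_smul, across_zero, topVertex, innerVertex, outerVertex, across_cyl,
      ein, eout, sin_sg_mul, ← hAdef, sub_self, Real.sin_zero]
    rw [hv]
    change _ = _ + (1 - t) * -x 2 * (rin * (sg b * Real.sin δ)) +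
      t * -x 2 * (rf * (sg b * Real.sin ηs))
    linear_combination (sg b * (1 - t) * x 2) * hin + (sg b * t * x 2) * houts
  · simp [topVertex, innerVertex, outerVertex]
    ring

/-- Here the horizontal slices run between the two sides of the page, and the two side inequalities
bound the transverse coordinate. -/
theorem mem_endFace (hA : Admissible θ n) {j : ℕ} {x : E3} (hx : x ∈ pageSet θ n j)
    (h0 : endForm θ n j x = 0) : x ∈ endFace θ n j := by
  obtain ⟨-, hside, -, hx1, hx0⟩ := hx
  have hcos := hA.cos_half_pos
  have hX : along (mid θ n j) x = (1 + x 2) * Real.cos (half θ n) +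
      -(x 2) * Real.cos (half θ n + eta θ n) := by
    rw [endForm] at h0; linarith
  set s : Bool → ℝ := fun b => (1 + x 2) * Real.sin (half θ n) + -(x 2) *
    (outerRadius θ n j b * Real.sin (half θ n + sideEta θ n j b)) with hs
  have hbd : ∀ b, sg b * across (mid θ n j) x ≤ s b := fun b => by
    have h1 := hside b
    rw [sideForm_eq, hX] at h1
    have e : outerRadius θ n j b * Real.sin (half θ n + sideEta θ n j b) * Real.cos (half θ n) =
        Real.cos (half θ n + eta θ n) * Real.sin (half θ n) + Real.sin (sideEta θ n j b) := by
      rw [← hA.outerRadius_mul j b]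
      have h2 := Admissible.outerRadius_mul_sin θ n j b
      have h3 : Real.sin (sideEta θ n j b) = Real.sin (half θ n + sideEta θ n j b) *
          Real.cos (half θ n) - Real.cos (half θ n + sideEta θ n j b) * Real.sin (half θ n) := by
        rw [← Real.sin_sub, add_sub_cancel_left]
      linear_combination h2 - outerRadius θ n j b * h3
    refine le_of_mul_le_mul_right ?_ hcos
    simp only [hs]
    nlinarith
  have hf := hbd false
  have hb := hbd true
  rw [sg_false] at hf
  rw [sg_true, one_mul] at hb
  obtain ⟨t, ht0, ht1, ht⟩ := exists_eq_combination (l := -s false) (by linarith) hb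
  have hcomb := combination_mem_convexHull (p := topVertex θ n j false) (q := topVertex θ n j true)
    (r := outerVertex θ n j false) (t := outerVertex θ n j true) (a := (1 - t) * (1 + x 2))
    (b := t * (1 + x 2)) (c := (1 - t) * -(x 2)) (d := t * -(x 2))
    (mul_nonneg (by linarith) (by linarith)) (mul_nonneg ht0 (by linarith))
    (mul_nonneg (by linarith) (by linarith)) (mul_nonneg ht0 (by linarith)) (by ring)
  rw [endFace, topFront_eq, topBack_eq, botFront_eq, botBack_eq hA.two_le]
  refine Set.mem_of_eq_of_mem (ext_coords (mid θ n j) ?_ ?_ ?_) hcomb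
  · simp only [along_add, along_smul, topVertex, outerVertex, along_cyl, sideAngle,
      add_sub_cancel_left, cos_sg_mul, hA.outerRadius_mul]
    rw [hX]; ring
  · simp only [across_add, across_smul, topVertex, outerVertex, across_cyl, sideAngle,
      add_sub_cancel_left, sin_sg_mul]
    rw [ht]
    simp only [hs, sg_false, sg_true]
    ring
  · simp [topVertex, outerVertex]
    ring

theorem mem_topFace (hA : Admissible θ n) {j : ℕ} (hj : j ∈ Set.Icc 1 n) {x : E3}
    (hx : x ∈ pageSet θ n j) (h0 : x 2 = 0) : x ∈ topFace θ n := by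
  obtain ⟨-, hside, hend, -, -⟩ := hx
  refine Set.mem_iUnion₂.2 ⟨j, hj, ?_⟩
  have hcos := hA.cos_half_pos
  have hsin := hA.sin_half_pos
  have hf := hside false
  have hb := hside true
  rw [sideForm_eq, h0, mul_zero, add_zero] at hf hb
  rw [endForm, h0, zero_mul, add_zero] at hend
  rw [sg_false] at hf
  rw [sg_true] at hb
  set X := along (mid θ n j) x with hX
  set Y := across (mid θ n j) x with hY
  set c := Real.cos (half θ n)
  set s := Real.sin (half θ n)
  have hcomb := combination_mem_convexHull_three (p := (0 : E3)) (q := topVertex θ n j false)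
    (r := topVertex θ n j true) (a := 1 - X / c) (b := (X * s - Y * c) / (2 * c * s))
    (c := (X * s + Y * c) / (2 * c * s))
    (by rw [sub_nonneg, div_le_one hcos]; linarith)
    (div_nonneg (by linarith) (by positivity)) (div_nonneg (by linarith) (by positivity))
    (by field_simp; ring)
  rw [topFront_eq, topBack_eq]
  refine Set.mem_of_eq_of_mem (ext_coords (mid θ n j) ?_ ?_ ?_) hcomb
  · simp only [along_add, along_smul, along_zero, topVertex, along_cyl, sideAngle,
      add_sub_cancel_left, cos_sg_mul]
    rw [← hX]
    change X = _ + _ * (1 * c) + _ * (1 * c)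
    field_simp; ring
  · simp only [across_add, across_smul, across_zero, topVertex, across_cyl, sideAngle,
      add_sub_cancel_left, sin_sg_mul]
    simp only [sg_false, sg_true]
    rw [← hY]
    change Y = _ + _ * (1 * (-1 * s)) + _ * (1 * (1 * s))
    field_simp; ring
  · simp [topVertex, h0]

/-- The rays from `z^1` through the two outer vertices cut the bottom of a page into at most three
triangles; this is the one beyond the ray of the side `b`. It is absent on an outer side, where that
ray bounds the sector. -/
theorem mem_triangle_of_gap (hA : Admissible θ n) {j : ℕ} {b : Bool} {x : E3}
    (hx : x ∈ pageSet θ n j) (h1 : x 2 = -1)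
    (hpos : 0 < sg b * across (mid θ n j + sg b * (half θ n + sideEta θ n j b)) x) :
    x ∈ convexHull ℝ {botInner θ n 1, innerVertex θ n j b, outerVertex θ n j b} := by
  obtain ⟨hsec, hside, -, -, -⟩ := hx
  have hsg := sg_mul_self b
  have hO : ¬ IsOuter n j b := fun hO => by
    have h2 := hsec b
    have e : mid θ n j + sg b * (half θ n + sideEta θ n j b) = sectorAngle θ n j b := by
      rw [sectorAngle, sideEta, if_pos hO, gap, if_pos hO]
    rw [e] at hpos
    exact absurd h2 (not_le.2 hpos)
  have hηs : sideEta θ n j b = eta θ n := if_neg hO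
  have hgap : gap θ n j b = half θ n := if_neg hO
  have hrin : innerRadius θ n j b = r2 θ n := if_neg hO
  have hrf : outerRadius θ n j b = 1 := if_neg hO
  set A := sideAngle θ n j b with hAdef
  set u := along A x with hu
  set v := sg b * across A x with hv
  have hacr : across A x = sg b * v := by rw [hv]; linear_combination (-across A x) * hsg
  have e1 : mid θ n j + sg b * (half θ n + sideEta θ n j b) = A + sg b * eta θ n := by
    rw [hAdef, sideAngle, hηs]; ring
  have e2 : sectorAngle θ n j b = A + sg b * half θ n := by
    rw [hAdef, sideAngle, sectorAngle, hgap]; ring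
  have hr2 := hA.r2_mul
  have hsα := hA.sin_half_pos
  have hsη := hA.sin_eta_pos
  set sα := Real.sin (half θ n) with hsαd
  set sη := Real.sin (eta θ n) with hsηd
  set cα := Real.cos (half θ n) with hcαd
  set cη := Real.cos (eta θ n) with hcηd
  have hD : 0 < v * cη - u * sη := by
    rw [e1, across_add_angle, cos_sg_mul, sin_sg_mul] at hpos
    refine hpos.trans_le (le_of_eq ?_)
    rw [hv]
    linear_combination (-u * sη) * hsg
  have hS : v * cα - u * sα ≤ 0 := by
    have h2 := hsec b
    rw [sectorForm, e2, across_add_angle, cos_sg_mul, sin_sg_mul] at h2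
    refine le_trans (le_of_eq ?_) h2
    rw [hv]
    linear_combination (u * sα) * hsg
  have hF : v ≤ sη := by
    have h2 := hside b
    rw [sideForm, h1, hηs] at h2
    linarith
  have hden : 0 < cη - r2 θ n * cα := by
    have h2 : 0 < Real.sin (half θ n - eta θ n) := Real.sin_pos_of_pos_of_lt_pi
      (by linarith [hA.eta_le, hA.eta_pos]) (by linarith [hA.half_le, hA.eta_pos, Real.pi_pos])
    rw [Real.sin_sub] at h2
    have h3 : (cη - r2 θ n * cα) * sα = sα * cη - cα * sη := by linear_combination (-cα) * hr2
    exact pos_of_mul_pos_left (by rw [h3]; exact h2) hsα.le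
  -- Both vertices other than `z^1` are at distance `sin η` from the vertical plane through the top
  -- edge, so `v / sin η` is their joint barycentric weight. The coordinate `u` then divides it
  -- between them.
  set τ := v / sη with hτ
  have hτv : τ * sη = v := div_mul_cancel₀ _ hsη.ne'
  have hτ1 : τ ≤ 1 := (div_le_one hsη).2 hF
  have hl : 0 ≤ τ * cη - u := by
    have : 0 < (τ * cη - u) * sη :=
      hD.trans_le (le_of_eq (by linear_combination (-cη) * hτv))
    exact (pos_of_mul_pos_left this hsη.le).le
  have hν : 0 ≤ u - τ * (r2 θ n * cα) := by
    have h3 : 0 ≤ (u - τ * (r2 θ n * cα)) * sα := by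
      have : (u - τ * (r2 θ n * cα)) * sα = u * sα - v * cα := by
        rw [← hτv, ← hr2]; ring
      linarith
    exact nonneg_of_mul_nonneg_left h3 hsα
  have hcomb := combination_mem_convexHull_three (p := botInner θ n 1) (q := innerVertex θ n j b)
    (r := outerVertex θ n j b) (a := 1 - τ) (b := (τ * cη - u) / (cη - r2 θ n * cα))
    (c := (u - τ * (r2 θ n * cα)) / (cη - r2 θ n * cα)) (by linarith)
    (div_nonneg hl hden.le) (div_nonneg hν hden.le) (by field_simp; ring)
  have hz : botInner θ n 1 = cyl 0 0 (-1) := by simp [botInner]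
  have ein : sectorAngle θ n j b - A = sg b * half θ n := by rw [e2]; ring
  have eout : mid θ n j + sg b * (half θ n + sideEta θ n j b) - A = sg b * eta θ n := by
    rw [e1]; ring
  refine Set.mem_of_eq_of_mem (ext_coords A ?_ ?_ ?_) hcomb
  · simp only [hz, along_add, along_smul, innerVertex, outerVertex, along_cyl, ein, eout, cos_sg_mul,
      hrin, hrf]
    rw [← hu]
    change u = _ + _ * (_ * cα) + _ * (_ * cη)
    field_simp; ring
  · simp only [hz, across_add, across_smul, innerVertex, outerVertex, across_cyl, ein, eout,
      sin_sg_mul, hrin, hrf]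
    rw [hacr]
    change sg b * v = _ + _ * (_ * (sg b * sα)) + _ * (_ * (sg b * sη))
    rw [← hτv]
    field_simp
    linear_combination (-(sg b * (τ * cη - u))) * hr2
  · have : (1 - τ) + (τ * cη - u) / (cη - r2 θ n * cα) +
        (u - τ * (r2 θ n * cα)) / (cη - r2 θ n * cα) = 1 := by field_simp; ring
    simp only [hz, innerVertex, outerVertex, PiLp.add_apply, PiLp.smul_apply, smul_eq_mul,
      cyl_apply_two, h1]
    linarith

/-- Both outer vertices have the coordinate `c` along the bisector of the page, so `X / c` is their
joint weight; the transverse coordinate divides it. -/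
theorem mem_triangle_of_page (hA : Admissible θ n) {j : ℕ} {x : E3}
    (hx : x ∈ pageSet θ n j) (h1 : x 2 = -1)
    (hneg : ∀ b, sg b * across (mid θ n j + sg b * (half θ n + sideEta θ n j b)) x ≤ 0) :
    x ∈ convexHull ℝ {botInner θ n 1, outerVertex θ n j false, outerVertex θ n j true} := by
  obtain ⟨-, -, hend, -, -⟩ := hx
  set X := along (mid θ n j) x with hX
  set Y := across (mid θ n j) x with hY
  have hc := hA.cos_half_add_eta_pos
  set c := Real.cos (half θ n + eta θ n) with hcd
  set s : Bool → ℝ := fun b => outerRadius θ n j b * Real.sin (half θ n + sideEta θ n j b) with hs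
  have hs0 : ∀ b, 0 < s b := fun b => mul_pos (hA.outerRadius_pos j b)
    (Real.sin_pos_of_pos_of_lt_pi (by linarith [hA.half_pos, hA.sideEta_nonneg j b])
      (by linarith [hA.half_le, hA.sideEta_le j b, hA.eta_le, hA.half_pos, Real.pi_pos]))
  have hX1 : X ≤ c := by
    rw [endForm, h1] at hend; linarith
  have hD : ∀ b, sg b * Y * c ≤ X * s b := fun b => by
    have h2 := hneg b
    rw [across_add_angle, cos_sg_mul, sin_sg_mul] at h2
    have h3 := mul_le_mul_of_nonneg_left h2 (hA.outerRadius_pos j b).le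
    rw [mul_zero] at h3
    have e : outerRadius θ n j b * (sg b * (Y * Real.cos (half θ n + sideEta θ n j b) -
        X * (sg b * Real.sin (half θ n + sideEta θ n j b)))) = sg b * Y * c - X * s b := by
      rw [hcd, ← hA.outerRadius_mul j b, hs]
      linear_combination (-(outerRadius θ n j b * X * Real.sin (half θ n + sideEta θ n j b))) *
        sg_mul_self b
    linarith
  have hf := hD false
  have hb := hD true
  rw [sg_false] at hf
  rw [sg_true] at hb
  have hf0 := hs0 false
  have hb0 := hs0 true
  have hcomb := combination_mem_convexHull_three (p := botInner θ n 1) (q := outerVertex θ n j false)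
    (r := outerVertex θ n j true) (a := 1 - X / c)
    (b := (X * s true - Y * c) / (c * (s true + s false)))
    (c := (X * s false + Y * c) / (c * (s true + s false)))
    (by rw [sub_nonneg, div_le_one hc]; exact hX1)
    (div_nonneg (by linarith) (by positivity)) (div_nonneg (by linarith) (by positivity))
    (by field_simp; ring)
  have hz : botInner θ n 1 = cyl 0 0 (-1) := by simp [botInner]
  refine Set.mem_of_eq_of_mem (ext_coords (mid θ n j) ?_ ?_ ?_) hcomb
  · simp only [hz, along_add, along_smul, outerVertex, along_cyl, add_sub_cancel_left, cos_sg_mul,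
      hA.outerRadius_mul]
    rw [← hX]
    change X = _ + _ * c + _ * c
    field_simp; ring
  · simp only [hz, across_add, across_smul, outerVertex, across_cyl, add_sub_cancel_left, sin_sg_mul]
    simp only [sg_false, sg_true]
    rw [← hY]
    have e1 : outerRadius θ n j false * (-1 * Real.sin (half θ n + sideEta θ n j false)) =
      - s false := by simp only [hs]; ring
    have e2 : outerRadius θ n j true * (1 * Real.sin (half θ n + sideEta θ n j true)) =
      s true := by simp only [hs]; ring
    rw [e1, e2]
    field_simp; ring
  · have : (1 - X / c) + (X * s true - Y * c) / (c * (s true + s false)) +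
        (X * s false + Y * c) / (c * (s true + s false)) = 1 := by field_simp; ring
    simp only [hz, outerVertex, PiLp.add_apply, PiLp.smul_apply, smul_eq_mul,
      cyl_apply_two, h1]
    linarith

theorem mem_bottomFace (hA : Admissible θ n) {j : ℕ} (hj : j ∈ Set.Icc 1 n) {x : E3}
    (hx : x ∈ pageSet θ n j) (h1 : x 2 = -1) : x ∈ bottomFace θ n := by
  refine Set.mem_iUnion₂.2 ⟨j, hj, ?_⟩
  rw [botInner_eq θ n j, botFront_eq, botBack_eq hA.two_le, botNext_eq hj.1]
  by_cases hneg : ∀ b, sg b * across (mid θ n j + sg b * (half θ n + sideEta θ n j b)) x ≤ 0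
  · exact Or.inl (Or.inr (mem_triangle_of_page hA hx h1 hneg))
  · push Not at hneg
    obtain ⟨b, hb⟩ := hneg
    have h2 := mem_triangle_of_gap hA hx h1 hb
    cases b
    · exact Or.inl (Or.inl h2)
    · refine Or.inr ?_
      rwa [Set.pair_comm] at h2

theorem pageBoundary_subset (hA : Admissible θ n) {j : ℕ} (hj : j ∈ Set.Icc 1 n) :
    pageBoundary θ n j ⊆ bookSurface θ n := by
  rintro x ⟨hx, h | h | h | ⟨b, h⟩⟩
  · exact Or.inl (Or.inl (mem_topFace hA hj hx h))
  · exact Or.inl (Or.inr (mem_bottomFace hA hj hx h))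
  · exact Or.inr (Set.mem_iUnion₂.2 ⟨j, hj, Or.inl (Or.inr (mem_endFace hA hx h))⟩)
  · refine Or.inr (Set.mem_iUnion₂.2 ⟨j, hj, ?_⟩)
    have h2 := mem_sideFace hA hx h
    cases b
    · rw [← frontFace_eq] at h2; exact Or.inl (Or.inl h2)
    · rw [← backFace_eq hA.two_le hj.1] at h2; exact Or.inr h2

theorem bookSurface_eq (hA : Admissible θ n) :
    bookSurface θ n = ⋃ j ∈ Set.Icc 1 n, pageBoundary θ n j :=
  (bookSurface_subset hA).antisymm (Set.iUnion₂_subset fun _ hj => pageBoundary_subset hA hj)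


/-! ### The polyhedron is the region inside its surface -/

/-- The points at which all the inequalities that define a page, except those of its sector, are
strict. -/
def strictPage (θ : ℝ) (n j : ℕ) : Set E3 :=
  {x | (∀ b, sideForm θ n j b x < 0) ∧ endForm θ n j x < 0 ∧ -1 < x 2 ∧ x 2 < 0}

/-- The closed sector of a page. -/
def sector (θ : ℝ) (n j : ℕ) : Set E3 := {x | ∀ b, sectorForm θ n j b x ≤ 0}

/-- The open wedge that contains the polyhedron. -/
def wedge (θ : ℝ) : Set E3 := {x | 0 < across 0 x ∧ across θ x < 0}

/-- The interior of the open-book polyhedron. -/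
def bookInterior (θ : ℝ) (n : ℕ) : Set E3 :=
  {x ∈ wedge θ | ∃ j ∈ Set.Icc 1 n, x ∈ sector θ n j ∩ strictPage θ n j}

theorem sectorAngle_one (θ : ℝ) (n : ℕ) : sectorAngle θ n 1 false = 0 := by
  simp [sectorAngle, gap, IsOuter, mid, half]; ring

theorem sectorAngle_last {n : ℕ} (hn : 2 ≤ n) (θ : ℝ) : sectorAngle θ n n true = θ := by
  simp only [sectorAngle, gap, IsOuter, mid, half, if_true, sg_true]
  linear_combination pageAngle_mul hn θ

theorem not_isOuter_true {j n : ℕ} (h : j < n) : ¬ IsOuter n j true := by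
  simp [IsOuter]; omega

theorem not_isOuter_false {j n : ℕ} (h : 1 < j) : ¬ IsOuter n j false := by
  simp [IsOuter]; omega

theorem sectorAngle_succ {j : ℕ} (h : j < n) (hj : 1 ≤ j) (θ : ℝ) :
    sectorAngle θ n j true = sectorAngle θ n (j + 1) false := by
  simp only [sectorAngle, gap, if_neg (not_isOuter_true h),
    if_neg (not_isOuter_false (show 1 < j + 1 by omega)), sg_true, sg_false, mid, half]
  push_cast; ring

theorem sectorAngle_eq_of_lt_true {j : ℕ} (h : j < n) (θ : ℝ) :
    sectorAngle θ n j true = mid θ n j + 2 * half θ n := by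
  simp only [sectorAngle, gap, if_neg (not_isOuter_true h), sg_true]; ring

theorem sectorAngle_eq_of_lt_false {j : ℕ} (h : 1 < j) (θ : ℝ) :
    sectorAngle θ n j false = mid θ n j - 2 * half θ n := by
  simp only [sectorAngle, gap, if_neg (not_isOuter_false h), sg_false]; ring

namespace Admissible

theorem sectorAngle_lt (hA : Admissible θ n) (j : ℕ) :
    sectorAngle θ n j false < sectorAngle θ n j true := by
  simp only [sectorAngle, sg_true, sg_false]
  linarith [hA.half_pos, hA.gap_nonneg j true, hA.gap_nonneg j false]

theorem sectorAngle_le_of_lt (hA : Admissible θ n) {j k : ℕ} (hj : 1 ≤ j) (hjk : j < k)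
    (hk : k ≤ n) : sectorAngle θ n j true ≤ sectorAngle θ n k false ∧
      (sectorAngle θ n j true = sectorAngle θ n k false → k = j + 1) := by
  rw [sectorAngle_eq_of_lt_true (by omega), sectorAngle_eq_of_lt_false (by omega)]
  have h1 : (j : ℝ) + 1 ≤ k := by exact_mod_cast hjk
  have h2 := hA.half_pos
  have e : pageAngle θ n = 2 * half θ n := by unfold half; ring
  simp only [mid, e]
  refine ⟨by nlinarith, fun h => ?_⟩
  have : (k : ℝ) = j + 1 := by
    have : (k - (j + 1) : ℝ) * (4 * half θ n) = 0 := by linarith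
    rcases mul_eq_zero.1 this with h | h <;> linarith
  exact_mod_cast this

theorem sectorAngle_nonneg (hA : Admissible θ n) {j : ℕ} (hj : j ∈ Set.Icc 1 n) :
    0 ≤ sectorAngle θ n j false := by
  rcases eq_or_lt_of_le hj.1 with h | h
  · rw [← h, sectorAngle_one]
  · have := (hA.sectorAngle_le_of_lt le_rfl h hj.2).1
    have h2 := hA.sectorAngle_lt 1
    rw [sectorAngle_one] at h2
    linarith

theorem sectorAngle_le (hA : Admissible θ n) {j : ℕ} (hj : j ∈ Set.Icc 1 n) :
    sectorAngle θ n j true ≤ θ := by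
  rcases eq_or_lt_of_le hj.2 with h | h
  · rw [h, sectorAngle_last hA.two_le]
  · have := (hA.sectorAngle_le_of_lt hj.1 h le_rfl).1
    have h2 := hA.sectorAngle_lt n
    rw [sectorAngle_last hA.two_le] at h2
    linarith

end Admissible

theorem exists_polar_of_mem_sector (hA : Admissible θ n) {j : ℕ} {x : E3} (hx : x ∈ sector θ n j) :
    ∃ ρ φ : ℝ, 0 ≤ ρ ∧ sectorAngle θ n j false ≤ φ ∧ φ ≤ sectorAngle θ n j true ∧
      x = cyl ρ φ (x 2) := by
  refine exists_polar (hA.sectorAngle_lt j) ?_ ?_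
  · have := hx false
    rw [sectorForm, sg_false] at this; linarith
  · have := hx true
    rwa [sectorForm, sg_true, one_mul] at this

/-- All angles lie in `[0, θ]`, so their differences are in `(-π, π)`, where the sign of the sine is
the sign of the angle. -/
theorem mem_sector_iff (hA : Admissible θ n) {j : ℕ} (hj : j ∈ Set.Icc 1 n) {ρ φ h : ℝ} (hρ : 0 < ρ)
    (h0 : 0 ≤ φ) (h1 : φ ≤ θ) : cyl ρ φ h ∈ sector θ n j ↔
      sectorAngle θ n j false ≤ φ ∧ φ ≤ sectorAngle θ n j true := by
  have hl := hA.sectorAngle_nonneg hj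
  have hu := hA.sectorAngle_le hj
  have hlt := hA.sectorAngle_lt j
  have hπ := Real.pi_pos
  have hθ := hA.le
  have hsin : ∀ ψ, -Real.pi < ψ → ψ < Real.pi → (0 ≤ Real.sin ψ ↔ 0 ≤ ψ) := fun ψ ha hb =>
    ⟨fun hs => by
      by_contra! hneg
      exact absurd (Real.sin_neg_of_neg_of_neg_pi_lt hneg ha) (not_lt.2 hs),
    fun hs => Real.sin_nonneg_of_nonneg_of_le_pi hs hb.le⟩
  have h1' := hsin (φ - sectorAngle θ n j false) (by linarith) (by linarith)
  have h2' := hsin (-(φ - sectorAngle θ n j true)) (by linarith) (by linarith)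
  rw [Real.sin_neg] at h2'
  constructor
  · intro hx
    have hf := hx false
    have hb := hx true
    rw [sectorForm, across_cyl, sg_false] at hf
    rw [sectorForm, across_cyl, sg_true] at hb
    have hf' := h1'.1 (by by_contra! h; nlinarith)
    have hb' := h2'.1 (by by_contra! h; nlinarith)
    exact ⟨by linarith, by linarith⟩
  · rintro ⟨ha, hb⟩ b
    cases b
    · rw [sectorForm, across_cyl, sg_false]
      nlinarith [h1'.2 (by linarith)]
    · rw [sectorForm, across_cyl, sg_true]
      nlinarith [h2'.2 (by linarith)]

theorem exists_polar_of_mem_wedge (hA : Admissible θ n) {x : E3} (hx : x ∈ wedge θ) :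
    ∃ ρ φ : ℝ, 0 < ρ ∧ 0 < φ ∧ φ < θ ∧ x = cyl ρ φ (x 2) := by
  obtain ⟨ρ, φ, hρ, h0, h1, he⟩ := exists_polar hA.pos hx.1.le hx.2.le
  have ha := hx.1
  have hb := hx.2
  rw [he, across_cyl] at ha hb
  refine ⟨ρ, φ, ?_, ?_, ?_, he⟩
  · refine lt_of_le_of_ne hρ fun h => ?_
    rw [← h] at ha; simp at ha
  · refine lt_of_le_of_ne h0 fun h => ?_
    rw [← h] at ha; simp at ha
  · refine lt_of_le_of_ne h1 fun h => ?_
    rw [h] at hb; simp at hb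

theorem exists_mem_sector (hA : Admissible θ n) {x : E3} (hx : x ∈ wedge θ) :
    ∃ j ∈ Set.Icc 1 n, x ∈ sector θ n j := by
  obtain ⟨ρ, φ, hρ, h0, h1, he⟩ := exists_polar_of_mem_wedge hA hx
  have hn := hA.two_le
  have hex : ∃ j, 1 ≤ j ∧ j ≤ n ∧ φ ≤ sectorAngle θ n j true :=
    ⟨n, by omega, le_rfl, by rw [sectorAngle_last hA.two_le]; exact h1.le⟩
  classical
  obtain ⟨ha, hb, hc⟩ := Nat.find_spec hex
  refine ⟨Nat.find hex, ⟨ha, hb⟩, ?_⟩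
  rw [he, mem_sector_iff hA ⟨ha, hb⟩ hρ h0.le h1.le]
  refine ⟨?_, hc⟩
  by_cases h : Nat.find hex = 1
  · rw [h, sectorAngle_one]; exact h0.le
  · have hlt := Nat.find_min hex (show Nat.find hex - 1 < Nat.find hex by omega)
    have e := sectorAngle_succ (n := n) (j := Nat.find hex - 1) (by omega) (by omega) θ
    rw [show Nat.find hex - 1 + 1 = Nat.find hex by omega] at e
    rw [← e]
    by_contra! hcon
    exact hlt ⟨by omega, by omega, hcon.le⟩

theorem sideForm_cyl (θ : ℝ) (n j : ℕ) (b : Bool) (ρ φ h : ℝ) : sideForm θ n j b (cyl ρ φ h) =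
    ρ * Real.sin (sg b * (φ - mid θ n j) - half θ n) + Real.sin (sideEta θ n j b) * h := by
  rw [sideForm, across_cyl, cyl_apply_two]
  have e : φ - sideAngle θ n j b = sg b * (sg b * (φ - mid θ n j) - half θ n) := by
    rw [sideAngle]; linear_combination (-(φ - mid θ n j)) * sg_mul_self b
  rw [e, sin_sg_mul]
  linear_combination (ρ * Real.sin (sg b * (φ - mid θ n j) - half θ n)) * sg_mul_self b

/-- Where a page meets the sector of another page, the inequalities of both are strict. -/
theorem mem_strictPage_of_mem_sector (hA : Admissible θ n) {j k : ℕ} (hj : j ∈ Set.Icc 1 n)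
    (hk : k ∈ Set.Icc 1 n) {x : E3} (hW : x ∈ wedge θ) (hxj : x ∈ sector θ n j)
    (hx : x ∈ strictPage θ n j) (hxk : x ∈ sector θ n k) : x ∈ strictPage θ n k := by
  obtain ⟨ρ, φ, hρ, h0, h1, he⟩ := exists_polar_of_mem_wedge hA hW
  obtain ⟨hside, hend, hx1, hx0⟩ := hx
  have e : pageAngle θ n = 2 * half θ n := by unfold half; ring
  have hα := hA.half_pos
  have h3α : 0 < Real.sin (3 * half θ n) := hA.sin_pos (by linarith)
    (by linarith [hA.half_le, Real.pi_pos])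
  have hη : ∀ b, 0 ≤ -(Real.sin (sideEta θ n k b) * x 2) := fun b => by
    have := mul_nonneg (hA.sin_sideEta_nonneg k b) (neg_nonneg.2 hx0.le); linarith
  rw [he] at hxj hxk
  rw [mem_sector_iff hA hj hρ h0.le h1.le] at hxj
  rw [mem_sector_iff hA hk hρ h0.le h1.le] at hxk
  have hends : ∀ i, endForm θ n i x = ρ * Real.cos (φ - mid θ n i) - Real.cos (half θ n) +
      x 2 * (Real.cos (half θ n + eta θ n) - Real.cos (half θ n)) := fun i => by
    rw [endForm]
    nth_rw 1 [he]
    rw [along_cyl]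
  have hsides : ∀ i b, sideForm θ n i b x = ρ * Real.sin (sg b * (φ - mid θ n i) - half θ n) +
      Real.sin (sideEta θ n i b) * x 2 := fun i b => by
    nth_rw 1 [he]
    rw [sideForm_cyl]
  -- Different sectors can meet off the axis only if the pages are neighbours, and then in the
  -- middle of their gap, at angle `2 * half` from both bisectors. There the facing side forms and
  -- the end forms of the two pages coincide by reflection. The far side of page `k` is at angle `3
  -- * half`, so its form is negative.
  rcases lt_trichotomy j k with hjk | hjk | hjk
  · obtain ⟨h2, h3⟩ := hA.sectorAngle_le_of_lt hj.1 hjk hk.2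
    have hk' : k = j + 1 := h3 (by linarith)
    have hφj : φ - mid θ n j = 2 * half θ n := by
      rw [sectorAngle_eq_of_lt_true (by have := hk.2; omega)] at hxj h2; linarith
    have hφk : φ - mid θ n k = -(2 * half θ n) := by
      rw [sectorAngle_eq_of_lt_false (by have := hj.1; omega)] at hxk h2; linarith
    have ηj : sideEta θ n j true = eta θ n := if_neg (not_isOuter_true (by have := hk.2; omega))
    have ηk : sideEta θ n k false = eta θ n := if_neg (not_isOuter_false (by have := hj.1; omega))
    refine ⟨fun b => ?_, ?_, hx1, hx0⟩
    · have hs := hside true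
      rw [hsides, hφj, ηj, sg_true] at hs
      cases b
      · rw [hsides, hφk, ηk, sg_false, neg_mul_neg]
        exact hs
      · have hh := hη true
        rw [hsides, hφk, sg_true, one_mul, ← neg_add', Real.sin_neg,
          show 2 * half θ n + half θ n = 3 * half θ n by ring]
        nlinarith [mul_pos hρ h3α]
    · rw [hends, hφk, Real.cos_neg]
      rwa [hends, hφj] at hend
  · exact hjk ▸ ⟨hside, hend, hx1, hx0⟩
  · obtain ⟨h2, h3⟩ := hA.sectorAngle_le_of_lt hk.1 hjk hj.2
    have hk' : j = k + 1 := h3 (by linarith)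
    have hφk : φ - mid θ n k = 2 * half θ n := by
      rw [sectorAngle_eq_of_lt_true (by have := hj.2; omega)] at hxk h2; linarith
    have hφj : φ - mid θ n j = -(2 * half θ n) := by
      rw [sectorAngle_eq_of_lt_false (by have := hk.1; omega)] at hxj h2; linarith
    have ηk : sideEta θ n k true = eta θ n := if_neg (not_isOuter_true (by have := hj.2; omega))
    have ηj : sideEta θ n j false = eta θ n := if_neg (not_isOuter_false (by have := hk.1; omega))
    refine ⟨fun b => ?_, ?_, hx1, hx0⟩
    · have hs := hside false
      rw [hsides, hφj, ηj, sg_false, neg_mul_neg] at hs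
      cases b
      · have hh := hη false
        rw [hsides, hφk, sg_false, neg_one_mul, ← neg_add', Real.sin_neg,
          show 2 * half θ n + half θ n = 3 * half θ n by ring]
        nlinarith [mul_pos hρ h3α]
      · rw [hsides, hφk, ηk, sg_true]
        exact hs
    · rw [hends, hφk]
      rwa [hends, hφj, Real.cos_neg] at hend

theorem isOpen_strictPage (θ : ℝ) (n j : ℕ) : IsOpen (strictPage θ n j) := by
  have h1 : Continuous fun x : E3 => x 2 := by fun_prop
  have e : strictPage θ n j = (⋂ b, {x | sideForm θ n j b x < 0})
      ∩ ({x | endForm θ n j x < 0} ∩ ({x | -1 < x 2} ∩ {x | x 2 < 0})) := by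
    ext x; simp [strictPage]
  rw [e]
  exact (isOpen_iInter_of_finite fun b => isOpen_lt (continuous_sideForm θ n j b) continuous_const).inter
    ((isOpen_lt (continuous_endForm θ n j) continuous_const).inter
    ((isOpen_lt continuous_const h1).inter (isOpen_lt h1 continuous_const)))

theorem isClosed_sector (θ : ℝ) (n j : ℕ) : IsClosed (sector θ n j) := by
  have e : sector θ n j = ⋂ b, {x | sectorForm θ n j b x ≤ 0} := by
    ext x; simp [sector]
  rw [e]
  exact isClosed_iInter fun b => isClosed_le (continuous_sectorForm θ n j b) continuous_const

theorem isOpen_wedge (θ : ℝ) : IsOpen (wedge θ) :=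
  (isOpen_lt continuous_const (continuous_across 0)).inter
    (isOpen_lt (continuous_across θ) continuous_const)

/-- A point in the middle of a gap belongs to two sectors, and nearby points may lie in either. The
strict inequalities hold in every sector through the point, so they persist nearby, and the
remaining closed sectors stay away. -/
theorem isOpen_bookInterior (hA : Admissible θ n) : IsOpen (bookInterior θ n) := by
  rw [isOpen_iff_mem_nhds]
  rintro x ⟨hW, j, hj, hxj, hx⟩
  have hev : ∀ᶠ z in 𝓝 x, ∀ k ∈ Set.Icc 1 n, z ∈ sector θ n k → z ∈ strictPage θ n k := by
    refine (Set.finite_Icc 1 n).eventually_all.2 fun k hk => ?_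
    by_cases hxk : x ∈ sector θ n k
    · filter_upwards [(isOpen_strictPage θ n k).mem_nhds
        (mem_strictPage_of_mem_sector hA hj hk hW hxj hx hxk)] with z hz _ using hz
    · filter_upwards [(isClosed_sector θ n k).isOpen_compl.mem_nhds hxk] with z hz hz'
        using absurd hz' hz
  filter_upwards [hev, (isOpen_wedge θ).mem_nhds hW] with z hz hzW
  obtain ⟨k, hk, hzk⟩ := exists_mem_sector hA hzW
  exact ⟨hzW, k, hk, hzk, hz k hk hzk⟩

theorem disjoint_bookInterior (hA : Admissible θ n) {x : E3} (hx : x ∈ bookInterior θ n) :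
    x ∉ bookSurface θ n := by
  intro hxΓ
  obtain ⟨hW, j, hj, hxj, hx⟩ := hx
  rw [bookSurface_eq hA] at hxΓ
  obtain ⟨k, hk, hxk, hor⟩ := Set.mem_iUnion₂.1 hxΓ
  obtain ⟨h1, h2, h3, h4⟩ := mem_strictPage_of_mem_sector hA hj hk hW hxj hx hxk.1
  rcases hor with h | h | h | ⟨b, h⟩
  · exact h4.ne h
  · exact h3.ne' h
  · exact h2.ne h
  · exact (h1 b).ne h

theorem axis_mem_bookSurface (hA : Admissible θ n) {φ h : ℝ} (h1 : -1 ≤ h) (h0 : h ≤ 0) :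
    cyl 0 φ h ∈ bookSurface θ n := by
  have hj : 1 ∈ Set.Icc 1 n := ⟨le_rfl, by have := hA.two_le; omega⟩
  refine pageBoundary_subset hA hj ⟨cyl_zero_mem hA 1 φ h1 h0, Or.inr (Or.inr (Or.inr ⟨false, ?_⟩))⟩
  rw [← sectorForm_eq_sideForm (by simp [IsOuter]), sectorForm, across_cyl, zero_mul, mul_zero]

theorem bookInterior_subset_pageSet : bookInterior θ n ⊆ ⋃ j ∈ Set.Icc 1 n, pageSet θ n j := by
  rintro x ⟨-, j, hj, hxj, h1, h2, h3, h4⟩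
  exact Set.mem_iUnion₂.2 ⟨j, hj, hxj, fun b => (h1 b).le, h2.le, h3.le, h4.le⟩

/-- If no form of the boundary vanishes, only the sector conditions could fail to be strict. The
axis belongs to the surface. A boundary half-plane of the wedge is reached only by the first or the
last page, where the form of the outer side would vanish. -/
theorem mem_of_mem_pageSet (hA : Admissible θ n) {j : ℕ} (hj : j ∈ Set.Icc 1 n) {x : E3}
    (hx : x ∈ pageSet θ n j) : x ∈ bookInterior θ n ∨ x ∈ bookSurface θ n := by
  by_cases hB : x ∈ pageBoundary θ n j
  · exact Or.inr (pageBoundary_subset hA hj hB)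
  have hB' : ¬ (x 2 = 0 ∨ x 2 = -1 ∨ endForm θ n j x = 0 ∨ ∃ b, sideForm θ n j b x = 0) :=
    fun h => hB ⟨hx, h⟩
  push Not at hB'
  obtain ⟨n0, n1, ne, ns⟩ := hB'
  obtain ⟨hsec, hside, hend, hx1, hx0⟩ := hx
  have hstrict : x ∈ strictPage θ n j := ⟨fun b => lt_of_le_of_ne (hside b) (ns b),
    lt_of_le_of_ne hend ne, lt_of_le_of_ne hx1 (Ne.symm n1), lt_of_le_of_ne hx0 n0⟩
  obtain ⟨ρ, φ, hρ, hl, hu, he⟩ := exists_polar_of_mem_sector hA hsec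
  rcases eq_or_lt_of_le hρ with h0 | h0
  · right
    rw [he, ← h0]
    exact axis_mem_bookSurface hA hx1 hx0
  left
  have hl0 := hA.sectorAngle_nonneg hj
  have hu0 := hA.sectorAngle_le hj
  have hθ := hA.le
  have hπ := Real.pi_pos
  refine ⟨⟨?_, ?_⟩, j, hj, hsec, hstrict⟩
  · rw [he, across_cyl, sub_zero]
    refine mul_pos h0 (Real.sin_pos_of_pos_of_lt_pi (lt_of_le_of_ne (hl0.trans hl) fun h => ?_)
      (by linarith))
    have hj1 : j = 1 := by
      by_contra hne
      have h1 := (hA.sectorAngle_le_of_lt le_rfl (lt_of_le_of_ne hj.1 (Ne.symm hne)) hj.2).1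
      have h2 := hA.sectorAngle_lt 1
      rw [sectorAngle_one] at h2
      linarith
    have hO : IsOuter n j false := by simp [IsOuter, hj1]
    refine ns false ?_
    rw [← sectorForm_eq_sideForm hO, sectorForm, hj1, sectorAngle_one, he, across_cyl, ← h]
    simp
  · rw [he, across_cyl]
    refine mul_neg_of_pos_of_neg h0 (Real.sin_neg_of_neg_of_neg_pi_lt
      (lt_of_le_of_ne (by linarith) fun h => ?_) (by linarith))
    have hjn : j = n := by
      by_contra hne
      have h1 := (hA.sectorAngle_le_of_lt hj.1 (lt_of_le_of_ne hj.2 hne) le_rfl).1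
      have h2 := hA.sectorAngle_lt n
      rw [sectorAngle_last hA.two_le] at h2
      linarith
    have hO : IsOuter n j true := by simp [IsOuter, hjn]
    refine ns true ?_
    rw [← sectorForm_eq_sideForm hO, sectorForm, hjn, sectorAngle_last hA.two_le, he, across_cyl, h]
    simp

theorem closure_bookInterior_subset (hA : Admissible θ n) :
    closure (bookInterior θ n) ⊆ bookInterior θ n ∪ bookSurface θ n := by
  have hcl : IsClosed (⋃ j ∈ Set.Icc 1 n, pageSet θ n j) :=
    (Set.finite_Icc 1 n).isClosed_biUnion fun j _ => isClosed_pageSet θ n j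
  intro x hx
  obtain ⟨j, hj, hxj⟩ := Set.mem_iUnion₂.1 (closure_minimal bookInterior_subset_pageSet hcl hx)
  exact mem_of_mem_pageSet hA hj hxj

theorem isBounded_pageSet (hA : Admissible θ n) (j : ℕ) : Bornology.IsBounded (pageSet θ n j) := by
  refine (Metric.isBounded_iff_subset_closedBall 0).2 ⟨3, fun x hx => ?_⟩
  obtain ⟨hsec, -, hend, hx1, hx0⟩ := hx
  obtain ⟨ρ, φ, hρ, hl, hu, he⟩ := exists_polar_of_mem_sector hA hsec
  have hπ := Real.pi_pos
  have hα := hA.half_le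
  have hα0 := hA.half_pos
  have hcos : 1 / 2 ≤ Real.cos (φ - mid θ n j) := by
    rw [← Real.cos_pi_div_three, ← Real.cos_abs (φ - mid θ n j)]
    have habs : |φ - mid θ n j| ≤ Real.pi / 3 := by
      simp only [sectorAngle, sg_true, sg_false] at hl hu
      have := hA.gap_le j true
      have := hA.gap_le j false
      exact abs_le.2 ⟨by linarith, by linarith⟩
    exact Real.cos_le_cos_of_nonneg_of_le_pi (abs_nonneg _) (by linarith) habs
  have hρ2 : ρ ≤ 2 := by
    rw [endForm] at hend
    nth_rw 1 [he] at hend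
    rw [along_cyl] at hend
    have h1 := Real.cos_le_one (half θ n)
    have h2 := hA.cos_half_add_eta_pos
    have h3 := hA.cos_half_pos
    have h4 := Real.cos_le_one (half θ n + eta θ n)
    nlinarith
  rw [mem_closedBall_zero_iff, EuclideanSpace.norm_eq, Fin.sum_univ_three]
  refine Real.sqrt_le_iff.2 ⟨by norm_num, ?_⟩
  have e0 : x 0 = ρ * Real.cos φ := by rw [he]; simp [cyl]
  have e1 : x 1 = ρ * Real.sin φ := by rw [he]; simp [cyl]
  simp only [Real.norm_eq_abs, sq_abs]
  rw [e0, e1]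
  have := Real.sin_sq_add_cos_sq φ
  have : (ρ * Real.cos φ) ^ 2 + (ρ * Real.sin φ) ^ 2 = ρ ^ 2 := by
    linear_combination ρ ^ 2 * this
  nlinarith

/-- The surface is the finite union of the closed bounded pages with the open interior removed. -/
theorem isCompact_bookSurface (hA : Admissible θ n) : IsCompact (bookSurface θ n) := by
  have hcl : IsClosed (bookSurface θ n) := by
    have : bookSurface θ n = (⋃ j ∈ Set.Icc 1 n, pageSet θ n j) \ bookInterior θ n := by
      ext x
      constructor
      · intro hx
        refine ⟨?_, fun h => disjoint_bookInterior hA h hx⟩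
        rw [bookSurface_eq hA] at hx
        obtain ⟨j, hj, hx⟩ := Set.mem_iUnion₂.1 hx
        exact Set.mem_iUnion₂.2 ⟨j, hj, hx.1⟩
      · rintro ⟨hx, hnot⟩
        obtain ⟨j, hj, hx⟩ := Set.mem_iUnion₂.1 hx
        exact (mem_of_mem_pageSet hA hj hx).resolve_left hnot
    rw [this]
    exact ((Set.finite_Icc 1 n).isClosed_biUnion fun j _ => isClosed_pageSet θ n j).sdiff
      (isOpen_bookInterior hA)
  refine Metric.isCompact_of_isClosed_isBounded hcl ?_
  refine ((Bornology.isBounded_biUnion (Set.finite_Icc 1 n)).2 fun j _ =>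
    isBounded_pageSet hA j).subset fun x hx => ?_
  rw [bookSurface_eq hA] at hx
  obtain ⟨j, hj, hx⟩ := Set.mem_iUnion₂.1 hx
  exact Set.mem_iUnion₂.2 ⟨j, hj, hx.1⟩

/-- The interior is open and its closure adds only points of the surface, so it is open and closed
relative to the complement. The component of each of its points therefore stays in it and is
bounded. -/
theorem bookInterior_subset_inside (hA : Admissible θ n) :
    bookInterior θ n ⊆ inside (bookSurface θ n) := by
  intro x hx
  have hxΓ := disjoint_bookInterior hA hx
  refine ⟨hxΓ, ?_⟩
  refine ((Bornology.isBounded_biUnion (Set.finite_Icc 1 n)).2 fun j _ =>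
    isBounded_pageSet hA j).subset (Set.Subset.trans ?_ bookInterior_subset_pageSet)
  refine isPreconnected_connectedComponentIn.subset_of_closure_inter_subset (isOpen_bookInterior hA)
    ⟨x, mem_connectedComponentIn hxΓ, hx⟩ ?_
  rintro z ⟨hz, hz'⟩
  exact (closure_bookInterior_subset hA hz).resolve_right (connectedComponentIn_subset _ _ hz')

/-- A point from which one can move upwards without meeting a page is not inside. -/
theorem notMem_inside_of_forall (hA : Admissible θ n) {z : E3}
    (hz : ∀ k ∈ Set.Icc 1 n, z ∈ sector θ n k → ∃ b, 0 < sideForm θ n k b z) :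
    z ∉ inside (bookSurface θ n) ∧ z ∉ bookSurface θ n := by
  set v : E3 := cyl 0 0 1 with hv
  -- Sector conditions do not depend on the height, and side forms do not decrease upwards, so the
  -- positive form at `z` stays positive along the vertical ray.
  have hray : ∀ c : ℝ, 0 ≤ c → z + c • v ∉ bookSurface θ n := by
    intro c hc hmem
    rw [bookSurface_eq hA] at hmem
    obtain ⟨k, hk, ⟨hsec, hside, -⟩, -⟩ := Set.mem_iUnion₂.1 hmem
    have hacr : ∀ γ, across γ (z + c • v) = across γ z := fun γ => by
      rw [across_add, across_smul, hv, across_cyl]; ring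
    obtain ⟨b, hb⟩ := hz k hk fun b => by
      have := hsec b
      rwa [sectorForm, hacr] at this
    have h2 := hside b
    rw [sideForm, hacr] at h2
    rw [sideForm] at hb
    have h3 : (z + c • v) 2 = z 2 + c := by simp [hv]
    rw [h3] at h2
    nlinarith [mul_nonneg (hA.sin_sideEta_nonneg k b) hc]
  have hzΓ : z ∉ bookSurface θ n := by simpa using hray 0 le_rfl
  refine ⟨fun hin => ?_, hzΓ⟩
  set R : Set E3 := (fun c : ℝ => z + c • v) '' Set.Ici 0 with hR
  have hRc : IsPreconnected R := isPreconnected_Ici.image _ (by fun_prop)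
  have hsub : R ⊆ connectedComponentIn (bookSurface θ n)ᶜ z := by
    refine hRc.subset_connectedComponentIn ⟨0, Set.self_mem_Ici, by simp⟩ ?_
    rintro _ ⟨c, hc, rfl⟩
    exact hray c hc
  obtain ⟨M, hM⟩ := (hin.2.subset hsub).exists_norm_le
  have hv1 : ‖v‖ = 1 := by simp [hv, cyl, EuclideanSpace.norm_eq, Fin.sum_univ_three]
  have hM0 : 0 ≤ M := (norm_nonneg _).trans (hM z ⟨0, Set.self_mem_Ici, by simp⟩)
  have h1 := hM (z + (M + ‖z‖ + 1) • v) ⟨_, by rw [Set.mem_Ici]; positivity, rfl⟩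
  have h2 := norm_sub_le (z + (M + ‖z‖ + 1) • v) z
  rw [add_sub_cancel_left, norm_smul, hv1, mul_one, Real.norm_of_nonneg (by positivity)] at h2
  linarith


/-! ### Tilted planes -/

/-- The point with given rotated coordinates. -/
def ofCoords (β a c h : ℝ) : E3 :=
  !₂[a * Real.cos β - c * Real.sin β, a * Real.sin β + c * Real.cos β, h]

theorem along_ofCoords (β a c h : ℝ) : along β (ofCoords β a c h) = a := by
  simp only [along, ofCoords]
  simp
  linear_combination a * Real.sin_sq_add_cos_sq β

theorem across_ofCoords (β a c h : ℝ) : across β (ofCoords β a c h) = c := by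
  simp only [across, ofCoords]
  simp
  linear_combination c * Real.sin_sq_add_cos_sq β

@[simp] theorem ofCoords_apply_two (β a c h : ℝ) : ofCoords β a c h 2 = h := by simp [ofCoords]

theorem inner_eq_coords (β : ℝ) (x y : E3) :
    inner ℝ x y = along β x * along β y + across β x * across β y + x 2 * y 2 := by
  simp only [PiLp.inner_apply, Fin.sum_univ_three, along, across]
  simp
  linear_combination (-(x 0 * y 0 + x 1 * y 1)) * Real.sin_sq_add_cos_sq β

theorem norm_sq_eq_coords (β : ℝ) (x : E3) :
    ‖x‖ ^ 2 = along β x ^ 2 + across β x ^ 2 + x 2 ^ 2 := by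
  rw [← real_inner_self_eq_norm_sq, inner_eq_coords β]; ring

/-- The isometric parametrization of the plane through `0` that contains the direction of angle `β`
and is tilted from the vertical by `ζ`. -/
def chart (β ζ : ℝ) (q : ℂ) : E3 :=
  ofCoords β q.re (Real.sin ζ * q.im) (-(Real.cos ζ * q.im))

/-- A unit normal of this plane. -/
def chartNormal (β ζ : ℝ) : E3 := ofCoords β 0 (Real.cos ζ) (Real.sin ζ)

theorem chart_sub (β ζ : ℝ) (p q : ℂ) : chart β ζ (p - q) = chart β ζ p - chart β ζ q := by
  ext i
  fin_cases i <;> simp [chart, ofCoords] <;> ring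

theorem norm_chart (β ζ : ℝ) (q : ℂ) : ‖chart β ζ q‖ = ‖q‖ := by
  have h : ‖chart β ζ q‖ ^ 2 = ‖q‖ ^ 2 := by
    rw [norm_sq_eq_coords β, chart, along_ofCoords, across_ofCoords, ofCoords_apply_two,
      Complex.sq_norm, Complex.normSq_apply]
    linear_combination q.im ^ 2 * Real.sin_sq_add_cos_sq ζ
  exact (pow_left_inj₀ (norm_nonneg _) (norm_nonneg _) two_ne_zero).1 h

theorem isometry_chart (β ζ : ℝ) : Isometry (chart β ζ) :=
  Isometry.of_dist_eq fun p q => by rw [dist_eq_norm, ← chart_sub, norm_chart, dist_eq_norm]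

theorem norm_chartNormal (β ζ : ℝ) : ‖chartNormal β ζ‖ = 1 := by
  have h : ‖chartNormal β ζ‖ ^ 2 = 1 := by
    rw [norm_sq_eq_coords β, chartNormal, along_ofCoords, across_ofCoords, ofCoords_apply_two]
    linear_combination Real.sin_sq_add_cos_sq ζ
  exact (pow_eq_one_iff_of_nonneg (norm_nonneg _) two_ne_zero).1 h

theorem inner_chartNormal (β ζ : ℝ) (x : E3) :
    inner ℝ x (chartNormal β ζ) = across β x * Real.cos ζ + x 2 * Real.sin ζ := by
  rw [inner_eq_coords β, chartNormal, along_ofCoords, across_ofCoords, ofCoords_apply_two]; ring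

theorem inner_chart_chartNormal (β ζ : ℝ) (q : ℂ) :
    inner ℝ (chart β ζ q) (chartNormal β ζ) = 0 := by
  rw [inner_chartNormal, chart, across_ofCoords, ofCoords_apply_two]; ring

/-- The parameter of the orthogonal projection of a point to the tilted plane. -/
def chartInv (β ζ : ℝ) (x : E3) : ℂ :=
  ⟨along β x, across β x * Real.sin ζ - x 2 * Real.cos ζ⟩

theorem continuous_chartInv (β ζ : ℝ) : Continuous (chartInv β ζ) := by
  have h1 := continuous_along β
  have h2 := continuous_across β
  have e : chartInv β ζ = fun x => ((along β x : ℝ) : ℂ) +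
      ((across β x * Real.sin ζ - x 2 * Real.cos ζ : ℝ) : ℂ) * Complex.I := by
    funext x
    rw [← Complex.mk_eq_add_mul_I]; rfl
  rw [e]
  fun_prop

theorem chartInv_chart (β ζ : ℝ) (q : ℂ) : chartInv β ζ (chart β ζ q) = q := by
  apply Complex.ext
  · simp only [chartInv, chart, along_ofCoords]
  · simp only [chartInv, chart, across_ofCoords, ofCoords_apply_two]
    linear_combination q.im * Real.sin_sq_add_cos_sq ζ

theorem chart_chartInv {β ζ : ℝ} {x : E3} (hx : inner ℝ x (chartNormal β ζ) = 0) :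
    chart β ζ (chartInv β ζ x) = x := by
  rw [inner_chartNormal] at hx
  have h := Real.sin_sq_add_cos_sq ζ
  refine ext_coords β ?_ ?_ ?_
  · simp only [chartInv, chart, along_ofCoords]
  · simp only [chartInv, chart, across_ofCoords]
    linear_combination across β x * h - Real.cos ζ * hx
  · simp only [chartInv, chart, ofCoords_apply_two]
    linear_combination x 2 * h - Real.sin ζ * hx

section Tilt

variable {β γ ζ ζ' η : ℝ} {p q : ℂ}

theorem along_chart (β γ ζ : ℝ) (q : ℂ) : along β (chart (β + γ) ζ q) =
    q.re * Real.cos γ - Real.sin ζ * q.im * Real.sin γ := by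
  have := along_add_angle (β + γ) (-γ) (chart (β + γ) ζ q)
  rw [add_neg_cancel_right, Real.cos_neg, Real.sin_neg] at this
  rw [this, chart, along_ofCoords, across_ofCoords]; ring

theorem across_chart (β γ ζ : ℝ) (q : ℂ) : across β (chart (β + γ) ζ q) =
    q.re * Real.sin γ + Real.sin ζ * q.im * Real.cos γ := by
  have := across_add_angle (β + γ) (-γ) (chart (β + γ) ζ q)
  rw [add_neg_cancel_right, Real.cos_neg, Real.sin_neg] at this
  rw [this, chart, along_ofCoords, across_ofCoords]; ring

theorem inner_chart_sub_chart (β γ ζ ζ' : ℝ) (p q : ℂ) :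
    inner ℝ (chart (β + γ) ζ q - chart β ζ' p) (chartNormal β ζ') =
      q.re * Real.sin γ * Real.cos ζ' + q.im * (Real.sin ζ * Real.cos γ * Real.cos ζ'
        - Real.cos ζ * Real.sin ζ') := by
  rw [inner_sub_left, inner_chart_chartNormal, inner_chartNormal, across_chart, chart,
    ofCoords_apply_two]
  ring

theorem abs_mul_le_one {a b : ℝ} (ha : |a| ≤ 1) (hb : |b| ≤ 1) : |a * b| ≤ 1 := by
  rw [abs_mul]; exact mul_le_one₀ ha (abs_nonneg _) hb

theorem abs_sin_le_of_abs_le (h : |ζ| ≤ η) : |Real.sin ζ| ≤ η := Real.abs_sin_le_abs.trans h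

/-- Two tilted planes seen from each other: lower bound for the numerator of the kernel. -/
theorem le_inner_chart_sub_chart (hζ : |ζ| ≤ η) (hζ' : |ζ'| ≤ η) (hη1 : η ≤ 1) (hq : 0 ≤ q.re)
    (hq' : 0 ≤ q.im) (hγ : |γ| ≤ 1) :
    q.re * (|γ| - |γ| ^ 3 / 6) * (1 - η ^ 2 / 2) - 2 * η * q.im ≤
      SignType.sign γ * inner ℝ (chart (β + γ) ζ q - chart β ζ' p) (chartNormal β ζ') := by
  have hη : 0 ≤ η := (abs_nonneg _).trans hζ
  rw [inner_chart_sub_chart]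
  have hs : (SignType.sign γ : ℝ) * Real.sin γ = Real.sin |γ| := by
    rcases lt_trichotomy γ 0 with h | h | h
    · rw [sign_neg h, abs_of_neg h, Real.sin_neg]; simp
    · simp [h]
    · rw [sign_pos h, abs_of_pos h]; simp
  have hsg : |(SignType.sign γ : ℝ)| ≤ 1 := by
    rcases lt_trichotomy γ 0 with h | h | h
    · rw [sign_neg h]; simp
    · simp [h]
    · rw [sign_pos h]; simp
  have h1 : |γ| - |γ| ^ 3 / 6 ≤ Real.sin |γ| := by
    rcases eq_or_lt_of_le (abs_nonneg γ) with h | h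
    · rw [← h]; simp
    · exact (Real.sin_gt_sub_cube h).le
  have h1' : 0 ≤ |γ| - |γ| ^ 3 / 6 := by
    have := mul_le_of_le_one_right (abs_nonneg γ) (pow_le_one₀ (n := 2) (abs_nonneg γ) hγ)
    nlinarith [abs_nonneg γ]
  have h2 : 1 - η ^ 2 / 2 ≤ Real.cos ζ' := by
    have := Real.one_sub_sq_div_two_le_cos (x := ζ')
    have h3 := sq_le_sq' (by linarith [abs_nonneg ζ']) hζ'
    rw [sq_abs] at h3
    linarith
  have h4 : |(SignType.sign γ : ℝ) * (Real.sin ζ * Real.cos γ * Real.cos ζ'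
        - Real.cos ζ * Real.sin ζ')| ≤ 2 * η := by
    rw [abs_mul]
    have ha : |Real.sin ζ * Real.cos γ * Real.cos ζ'| ≤ η := by
      rw [mul_assoc, abs_mul]
      exact (mul_le_of_le_one_right (abs_nonneg _) (abs_mul_le_one (Real.abs_cos_le_one _)
        (Real.abs_cos_le_one _))).trans (abs_sin_le_of_abs_le hζ)
    have hb : |Real.cos ζ * Real.sin ζ'| ≤ η := by
      rw [abs_mul]
      exact (mul_le_of_le_one_left (abs_nonneg _) (Real.abs_cos_le_one _)).trans
        (abs_sin_le_of_abs_le hζ')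
    calc _ ≤ 1 * (η + η) := mul_le_mul hsg ((abs_sub _ _).trans (add_le_add ha hb))
          (abs_nonneg _) zero_le_one
      _ = 2 * η := by ring
  have h5 := mul_le_mul_of_nonneg_left (neg_le_of_abs_le h4) hq'
  have h6 : q.re * (|γ| - |γ| ^ 3 / 6) * (1 - η ^ 2 / 2) ≤ q.re * Real.sin |γ| * Real.cos ζ' :=
    mul_le_mul (mul_le_mul_of_nonneg_left h1 hq) h2 (by nlinarith)
      (mul_nonneg hq (h1'.trans h1))
  have e : q.re * Real.sin |γ| * Real.cos ζ' =
      SignType.sign γ * (q.re * Real.sin γ * Real.cos ζ') := by rw [← hs]; ring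
  rw [mul_add]
  linarith

/-- The capital letters stand for the separation of two planes at the same chart parameter, mainly
the transverse `B` of size `R`. The small letters stand for a displacement within one plane, of
length `v` and almost without transverse part. So every cross term is of order `θ * R * v`. -/
theorem sq_sum_le {θ R v A B C a b c : ℝ} (hθ0 : 0 ≤ θ) (hθ : θ ≤ 1 / 2) (hR : 0 ≤ R) (hv : 0 ≤ v)
    (hA : |A| ≤ R * θ) (hB : |B| ≤ R * (1 + 2 * θ)) (hC : |C| ≤ R * θ) (ha : |a| ≤ v)
    (hb : |b| ≤ v * θ) (hc : |c| ≤ v) (habc : a ^ 2 + b ^ 2 + c ^ 2 = v ^ 2) :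
    (A + a) ^ 2 + (B + b) ^ 2 + (C + c) ^ 2 ≤ (1 + 11 * θ) * (v ^ 2 + R ^ 2) := by
  have hRv := mul_nonneg hR hv
  have h1 : A * a ≤ R * θ * v := (le_abs_self _).trans (by
    rw [abs_mul]; exact mul_le_mul hA ha (abs_nonneg _) (by positivity))
  have h2 : B * b ≤ R * (1 + 2 * θ) * (v * θ) := (le_abs_self _).trans (by
    rw [abs_mul]; exact mul_le_mul hB hb (abs_nonneg _) (by positivity))
  have h3 : C * c ≤ R * θ * v := (le_abs_self _).trans (by
    rw [abs_mul]; exact mul_le_mul hC hc (abs_nonneg _) (by positivity))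
  have hA2 : A ^ 2 ≤ (R * θ) ^ 2 := sq_le_sq' (neg_le_of_abs_le hA) (le_of_abs_le hA)
  have hB2 : B ^ 2 ≤ (R * (1 + 2 * θ)) ^ 2 := sq_le_sq' (neg_le_of_abs_le hB) (le_of_abs_le hB)
  have hC2 : C ^ 2 ≤ (R * θ) ^ 2 := sq_le_sq' (neg_le_of_abs_le hC) (le_of_abs_le hC)
  have h5 : R * (1 + 2 * θ) * (v * θ) ≤ 2 * (R * v * θ) := by
    have : R * v * θ * (1 + 2 * θ) ≤ R * v * θ * 2 :=
      mul_le_mul_of_nonneg_left (by linarith) (by positivity)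
    linarith
  have h6 : R * v * θ ≤ (R ^ 2 + v ^ 2) / 2 * θ :=
    mul_le_mul_of_nonneg_right (by nlinarith [sq_nonneg (R - v)]) hθ0
  have h7 : R ^ 2 * (θ * θ) ≤ R ^ 2 * (θ * (1 / 2)) := by gcongr
  nlinarith

/-- Two tilted planes seen from each other: upper bound for the denominator of the kernel. -/
theorem norm_sq_chart_sub_chart_le {θ r : ℝ} (hζ : |ζ| ≤ η) (hζ' : |ζ'| ≤ η) (hη : η ≤ |γ| * θ)
    (hγ : |γ| ≤ θ) (hθ : θ ≤ 1 / 2) (hq : 0 ≤ q.re) (hq' : 0 ≤ q.im) (hqr : q.re ≤ r)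
    (hqr' : q.im ≤ r) :
    ‖chart (β + γ) ζ q - chart β ζ' p‖ ^ 2 ≤ (1 + 11 * θ) * (‖q - p‖ ^ 2 + (r * |γ|) ^ 2) := by
  have hη0 : 0 ≤ η := (abs_nonneg _).trans hζ
  have hγ0 := abs_nonneg γ
  have hθ0 : 0 ≤ θ := hγ0.trans hγ
  have hr : 0 ≤ r := hq.trans hqr
  have hηθ : η ≤ θ := hη.trans (mul_le_of_le_one_left hθ0 (by linarith))
  -- First change the plane at fixed parameter, then the parameter within the second plane. The
  -- added angle `0` lets one formula for the coordinates serve both planes.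
  have e : chart (β + γ) ζ q - chart β ζ' p =
      (chart (β + γ) ζ q - chart (β + 0) ζ' q) + chart (β + 0) ζ' (q - p) := by
    rw [add_zero, chart_sub]; abel
  have hal : ∀ x y : E3, along β (x - y) = along β x - along β y := fun x y => by
    simp [along]; ring
  have hac : ∀ x y : E3, across β (x - y) = across β x - across β y := fun x y => by
    simp [across]; ring
  have hcos : ∀ ψ, |ψ| ≤ η → 1 - η ^ 2 / 2 ≤ Real.cos ψ := fun ψ hψ => by
    have := Real.one_sub_sq_div_two_le_cos (x := ψ)
    have h3 := sq_le_sq' (by linarith [abs_nonneg ψ]) hψ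
    rw [sq_abs] at h3
    linarith
  rw [norm_sq_eq_coords β, e, along_add, across_add, PiLp.add_apply, hal, hac, PiLp.sub_apply]
  have hV := norm_sq_eq_coords β (chart (β + 0) ζ' (q - p))
  rw [norm_chart] at hV
  simp only [along_chart, across_chart, Real.cos_zero, Real.sin_zero, mul_one, mul_zero, sub_zero,
    zero_add] at hV ⊢
  simp only [chart, ofCoords_apply_two] at hV ⊢
  have him := Complex.abs_im_le_norm (q - p)
  refine sq_sum_le hθ0 hθ (mul_nonneg hr hγ0) (norm_nonneg _) ?_ ?_ ?_
    (Complex.abs_re_le_norm (q - p)) ?_ ?_ hV.symm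
  · have h1 : |q.re * (Real.cos γ - 1)| ≤ r * (|γ| * (θ / 2)) := by
      rw [abs_mul, abs_of_nonneg hq]
      refine mul_le_mul hqr ?_ (abs_nonneg _) hr
      rw [abs_le]
      have h2 := Real.one_sub_sq_div_two_le_cos (x := γ)
      have h3 : γ ^ 2 ≤ |γ| * θ := by rw [← sq_abs]; nlinarith
      exact ⟨by linarith, by linarith [Real.cos_le_one γ, mul_nonneg hγ0 hθ0]⟩
    have h2 : |Real.sin ζ * q.im * Real.sin γ| ≤ r * (|γ| * (θ / 2)) := by
      rw [abs_mul, abs_mul, abs_of_nonneg hq']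
      have h3 := abs_sin_le_of_abs_le hζ
      have h4 : |Real.sin γ| ≤ 1 / 2 := (Real.abs_sin_le_abs.trans hγ).trans hθ
      calc _ ≤ (|γ| * θ) * r * (1 / 2) := by gcongr; exact h3.trans hη
        _ = _ := by ring
    calc _ = |q.re * (Real.cos γ - 1) - Real.sin ζ * q.im * Real.sin γ| := by ring_nf
      _ ≤ _ := (abs_sub _ _).trans (add_le_add h1 h2)
      _ = _ := by ring
  · have h1 : |q.re * Real.sin γ| ≤ r * |γ| := by
      rw [abs_mul, abs_of_nonneg hq]
      exact mul_le_mul hqr Real.abs_sin_le_abs (abs_nonneg _) hr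
    have h2 : |Real.sin ζ * q.im * Real.cos γ| ≤ r * |γ| * θ := by
      rw [abs_mul, abs_mul, abs_of_nonneg hq']
      calc _ ≤ (|γ| * θ) * r * 1 := by
            gcongr
            · exact (abs_sin_le_of_abs_le hζ).trans hη
            · exact Real.abs_cos_le_one _
        _ = _ := by ring
    have h3 : |Real.sin ζ' * q.im| ≤ r * |γ| * θ := by
      rw [abs_mul, abs_of_nonneg hq']
      calc _ ≤ (|γ| * θ) * r := by gcongr; exact (abs_sin_le_of_abs_le hζ').trans hη
        _ = _ := by ring
    calc _ ≤ |q.re * Real.sin γ + Real.sin ζ * q.im * Real.cos γ| + |Real.sin ζ' * q.im| := abs_sub _ _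
      _ ≤ |q.re * Real.sin γ| + |Real.sin ζ * q.im * Real.cos γ| + |Real.sin ζ' * q.im| := by
        gcongr; exact abs_add_le _ _
      _ ≤ r * |γ| + r * |γ| * θ + r * |γ| * θ := by gcongr
      _ = _ := by ring
  · have h1 := hcos ζ hζ
    have h2 := hcos ζ' hζ'
    have h3 := Real.cos_le_one ζ
    have h4 := Real.cos_le_one ζ'
    have h5 : |Real.cos ζ' - Real.cos ζ| ≤ |γ| * θ := by
      have : η ^ 2 ≤ 1 * (|γ| * θ) := by
        rw [sq]; exact mul_le_mul (by linarith) hη hη0 zero_le_one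
      exact abs_le.2 ⟨by linarith, by linarith⟩
    calc _ = |q.im * (Real.cos ζ' - Real.cos ζ)| := by ring_nf
      _ = q.im * |Real.cos ζ' - Real.cos ζ| := by rw [abs_mul, abs_of_nonneg hq']
      _ ≤ r * (|γ| * θ) := by gcongr
      _ = _ := by ring
  · rw [abs_mul, mul_comm]
    exact mul_le_mul him ((abs_sin_le_of_abs_le hζ').trans hηθ) (abs_nonneg _) (norm_nonneg _)
  · rw [abs_neg, abs_mul]
    exact (mul_le_of_le_one_left (abs_nonneg _) (Real.abs_cos_le_one _)).trans him

/-- The ratio between the kernel of the flat limit and that of two tilted planes. -/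
def tiltLoss (τ : ℝ) : ℝ := ((1 - τ) ^ 3 - 4 * τ) / ((1 + 11 * τ) * (1 + τ)) ^ 3

theorem loss_pos {τ : ℝ} (hτ : τ ≤ 1 / 10) : 0 < (1 - τ) ^ 3 - 4 * τ := by
  have : (1 - 1 / 10 : ℝ) ^ 3 ≤ (1 - τ) ^ 3 := pow_le_pow_left₀ (by norm_num) (by linarith) 3
  norm_num at this
  linarith

theorem tiltLoss_nonneg {τ : ℝ} (h0 : 0 ≤ τ) (h1 : τ ≤ 1 / 10) : 0 ≤ tiltLoss τ := by
  have := loss_pos h1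
  unfold tiltLoss
  positivity

theorem tendsto_tiltLoss : Tendsto tiltLoss (𝓝 0) (𝓝 1) := by
  have h : ContinuousAt tiltLoss 0 := by
    unfold tiltLoss
    refine ContinuousAt.div (by fun_prop) (by fun_prop) (by norm_num)
  have := h.tendsto
  simpa [tiltLoss] using this

/-- The rotation by `γ` produces the main term of size `t * |γ|`. The tilts can subtract at most `2
* η * q.im ≤ 4 * τ * (t * |γ|)`, thanks to `η ≤ |γ| * τ`; without this the kernel might change sign.
-/
theorem inner_chart_pos {τ t : ℝ} (hτ : τ ≤ 1 / 10) (ht : 0 < t) (hγ0 : γ ≠ 0)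
    (hγ : |γ| ≤ τ) (hζ : |ζ| ≤ η) (hζ' : |ζ'| ≤ η) (hη : η ≤ |γ| * τ)
    (hq : t * (1 - τ) ≤ q.re) (hq' : t * (1 - τ) ≤ q.im) (hqt' : q.im ≤ t * (1 + τ)) :
    t * |γ| * ((1 - τ) ^ 3 - 4 * τ) ≤
      SignType.sign γ * inner ℝ (chart (β + γ) ζ q - chart β ζ' p) (chartNormal β ζ') := by
  have hη0 : 0 ≤ η := (abs_nonneg _).trans hζ
  have hγ1 : 0 < |γ| := abs_pos.2 hγ0
  have hτ0 : 0 < τ := hγ1.trans_le hγ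
  have hq0 : 0 < t * (1 - τ) := mul_pos ht (by linarith)
  have hητ : η ≤ τ := hη.trans (mul_le_of_le_one_left hτ0.le (by linarith))
  refine le_trans ?_ (le_inner_chart_sub_chart hζ hζ' (by linarith) (hq0.le.trans hq)
    (hq0.le.trans hq') (by linarith))
  have h1 : |γ| * (1 - τ) ≤ |γ| - |γ| ^ 3 / 6 := by
    have : |γ| ^ 2 ≤ τ := by nlinarith
    nlinarith
  have h2 : 1 - τ ≤ 1 - η ^ 2 / 2 := by nlinarith
  have h0 : 0 ≤ 1 - τ := by linarith
  have h3 : t * (1 - τ) * (|γ| * (1 - τ)) * (1 - τ) ≤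
      q.re * (|γ| - |γ| ^ 3 / 6) * (1 - η ^ 2 / 2) := by
    have := mul_nonneg hγ1.le h0
    gcongr
    · exact mul_nonneg (hq0.le.trans hq) (this.trans h1)
    · exact hq0.le.trans hq
  have h4 : 2 * η * q.im ≤ 4 * τ * (t * |γ|) := by
    calc 2 * η * q.im ≤ 2 * (|γ| * τ) * (t * (1 + τ)) := by
          gcongr; exact hq0.le.trans hq'
      _ ≤ 2 * (|γ| * τ) * (t * 2) := by gcongr; linarith
      _ = _ := by ring
  linarith

/-- Two tilted planes seen from each other: lower bound for the kernel. -/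
theorem tiltLoss_mul_poisson_le {τ t : ℝ} (hτ : τ ≤ 1 / 10) (ht : 0 < t) (hγ0 : γ ≠ 0)
    (hγ : |γ| ≤ τ) (hζ : |ζ| ≤ η) (hζ' : |ζ'| ≤ η) (hη : η ≤ |γ| * τ)
    (hq : t * (1 - τ) ≤ q.re) (hq' : t * (1 - τ) ≤ q.im) (hqt : q.re ≤ t * (1 + τ))
    (hqt' : q.im ≤ t * (1 + τ)) :
    tiltLoss τ * poisson (t * |γ|) (q - p) ≤
      SignType.sign γ * inner ℝ (chart (β + γ) ζ q - chart β ζ' p) (chartNormal β ζ') /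
        ‖chart (β + γ) ζ q - chart β ζ' p‖ ^ 3 := by
  have h1 := inner_chart_pos (β := β) (p := p) hτ ht hγ0 hγ hζ hζ' hη hq hq' hqt'
  have hγ1 : 0 < |γ| := abs_pos.2 hγ0
  have hτ0 : 0 < τ := hγ1.trans_le hγ
  have hq0 : 0 < t * (1 - τ) := mul_pos ht (by linarith)
  have hd : 0 < t * |γ| := mul_pos ht hγ1
  have hnum := loss_pos hτ
  set X := chart (β + γ) ζ q - chart β ζ' p with hX
  have hX0 : 0 < ‖X‖ := norm_pos_iff.2 fun h0 => by
    rw [h0, inner_zero_left, mul_zero] at h1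
    exact absurd h1 (not_le.2 (mul_pos hd hnum))
  have h2 : ‖X‖ ^ 2 ≤ (1 + 11 * τ) * (‖q - p‖ ^ 2 + (t * (1 + τ) * |γ|) ^ 2) :=
    norm_sq_chart_sub_chart_le hζ hζ' hη hγ (by linarith) (hq0.le.trans hq) (hq0.le.trans hq') hqt hqt'
  set D := ‖q - p‖ ^ 2 + (t * |γ|) ^ 2 with hD
  have hD0 : 0 < D := by positivity
  have h3 : ‖X‖ ≤ (1 + 11 * τ) * (1 + τ) * √D := by
    refine (pow_le_pow_iff_left₀ hX0.le (by positivity) two_ne_zero).1 (h2.trans ?_)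
    rw [mul_pow _ (√D), Real.sq_sqrt hD0.le]
    have ha : ‖q - p‖ ^ 2 + (t * (1 + τ) * |γ|) ^ 2 ≤ (1 + τ) ^ 2 * D := by
      have : ‖q - p‖ ^ 2 ≤ (1 + τ) ^ 2 * ‖q - p‖ ^ 2 :=
        le_mul_of_one_le_left (by positivity) (by nlinarith)
      rw [hD]; nlinarith
    calc (1 + 11 * τ) * (‖q - p‖ ^ 2 + (t * (1 + τ) * |γ|) ^ 2)
        ≤ (1 + 11 * τ) ^ 2 * ((1 + τ) ^ 2 * D) :=
          mul_le_mul (by nlinarith) ha (by positivity) (by positivity)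
      _ = _ := by ring
  have h4 : ‖X‖ ^ 3 ≤ ((1 + 11 * τ) * (1 + τ)) ^ 3 * √D ^ 3 := by
    rw [← mul_pow]; exact pow_le_pow_left₀ hX0.le h3 3
  have hs : 0 < √D := Real.sqrt_pos.2 hD0
  calc tiltLoss τ * poisson (t * |γ|) (q - p)
      = t * |γ| * ((1 - τ) ^ 3 - 4 * τ) / (((1 + 11 * τ) * (1 + τ)) ^ 3 * √D ^ 3) := by
        rw [tiltLoss, poisson, ← hD]; field_simp
    _ ≤ _ := div_le_div₀ ((mul_pos hd hnum).le.trans h1) h1 (by positivity) h4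

end Tilt


/-! ### The sides near the origin -/

/-- An open set in which the surface coincides with one of the sides of a page. -/
def sideRegion (θ : ℝ) (n j : ℕ) (b : Bool) : Set E3 :=
  {z | sectorForm θ n j (!b) z < 0 ∧ (IsOuter n j b ∨ sectorForm θ n j b z < 0) ∧
    sideForm θ n j (!b) z < 0 ∧ endForm θ n j z < 0 ∧ -1 < z 2 ∧ z 2 < 0}

theorem isOpen_sideRegion (θ : ℝ) (n j : ℕ) (b : Bool) : IsOpen (sideRegion θ n j b) := by
  have h1 : Continuous fun x : E3 => x 2 := by fun_prop
  have h2 := continuous_sectorForm θ n j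
  have h3 := continuous_sideForm θ n j (!b)
  have h4 := continuous_endForm θ n j
  have h5 : IsOpen {z | IsOuter n j b ∨ sectorForm θ n j b z < 0} := by
    by_cases h : IsOuter n j b
    · simp [h]
    · simpa [h] using isOpen_lt (h2 b) continuous_const
  exact (isOpen_lt (h2 _) continuous_const).inter (h5.inter ((isOpen_lt h3 continuous_const).inter
    ((isOpen_lt h4 continuous_const).inter ((isOpen_lt continuous_const h1).inter
    (isOpen_lt h1 continuous_const)))))

theorem sectorForm_neg_or_isOuter {j : ℕ} {b : Bool} {z : E3} (hz : z ∈ sideRegion θ n j b)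
    (c : Bool) : sectorForm θ n j c z < 0 ∨ c = b ∧ IsOuter n j b := by
  by_cases h : c = b
  · subst h
    exact hz.2.1.symm.imp id fun h => ⟨rfl, h⟩
  · left
    have : c = !b := by cases b <;> cases c <;> simp_all
    rw [this]; exact hz.1

theorem mem_bookInterior_of_sideForm_neg (hA : Admissible θ n) {j : ℕ} (hj : j ∈ Set.Icc 1 n)
    {b : Bool} {z : E3} (hz : z ∈ sideRegion θ n j b) (h : sideForm θ n j b z < 0) :
    z ∈ bookInterior θ n := by
  have hsec : ∀ c, sectorForm θ n j c z < 0 := fun c => by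
    rcases sectorForm_neg_or_isOuter hz c with hc | ⟨rfl, ho⟩
    · exact hc
    · rwa [sectorForm_eq_sideForm ho]
  have hside : ∀ c, sideForm θ n j c z < 0 := fun c => by
    by_cases hc : c = b
    · rwa [hc]
    · have : c = !b := by cases b <;> cases c <;> simp_all
      rw [this]; exact hz.2.2.1
  obtain ⟨-, -, -, hend, h1, h0⟩ := hz
  have hzs : z ∈ sector θ n j := fun c => (hsec c).le
  obtain ⟨ρ, φ, hρ, hl, hu, he⟩ := exists_polar_of_mem_sector hA hzs
  have hf := hsec false
  have hb := hsec true
  rw [sectorForm, sg_false, he, across_cyl] at hf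
  rw [sectorForm, sg_true, he, across_cyl] at hb
  have hρ0 : 0 < ρ := lt_of_le_of_ne hρ fun h => by rw [← h] at hf; simp at hf
  have hl' : sectorAngle θ n j false < φ := lt_of_le_of_ne hl fun h => by rw [← h] at hf; simp at hf
  have hu' : φ < sectorAngle θ n j true := lt_of_le_of_ne hu fun h => by rw [h] at hb; simp at hb
  have := hA.sectorAngle_nonneg hj
  have := hA.sectorAngle_le hj
  have := hA.le
  have := Real.pi_pos
  refine ⟨⟨?_, ?_⟩, j, hj, hzs, hside, hend, h1, h0⟩
  · rw [he, across_cyl]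
    exact mul_pos hρ0 (Real.sin_pos_of_pos_of_lt_pi (by linarith) (by linarith))
  · rw [he, across_cyl]
    exact mul_neg_of_pos_of_neg hρ0 (Real.sin_neg_of_neg_of_neg_pi_lt (by linarith) (by linarith))

theorem mem_bookSurface_of_sideForm_eq_zero (hA : Admissible θ n) {j : ℕ} (hj : j ∈ Set.Icc 1 n)
    {b : Bool} {z : E3} (hz : z ∈ sideRegion θ n j b) (h : sideForm θ n j b z = 0) :
    z ∈ bookSurface θ n := by
  refine pageBoundary_subset hA hj ⟨⟨fun c => ?_, fun c => ?_, hz.2.2.2.1.le, hz.2.2.2.2.1.le,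
    hz.2.2.2.2.2.le⟩, Or.inr (Or.inr (Or.inr ⟨b, h⟩))⟩
  · rcases sectorForm_neg_or_isOuter hz c with hc | ⟨rfl, ho⟩
    · exact hc.le
    · rw [sectorForm_eq_sideForm ho, h]
  · by_cases hc : c = b
    · rw [hc, h]
    · have : c = !b := by cases b <;> cases c <;> simp_all
      rw [this]; exact hz.2.2.1.le

/-- The strict sector inequalities exclude `z` from the sectors of all other pages, and in the
sector of page `j` the positive form is that of `b`. Hence the vertical ray from `z` escapes. -/
theorem notMem_inside_of_sideForm_pos (hA : Admissible θ n) {j : ℕ} (hj : j ∈ Set.Icc 1 n)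
    {b : Bool} {z : E3} (hz : z ∈ sideRegion θ n j b) (h : 0 < sideForm θ n j b z) :
    z ∉ inside (bookSurface θ n) ∧ z ∉ bookSurface θ n := by
  refine notMem_inside_of_forall hA fun k hk hzk => ?_
  obtain ⟨ρ, φ, hρ, hl, hu, he⟩ := exists_polar_of_mem_sector hA hzk
  have h0 := hA.sectorAngle_nonneg hk
  have h1 := hA.sectorAngle_le hk
  have h0' := hA.sectorAngle_nonneg hj
  have h1' := hA.sectorAngle_le hj
  have h2' := hA.sectorAngle_lt j
  have := hA.le
  have := Real.pi_pos
  rcases lt_trichotomy j k with hjk | hjk | hjk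
  · exfalso
    have h3 := (hA.sectorAngle_le_of_lt hj.1 hjk hk.2).1
    rcases sectorForm_neg_or_isOuter hz true with hc | ⟨rfl, ho⟩
    · rw [sectorForm, sg_true, he, across_cyl, one_mul] at hc
      exact absurd hc (not_lt.2 (mul_nonneg hρ
        (Real.sin_nonneg_of_nonneg_of_le_pi (by linarith) (by linarith))))
    · exact not_isOuter_true (lt_of_lt_of_le hjk hk.2) ho
  · exact ⟨b, hjk ▸ h⟩
  · exfalso
    have h3 := (hA.sectorAngle_le_of_lt hk.1 hjk hj.2).1
    rcases sectorForm_neg_or_isOuter hz false with hc | ⟨rfl, ho⟩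
    · rw [sectorForm, sg_false, he, across_cyl] at hc
      have := mul_nonpos_of_nonneg_of_nonpos hρ
        (Real.sin_nonpos_of_nonpos_of_neg_pi_le (x := φ - sectorAngle θ n j false)
          (by linarith) (by linarith))
      linarith
    · exact not_isOuter_false (lt_of_le_of_lt hk.1 hjk) ho

theorem arctan_le_self {x : ℝ} (hx : 0 ≤ x) : Real.arctan x ≤ x := by
  have h := Real.le_tan (Real.arctan_nonneg.2 hx) (Real.arctan_lt_pi_div_two x)
  rwa [Real.tan_arctan] at h

/-- The slope of a side, with a sign. -/
def tilt (θ : ℝ) (n j : ℕ) (b : Bool) : ℝ := sg b * Real.arctan (Real.sin (sideEta θ n j b))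

/-- The outward unit normal of a side. -/
def sideNormal (θ : ℝ) (n j : ℕ) (b : Bool) : E3 :=
  sg b • chartNormal (sideAngle θ n j b) (tilt θ n j b)

theorem norm_sideNormal (θ : ℝ) (n j : ℕ) (b : Bool) : ‖sideNormal θ n j b‖ = 1 := by
  rw [sideNormal, norm_smul, norm_chartNormal, mul_one]
  cases b <;> simp

theorem sideForm_eq_inner (θ : ℝ) (n j : ℕ) (b : Bool) (x : E3) : sideForm θ n j b x =
    √(1 + Real.sin (sideEta θ n j b) ^ 2) * inner ℝ x (sideNormal θ n j b) := by
  have h : √(1 + Real.sin (sideEta θ n j b) ^ 2) ≠ 0 := by positivity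
  rw [sideNormal, inner_smul_right, inner_chartNormal, tilt, cos_sg_mul, sin_sg_mul,
    Real.cos_arctan, Real.sin_arctan, sideForm]
  field_simp
  linear_combination (-(Real.sin (sideEta θ n j b) * x 2)) * sg_mul_self b

theorem abs_tilt_le (hA : Admissible θ n) (j : ℕ) (b : Bool) : |tilt θ n j b| ≤ eta θ n := by
  have h1 : |tilt θ n j b| = Real.arctan (Real.sin (sideEta θ n j b)) := by
    rw [tilt, abs_mul, abs_of_nonneg (Real.arctan_nonneg.2 (hA.sin_sideEta_nonneg j b))]
    cases b <;> simp
  rw [h1]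
  calc _ ≤ Real.sin (sideEta θ n j b) := arctan_le_self (hA.sin_sideEta_nonneg j b)
    _ ≤ sideEta θ n j b := Real.sin_le (hA.sideEta_nonneg j b)
    _ ≤ _ := hA.sideEta_le j b

/-- The chart of the plane of a side. -/
def sideChart (θ : ℝ) (n j : ℕ) (b : Bool) : ℂ → E3 := chart (sideAngle θ n j b) (tilt θ n j b)

theorem sideForm_sideChart (θ : ℝ) (n j : ℕ) (b : Bool) (q : ℂ) :
    sideForm θ n j b (sideChart θ n j b q) = 0 := by
  rw [sideForm_eq_inner, sideNormal, inner_smul_right, sideChart, inner_chart_chartNormal, mul_zero,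
    mul_zero]

/-- Throughout `sideRegion` the sign of `sideForm`, a positive multiple of the linear form of
`sideNormal`, decides between inside, surface and outside. -/
theorem isOutwardUnitNormal_sideNormal (hA : Admissible θ n) {j : ℕ} (hj : j ∈ Set.Icc 1 n)
    {b : Bool} {z : E3} (hz : z ∈ sideRegion θ n j b) (h : sideForm θ n j b z = 0) :
    IsOutwardUnitNormal (inside (bookSurface θ n)) z (sideNormal θ n j b) := by
  refine ⟨norm_sideNormal θ n j b, ?_⟩
  obtain ⟨r, hr, hsub⟩ := Metric.isOpen_iff.1 (isOpen_sideRegion θ n j b) z hz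
  refine ⟨r, hr, fun x hx => ?_⟩
  have hκ : 0 < √(1 + Real.sin (sideEta θ n j b) ^ 2) := by positivity
  have e : sideForm θ n j b x =
      √(1 + Real.sin (sideEta θ n j b) ^ 2) * inner ℝ (x - z) (sideNormal θ n j b) := by
    rw [inner_sub_left, mul_sub, ← sideForm_eq_inner, ← sideForm_eq_inner, h, sub_zero]
  have e' : inner ℝ (x - z) (sideNormal θ n j b) < 0 ↔ sideForm θ n j b x < 0 := by
    rw [e]
    exact ⟨fun h => mul_neg_of_pos_of_neg hκ h, fun h => by by_contra! hc; exact absurd h (not_lt.2 (mul_nonneg hκ.le hc))⟩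
  rw [e']
  constructor
  · intro hin
    by_contra! hcon
    rcases eq_or_lt_of_le hcon with h0 | h0
    · exact hin.1 (mem_bookSurface_of_sideForm_eq_zero hA hj (hsub hx) h0.symm)
    · exact (notMem_inside_of_sideForm_pos hA hj (hsub hx) h0).1 hin
  · intro hneg
    exact bookInterior_subset_inside hA (mem_bookInterior_of_sideForm_neg hA hj (hsub hx) hneg)

theorem sideForm_eq_zero_of_mem (hA : Admissible θ n) {j : ℕ} (hj : j ∈ Set.Icc 1 n) {b : Bool}
    {z : E3} (hz : z ∈ sideRegion θ n j b) (hΓ : z ∈ bookSurface θ n) : sideForm θ n j b z = 0 := by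
  rcases lt_trichotomy (sideForm θ n j b z) 0 with h | h | h
  · exact absurd hΓ (disjoint_bookInterior hA (mem_bookInterior_of_sideForm_neg hA hj hz h))
  · exact h
  · exact absurd hΓ (notMem_inside_of_sideForm_pos hA hj hz h).2

theorem sg_mul_sin_tilt_mem (hA : Admissible θ n) (j : ℕ) (b : Bool) :
    0 ≤ sg b * Real.sin (tilt θ n j b) ∧ sg b * Real.sin (tilt θ n j b) ≤ eta θ n := by
  rw [tilt, sin_sg_mul, ← mul_assoc, sg_mul_self, one_mul]
  have h1 := Real.arctan_nonneg.2 (hA.sin_sideEta_nonneg j b)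
  have h2 : Real.arctan (Real.sin (sideEta θ n j b)) ≤ eta θ n :=
    (arctan_le_self (hA.sin_sideEta_nonneg j b)).trans
      ((Real.sin_le (hA.sideEta_nonneg j b)).trans (hA.sideEta_le j b))
  exact ⟨Real.sin_nonneg_of_nonneg_of_le_pi h1 (by linarith [Real.arctan_lt_pi_div_two (Real.sin (sideEta θ n j b)), Real.pi_pos]),
    (Real.sin_le h1).trans h2⟩

/-- Close to the origin the end and the bottom are out of reach. The condition `q.im < 2 * q.re`
keeps the point away from the inner edge, where the side meets the middle of the gap. -/
theorem sideChart_mem_sideRegion (hA : Admissible θ n) (j : ℕ) (b : Bool) {q : ℂ} (h0 : 0 < q.im)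
    (h1 : q.im < 2 * q.re) (h2 : q.re < 1 / 12) (h3 : q.im < 1 / 12) :
    sideChart θ n j b q ∈ sideRegion θ n j b := by
  set β := sideAngle θ n j b with hβ
  set ζ := tilt θ n j b with hζ
  set z := sideChart θ n j b q with hz
  have hre : 0 < q.re := by linarith
  have hal : along β z = q.re := by rw [hz, sideChart, chart, along_ofCoords]
  have hac : across β z = Real.sin ζ * q.im := by rw [hz, sideChart, chart, across_ofCoords]
  have hz2 : z 2 = -(Real.cos ζ * q.im) := by rw [hz, sideChart, chart, ofCoords_apply_two]
  obtain ⟨hs0, hs1⟩ := sg_mul_sin_tilt_mem hA j b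
  rw [← hζ] at hs0 hs1
  have hα := hA.half_pos
  have hα' := hA.half_le
  have hπ := Real.pi_pos
  have hπ' := Real.pi_gt_three
  have hη := hA.eta_le
  have hcosζ : 0 < Real.cos ζ := by
    rw [hζ, tilt, cos_sg_mul]; exact Real.cos_arctan_pos _
  have hcosζ1 := Real.cos_le_one ζ
  have hz0 : z 2 < 0 := by rw [hz2]; nlinarith
  have hz1 : -(1 / 12) < z 2 := by rw [hz2]; nlinarith
  have hsg := sg_mul_self b
  have hnb : sg (!b) = -sg b := by cases b <;> simp
  have hform : ∀ ψ, sg (!b) * across (β - sg b * ψ) z =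
      -(sg b * Real.sin ζ * q.im * Real.cos ψ + q.re * Real.sin ψ) := fun ψ => by
    rw [sub_eq_add_neg, across_add_angle, hal, hac, Real.cos_neg, Real.sin_neg, cos_sg_mul,
      sin_sg_mul, hnb]
    linear_combination (-(q.re * Real.sin ψ)) * hsg
  have hneg : ∀ ψ, 0 < ψ → ψ ≤ Real.pi / 2 → sg (!b) * across (β - sg b * ψ) z < 0 := by
    intro ψ hψ hψ'
    rw [hform]
    have := mul_pos hre (hA.sin_pos hψ hψ')
    have := mul_nonneg (mul_nonneg hs0 h0.le)
      (Real.cos_nonneg_of_neg_pi_div_two_le_of_le (by linarith) hψ')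
    linarith
  refine ⟨?_, ?_, ?_, ?_, by linarith, hz0⟩
  · have e : sectorAngle θ n j (!b) = β - sg b * (2 * half θ n + gap θ n j (!b)) := by
      rw [hβ, sectorAngle, sideAngle, hnb]; ring
    rw [sectorForm, e]
    have := hA.gap_nonneg j (!b)
    have := hA.gap_le j (!b)
    exact hneg _ (by linarith) (by linarith)
  · by_cases ho : IsOuter n j b
    · exact Or.inl ho
    right
    have e : sectorAngle θ n j b = β + sg b * half θ n := by
      rw [hβ, sectorAngle, sideAngle, gap, if_neg ho]; ring
    rw [sectorForm, e, across_add_angle, hal, hac, cos_sg_mul, sin_sg_mul]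
    have e2 : sg b * (Real.sin ζ * q.im * Real.cos (half θ n) - q.re * (sg b * Real.sin (half θ n))) =
        sg b * Real.sin ζ * q.im * Real.cos (half θ n) - q.re * Real.sin (half θ n) := by
      linear_combination (-(q.re * Real.sin (half θ n))) * hsg
    rw [e2]
    -- The widening moves the point outwards by at most `η * q.im ≤ 2 * η * q.re`, while the middle
    -- of the gap is at least `q.re * half / 2` away. The bound `8 * η ≤ half` settles the
    -- comparison.
    have hj : 2 / Real.pi * half θ n ≤ Real.sin (half θ n) := Real.mul_le_sin hα.le (by linarith)
    have hj' : 1 / 2 * half θ n ≤ Real.sin (half θ n) := by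
      refine le_trans ?_ hj
      refine mul_le_mul_of_nonneg_right ?_ hα.le
      rw [div_le_div_iff₀ two_pos hπ]
      linarith [Real.pi_le_four]
    have ha : sg b * Real.sin ζ * q.im * Real.cos (half θ n) ≤ eta θ n * (2 * q.re) := by
      calc _ ≤ eta θ n * q.im * 1 := by
            gcongr
            · exact hA.cos_half_pos.le
            · exact mul_nonneg hA.eta_pos.le h0.le
            · exact Real.cos_le_one _
        _ ≤ _ := by rw [mul_one]; exact mul_le_mul_of_nonneg_left h1.le hA.eta_pos.le
    have hb := mul_le_mul_of_nonneg_left hj' hre.le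
    have hc := mul_le_mul_of_nonneg_left hη hre.le
    have hd := mul_pos hre hα
    linarith
  · have e : sideAngle θ n j (!b) = β - sg b * (2 * half θ n) := by
      rw [hβ, sideAngle, sideAngle, hnb]; ring
    rw [sideForm, e]
    have := hneg (2 * half θ n) (by linarith) (by linarith)
    have := mul_nonpos_of_nonneg_of_nonpos (hA.sin_sideEta_nonneg j (!b)) hz0.le
    linarith
  -- The three contributions are below `1/6`, at most `1/12` and at most `-1/2`.
  · rw [endForm]
    have hmid : along (mid θ n j) z ≤ q.re + q.im := by
      have e : mid θ n j = β + -(sg b * half θ n) := by rw [hβ, sideAngle]; ring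
      rw [e, along_add_angle, hal, hac]
      have h4 : |Real.sin ζ * q.im * Real.sin (-(sg b * half θ n))| ≤ q.im := by
        rw [mul_right_comm, abs_mul, abs_of_pos h0]
        exact mul_le_of_le_one_left h0.le (abs_mul_le_one (Real.abs_sin_le_one _)
          (Real.abs_sin_le_one _))
      have h5 := mul_le_mul_of_nonneg_left (Real.cos_le_one (-(sg b * half θ n))) hre.le
      linarith [le_of_abs_le h4]
    have hc : 1 / 2 ≤ Real.cos (half θ n) := by
      rw [← Real.cos_pi_div_three]
      exact Real.cos_le_cos_of_nonneg_of_le_pi hα.le (by linarith) (by linarith)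
    have hd : z 2 * (Real.cos (half θ n + eta θ n) - Real.cos (half θ n)) ≤ 1 / 12 := by
      have := hA.cos_half_add_eta_pos
      have := Real.cos_le_one (half θ n)
      nlinarith
    linarith


/-! ### Plane pieces of a surface -/

theorem map_restrict_surf {Γ : Set E3} (hΓ : IsClosed Γ) {Φ : ℂ → E3} (hΦ : Isometry Φ) {B : Set ℂ}
    (hB : MeasurableSet B) (hsub : Φ '' B ⊆ Γ) :
    ((surf Γ).restrict (Subtype.val ⁻¹' (Φ '' B))).map Subtype.val = (volume.restrict B).map Φ := by
  have hemb : MeasurableEmbedding Φ := hΦ.isClosedEmbedding.measurableEmbedding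
  have hsubt : MeasurableEmbedding (Subtype.val : Γ → E3) :=
    MeasurableEmbedding.subtype_coe hΓ.measurableSet
  have hS : MeasurableSet (Φ '' B) := hemb.measurableSet_image.2 hB
  have e1 : B = Φ ⁻¹' (Φ '' B) := (Set.preimage_image_eq B hΦ.injective).symm
  rw [← hsubt.restrict_map, surf, hsubt.map_comap, Subtype.range_coe, Measure.restrict_restrict hS,
    Set.inter_eq_left.2 hsub]
  nth_rw 2 [e1]
  rw [← hemb.restrict_map, ← restrict_range_eq_map hΦ, Measure.restrict_restrict hS,
    Set.inter_eq_left.2 (Set.image_subset_range Φ B)]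

theorem surf_preimage_image {Γ : Set E3} (hΓ : IsClosed Γ) {Φ : ℂ → E3} (hΦ : Isometry Φ) {B : Set ℂ}
    (hB : MeasurableSet B) (hsub : Φ '' B ⊆ Γ) :
    surf Γ (Subtype.val ⁻¹' (Φ '' B)) = volume B := by
  have h := congrArg (fun m : Measure E3 => m Set.univ) (map_restrict_surf hΓ hΦ hB hsub)
  rwa [Measure.map_apply measurable_subtype_coe MeasurableSet.univ,
    Measure.map_apply hΦ.continuous.measurable MeasurableSet.univ, Set.preimage_univ, Set.preimage_univ,
    Measure.restrict_apply_univ, Measure.restrict_apply_univ] at h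

theorem setIntegral_preimage_image {Γ : Set E3} (hΓ : IsClosed Γ) {Φ : ℂ → E3} (hΦ : Isometry Φ)
    {B : Set ℂ} (hB : MeasurableSet B) (hsub : Φ '' B ⊆ Γ) (g : E3 → ℝ) :
    ∫ x in Subtype.val ⁻¹' (Φ '' B), g (x : E3) ∂(surf Γ) = ∫ q in B, g (Φ q) := by
  have hsubt : MeasurableEmbedding (Subtype.val : Γ → E3) :=
    MeasurableEmbedding.subtype_coe hΓ.measurableSet
  rw [← hsubt.integral_map, map_restrict_surf hΓ hΦ hB hsub,
    hΦ.isClosedEmbedding.measurableEmbedding.integral_map]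

/-! ### The patches -/

/-- The sides are numbered consecutively by `0, …, 2n-1`, so two different ones are between `θ_n`
and `θ` apart. -/
theorem sideAngle_eq_natCast_mul (θ : ℝ) (n k : ℕ) (b : Bool) :
    sideAngle θ n (k + 1) b = ((2 * k + b.toNat : ℕ) : ℝ) * pageAngle θ n := by
  cases b <;> simp [sideAngle, mid, half] <;> ring

theorem abs_sideAngle_sub (hA : Admissible θ n) {i j : Fin n × Bool} (h : i ≠ j) :
    2 * half θ n ≤ |sideAngle θ n (i.1 + 1) i.2 - sideAngle θ n (j.1 + 1) j.2| ∧
      |sideAngle θ n (i.1 + 1) i.2 - sideAngle θ n (j.1 + 1) j.2| ≤ θ := by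
  have hn := hA.two_le
  have hp : 0 < pageAngle θ n := by have := hA.half_pos; unfold half at this; linarith
  rw [sideAngle_eq_natCast_mul, sideAngle_eq_natCast_mul, ← sub_mul, abs_mul, abs_of_pos hp]
  have e : pageAngle θ n = 2 * half θ n := by unfold half; ring
  have hbi := Bool.toNat_le i.2
  have hbj := Bool.toNat_le j.2
  have hi := i.1.2
  have hj := j.1.2
  set a := 2 * (i.1 : ℕ) + i.2.toNat with ha
  set c := 2 * (j.1 : ℕ) + j.2.toNat with hc
  have hne : a ≠ c := by
    intro hac
    apply h
    have h1 : (i.1 : ℕ) = j.1 := by omega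
    have h2 : i.2.toNat = j.2.toNat := by omega
    exact Prod.ext (Fin.ext h1) (by revert h2; cases i.2 <;> cases j.2 <;> simp)
  constructor
  · rw [← e]
    refine le_mul_of_one_le_left hp.le ?_
    rcases lt_or_gt_of_ne hne with h1 | h1
    · have : (a : ℝ) + 1 ≤ c := by exact_mod_cast h1
      rw [abs_of_neg (by linarith)]; linarith
    · have : (c : ℝ) + 1 ≤ a := by exact_mod_cast h1
      rw [abs_of_pos (by linarith)]; linarith
  · refine (mul_le_mul_of_nonneg_right ?_ hp.le).trans (pageAngle_mul hn θ).le
    have h1 : (a : ℝ) + 1 ≤ 2 * n := by exact_mod_cast (show a + 1 ≤ 2 * n by omega)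
    have h2 : (c : ℝ) + 1 ≤ 2 * n := by exact_mod_cast (show c + 1 ≤ 2 * n by omega)
    have h3 : (0 : ℝ) ≤ a := Nat.cast_nonneg a
    have h4 : (0 : ℝ) ≤ c := Nat.cast_nonneg c
    exact abs_le.2 ⟨by linarith, by linarith⟩

/-- The parameters of a patch of scale `t`. -/
def patchBall (τ t : ℝ) : Set ℂ := Metric.ball ⟨t, t⟩ (τ * t)

theorem bounds_of_mem_closedBall {τ t : ℝ} {q : ℂ} (hq : q ∈ Metric.closedBall (⟨t, t⟩ : ℂ) (τ * t)) :
    t * (1 - τ) ≤ q.re ∧ q.re ≤ t * (1 + τ) ∧ t * (1 - τ) ≤ q.im ∧ q.im ≤ t * (1 + τ) := by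
  rw [mem_closedBall_iff_norm] at hq
  have h1 := abs_le.1 ((Complex.abs_re_le_norm _).trans hq)
  have h2 := abs_le.1 ((Complex.abs_im_le_norm _).trans hq)
  simp only [Complex.sub_re, Complex.sub_im] at h1 h2
  exact ⟨by linarith [h1.1], by linarith [h1.2], by linarith [h2.1], by linarith [h2.2]⟩

theorem patchBall_subset (τ t : ℝ) : patchBall τ t ⊆ Metric.closedBall ⟨t, t⟩ (τ * t) :=
  Metric.ball_subset_closedBall

theorem sideChart_patchBall_subset (hA : Admissible θ n) {τ t : ℝ} (hτ : τ ≤ 1 / 10) (ht : 0 < t)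
    (ht' : t ≤ 1 / 16) (j : ℕ) (b : Bool) : sideChart θ n j b '' patchBall τ t ⊆ sideRegion θ n j b := by
  rintro _ ⟨q, hq, rfl⟩
  obtain ⟨h1, h2, h3, h4⟩ := bounds_of_mem_closedBall (patchBall_subset τ t hq)
  have := mul_le_mul_of_nonneg_left hτ ht.le
  -- With `τ ≤ 1/10` and `t ≤ 1/16` one has `t * (1 + τ) ≤ 11/160 < 1/12` and `1 + τ < 2 * (1 - τ)`.
  exact sideChart_mem_sideRegion hA j b (by linarith) (by linarith) (by linarith) (by linarith)

/-- A small piece, at scale `t`, of a side. -/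
def patch (θ : ℝ) (n : ℕ) (τ t : ℝ) (i : Fin n × Bool) : Set (bookSurface θ n) :=
  Subtype.val ⁻¹' (sideChart θ n (i.1 + 1) i.2 '' patchBall τ t)

theorem page_mem (i : Fin n × Bool) : (i.1 : ℕ) + 1 ∈ Set.Icc 1 n := ⟨by omega, i.1.2⟩

theorem isometry_sideChart (θ : ℝ) (n j : ℕ) (b : Bool) : Isometry (sideChart θ n j b) :=
  isometry_chart _ _

/-- Within the open `sideRegion` the surface is the plane of the side, so the patch is cut out of
the surface by an open condition on the projected chart parameter. -/
theorem isOpen_patch (hA : Admissible θ n) {τ t : ℝ} (hτ : τ ≤ 1 / 10) (ht : 0 < t)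
    (ht' : t ≤ 1 / 16) (i : Fin n × Bool) : IsOpen (patch θ n τ t i) := by
  have hsub := sideChart_patchBall_subset hA hτ ht ht' (i.1 + 1) i.2
  set β := sideAngle θ n (i.1 + 1) i.2
  set ζ := tilt θ n (i.1 + 1) i.2
  have e : patch θ n τ t i = Subtype.val ⁻¹' (sideRegion θ n (i.1 + 1) i.2 ∩
      chartInv β ζ ⁻¹' patchBall τ t) := by
    ext x
    constructor
    · intro hx
      refine ⟨hsub hx, ?_⟩
      obtain ⟨q, hq, he⟩ := hx
      rw [Set.mem_preimage, ← he]
      change chartInv β ζ (chart β ζ q) ∈ _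
      rwa [chartInv_chart]
    · rintro ⟨hx, hq⟩
      refine ⟨_, hq, chart_chartInv ?_⟩
      have h0 := sideForm_eq_zero_of_mem hA (page_mem i) hx x.2
      rw [sideForm_eq_inner, sideNormal, inner_smul_right] at h0
      have h1 : √(1 + Real.sin (sideEta θ n (i.1 + 1) i.2) ^ 2) ≠ 0 := by positivity
      have h2 : sg i.2 ≠ 0 := fun h => by simpa [h] using sg_mul_self i.2
      simpa [h1, h2] using h0
  rw [e]
  exact ((isOpen_sideRegion θ n _ _).inter
    (Metric.isOpen_ball.preimage (continuous_chartInv β ζ))).preimage continuous_subtype_val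

theorem sideChart_patchBall_subset_bookSurface (hA : Admissible θ n) {τ t : ℝ} (hτ : τ ≤ 1 / 10)
    (ht : 0 < t) (ht' : t ≤ 1 / 16) (i : Fin n × Bool) :
    sideChart θ n (i.1 + 1) i.2 '' patchBall τ t ⊆ bookSurface θ n := by
  intro x hx
  refine mem_bookSurface_of_sideForm_eq_zero hA (page_mem i)
    (sideChart_patchBall_subset hA hτ ht ht' _ _ hx) ?_
  obtain ⟨q, -, rfl⟩ := hx
  exact sideForm_sideChart θ n _ _ q

theorem surf_patch (hA : Admissible θ n) {τ t : ℝ} (hτ : τ ≤ 1 / 10) (ht : 0 < t) (ht' : t ≤ 1 / 16)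
    (i : Fin n × Bool) : surf (bookSurface θ n) (patch θ n τ t i) = volume (patchBall τ t) :=
  surf_preimage_image (isCompact_bookSurface hA).isClosed (isometry_sideChart θ n _ _)
    Metric.isOpen_ball.measurableSet (sideChart_patchBall_subset_bookSurface hA hτ ht ht' i)

/-- The distance from the origin separates patches of different scales, and the origin itself from
all patches. -/
theorem norm_bounds_of_mem_patch {τ t : ℝ} (ht : 0 < t) {i : Fin n × Bool} {x : bookSurface θ n}
    (hx : x ∈ patch θ n τ t i) : t * (1 - τ) ≤ ‖(x : E3)‖ ∧ ‖(x : E3)‖ ≤ 2 * t * (1 + τ) := by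
  obtain ⟨q, hq, he⟩ := hx
  obtain ⟨h1, h2, h3, h4⟩ := bounds_of_mem_closedBall (patchBall_subset τ t hq)
  rw [← he, sideChart, norm_chart]
  refine ⟨h1.trans ((le_abs_self _).trans (Complex.abs_re_le_norm q)), ?_⟩
  have hqt := mem_ball_iff_norm.1 hq
  have hτ0 : 0 ≤ τ := by
    have := (norm_nonneg _).trans_lt hqt
    exact (pos_of_mul_pos_left this ht.le).le
  have ht2 : ‖(⟨t, t⟩ : ℂ)‖ ≤ 2 * t := by
    refine (Complex.norm_le_abs_re_add_abs_im _).trans ?_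
    simp only [abs_of_pos ht]; linarith
  have := norm_le_norm_add_norm_sub' q (⟨t, t⟩ : ℂ)
  nlinarith

section Pair

variable {τ t : ℝ} {i j : Fin n × Bool} {p q : ℂ}

/-- The sign of the kernel between two patches. -/
def patchSign (θ : ℝ) (n : ℕ) (i j : Fin n × Bool) : ℝ :=
  sg j.2 * SignType.sign (sideAngle θ n (i.1 + 1) i.2 - sideAngle θ n (j.1 + 1) j.2)

theorem abs_patchSign_le (θ : ℝ) (n : ℕ) (i j : Fin n × Bool) : |patchSign θ n i j| ≤ 1 := by
  unfold patchSign
  refine abs_mul_le_one (by cases j.2 <;> simp) ?_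
  rcases lt_trichotomy (sideAngle θ n (i.1 + 1) i.2 - sideAngle θ n (j.1 + 1) j.2) 0 with h | h | h
  · rw [sign_neg h]; simp
  · simp [h]
  · rw [sign_pos h]; simp

/-- The parameter `η` is of second order, `θ / (2π)` times half of `θ_n`, so it is small even
against the least angle between two sides. -/
theorem eta_le_abs_mul (hA : Admissible θ n) (hθ : θ ≤ τ) (hij : i ≠ j) : eta θ n ≤
    |sideAngle θ n (i.1 + 1) i.2 - sideAngle θ n (j.1 + 1) j.2| * τ := by
  have h1 := (abs_sideAngle_sub hA hij).1
  have h2 := hA.half_pos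
  have h3 := hA.pos
  rw [eta_eq]
  have h4 : θ / (2 * Real.pi) ≤ τ := (div_le_self h3.le (by linarith [Real.pi_gt_three])).trans hθ
  have h5 := h3.trans_le hθ
  calc _ ≤ τ * half θ n := by gcongr
    _ ≤ τ * |sideAngle θ n (i.1 + 1) i.2 - sideAngle θ n (j.1 + 1) j.2| := by gcongr; linarith
    _ = _ := mul_comm _ _

theorem patchSign_mul_inner (θ : ℝ) (n : ℕ) (i j : Fin n × Bool) (x : E3) :
    patchSign θ n i j * inner ℝ x (sideNormal θ n (j.1 + 1) j.2) =
      SignType.sign (sideAngle θ n (i.1 + 1) i.2 - sideAngle θ n (j.1 + 1) j.2) *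
        inner ℝ x (chartNormal (sideAngle θ n (j.1 + 1) j.2) (tilt θ n (j.1 + 1) j.2)) := by
  rw [patchSign, sideNormal, inner_smul_right]
  linear_combination (SignType.sign (sideAngle θ n (i.1 + 1) i.2 - sideAngle θ n (j.1 + 1) j.2) *
    inner ℝ x (chartNormal (sideAngle θ n (j.1 + 1) j.2) (tilt θ n (j.1 + 1) j.2))) * sg_mul_self j.2

theorem le_patchSign_mul_inner (hA : Admissible θ n) (hτ : τ ≤ 1 / 10) (hθ : θ ≤ τ) (ht : 0 < t)
    (hij : i ≠ j) (hq : q ∈ Metric.closedBall (⟨t, t⟩ : ℂ) (τ * t)) :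
    t * (2 * half θ n) * ((1 - τ) ^ 3 - 4 * τ) ≤ patchSign θ n i j *
      inner ℝ (sideChart θ n (i.1 + 1) i.2 q - sideChart θ n (j.1 + 1) j.2 p)
        (sideNormal θ n (j.1 + 1) j.2) := by
  obtain ⟨h1, h2, h3, h4⟩ := bounds_of_mem_closedBall hq
  obtain ⟨ha, hb⟩ := abs_sideAngle_sub hA hij
  have hα := hA.half_pos
  rw [patchSign_mul_inner]
  have hnum := loss_pos hτ
  have := inner_chart_pos (β := sideAngle θ n (j.1 + 1) j.2) (p := p) hτ ht
    (abs_pos.1 (by linarith)) (hb.trans hθ) (abs_tilt_le hA (i.1 + 1) i.2)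
    (abs_tilt_le hA (j.1 + 1) j.2) (eta_le_abs_mul hA hθ hij) h1 h3 h4
  rw [add_sub_cancel] at this
  refine le_trans ?_ this
  gcongr

/-- The sign is `± 1` for different sides, and the signed product is positive by the preceding
bound. -/
theorem abs_inner_eq_patchSign_mul (hA : Admissible θ n) (hτ : τ ≤ 1 / 10) (hθ : θ ≤ τ) (ht : 0 < t)
    (hij : i ≠ j) (hq : q ∈ Metric.closedBall (⟨t, t⟩ : ℂ) (τ * t)) :
    |inner ℝ (sideChart θ n (i.1 + 1) i.2 q - sideChart θ n (j.1 + 1) j.2 p)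
        (sideNormal θ n (j.1 + 1) j.2)| = patchSign θ n i j *
      inner ℝ (sideChart θ n (i.1 + 1) i.2 q - sideChart θ n (j.1 + 1) j.2 p)
        (sideNormal θ n (j.1 + 1) j.2) := by
  have h1 := le_patchSign_mul_inner (p := p) hA hτ hθ ht hij hq
  set I := inner ℝ (sideChart θ n (i.1 + 1) i.2 q - sideChart θ n (j.1 + 1) j.2 p)
        (sideNormal θ n (j.1 + 1) j.2) with hI
  have hnum := loss_pos hτ
  have h2 : 0 ≤ patchSign θ n i j * I := le_trans (by have := hA.half_pos; positivity) h1
  have hγ : sideAngle θ n (i.1 + 1) i.2 - sideAngle θ n (j.1 + 1) j.2 ≠ 0 :=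
    abs_pos.1 (by have := (abs_sideAngle_sub hA hij).1; have := hA.half_pos; linarith)
  have h3 : |patchSign θ n i j| = 1 := by
    unfold patchSign
    rw [abs_mul]
    have e1 : |sg j.2| = 1 := by cases j.2 <;> simp
    rcases lt_or_gt_of_ne hγ with h | h
    · rw [sign_neg h, e1]; simp
    · rw [sign_pos h, e1]; simp
  rw [← abs_of_nonneg h2, abs_mul, h3, one_mul]

theorem le_norm_sideChart_sub (hA : Admissible θ n) (hτ : τ ≤ 1 / 10) (hθ : θ ≤ τ) (ht : 0 < t)
    (hij : i ≠ j) (hq : q ∈ Metric.closedBall (⟨t, t⟩ : ℂ) (τ * t)) :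
    t * (2 * half θ n) * ((1 - τ) ^ 3 - 4 * τ) ≤
      ‖sideChart θ n (i.1 + 1) i.2 q - sideChart θ n (j.1 + 1) j.2 p‖ := by
  refine (le_patchSign_mul_inner (p := p) hA hτ hθ ht hij hq).trans ?_
  rw [← abs_inner_eq_patchSign_mul hA hτ hθ ht hij hq]
  refine (abs_real_inner_le_norm _ _).trans ?_
  rw [norm_sideNormal, mul_one]

/-- Each pair of patches contributes nearly `1/4`, uniformly in the scale: the flat limit gives `(π
- τ) / (4π)`, and the tilts cost the factor `tiltLoss τ`. -/
theorem le_setIntegral_kernel (hA : Admissible θ n) (hτ : τ ≤ 1 / 10) (hθ : θ ≤ τ) (ht : 0 < t)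
    (hij : i ≠ j) {R₀ : ℝ} (hR₀ : 0 < R₀)
    (hR : ∀ R ≥ R₀, Real.pi - τ ≤ ∫ v in Metric.ball (R : ℂ) R, poisson 1 v)
    (hθR : θ ≤ τ / (2 * R₀)) (hp : p ∈ patchBall τ t) :
    tiltLoss τ * (Real.pi - τ) / (4 * Real.pi) ≤
      ∫ q in patchBall τ t, |inner ℝ (sideChart θ n (i.1 + 1) i.2 q - sideChart θ n (j.1 + 1) j.2 p)
        (sideNormal θ n (j.1 + 1) j.2)| /
        (4 * Real.pi * ‖sideChart θ n (i.1 + 1) i.2 q - sideChart θ n (j.1 + 1) j.2 p‖ ^ 3) := by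
  obtain ⟨ha, hb⟩ := abs_sideAngle_sub hA hij
  have hα := hA.half_pos
  have hπ := Real.pi_pos
  have hτ0 : 0 < τ := hA.pos.trans_le hθ
  set γ := sideAngle θ n (i.1 + 1) i.2 - sideAngle θ n (j.1 + 1) j.2 with hγ
  have hγ0 : 0 < |γ| := by linarith
  have hd : 0 < t * |γ| := mul_pos ht hγ0
  have hr : 0 < t * (2 * half θ n) * ((1 - τ) ^ 3 - 4 * τ) := by
    have := loss_pos hτ
    positivity
  -- The half disc radius in units of the height is `τ / (2 * |γ|)`; it does not depend on `t`, and
  -- it is at least `R₀` because `|γ| ≤ θ ≤ τ / (2 * R₀)`.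
  have h1 : Real.pi - τ ≤ ∫ q in patchBall τ t, poisson (t * |γ|) (q - p) := by
    refine le_trans (hR _ ?_) (setIntegral_poisson_le hp hd)
    rw [ge_iff_le, le_div_iff₀ (by positivity)]
    have h2 := hb.trans hθR
    rw [le_div_iff₀ (by positivity)] at h2
    have := mul_le_mul_of_nonneg_left h2 ht.le
    linarith
  have hint : IntegrableOn (fun q => |inner ℝ (sideChart θ n (i.1 + 1) i.2 q -
      sideChart θ n (j.1 + 1) j.2 p) (sideNormal θ n (j.1 + 1) j.2)| /
        (4 * Real.pi * ‖sideChart θ n (i.1 + 1) i.2 q - sideChart θ n (j.1 + 1) j.2 p‖ ^ 3))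
      (patchBall τ t) := by
    refine IntegrableOn.mono_set ?_ (patchBall_subset τ t)
    refine ContinuousOn.integrableOn_compact (isCompact_closedBall _ _) ?_
    have hc := (isometry_sideChart θ n (i.1 + 1) i.2).continuous
    refine ContinuousOn.div (by fun_prop) (by fun_prop) fun q hq => ?_
    have := hr.trans_le (le_norm_sideChart_sub (p := p) hA hτ hθ ht hij hq)
    positivity
  calc tiltLoss τ * (Real.pi - τ) / (4 * Real.pi)
      = tiltLoss τ / (4 * Real.pi) * (Real.pi - τ) := by ring
    _ ≤ tiltLoss τ / (4 * Real.pi) * ∫ q in patchBall τ t, poisson (t * |γ|) (q - p) :=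
        mul_le_mul_of_nonneg_left h1 (div_nonneg (tiltLoss_nonneg hτ0.le hτ) (by positivity))
    _ = ∫ q in patchBall τ t, tiltLoss τ / (4 * Real.pi) * poisson (t * |γ|) (q - p) :=
        (integral_const_mul _ _).symm
    _ ≤ _ := by
        refine setIntegral_mono_on (((integrable_poisson hd p).const_mul _).integrableOn) hint
          Metric.isOpen_ball.measurableSet fun q hq => ?_
        have hq' := patchBall_subset τ t hq
        obtain ⟨h2, h3, h4, h5⟩ := bounds_of_mem_closedBall hq'
        have h6 := tiltLoss_mul_poisson_le (β := sideAngle θ n (j.1 + 1) j.2) (p := p) hτ ht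
          (abs_pos.1 hγ0) (hb.trans hθ) (abs_tilt_le hA (i.1 + 1) i.2)
          (abs_tilt_le hA (j.1 + 1) j.2) (eta_le_abs_mul hA hθ hij) h2 h4 h3 h5
        rw [hγ, add_sub_cancel, ← patchSign_mul_inner] at h6
        rw [abs_inner_eq_patchSign_mul hA hτ hθ ht hij hq']
        have h7 := div_le_div_of_nonneg_right h6 (show 0 ≤ 4 * Real.pi by positivity)
        rw [div_div, mul_comm _ (4 * Real.pi)] at h7
        calc _ = tiltLoss τ * poisson (t * |γ|) (q - p) / (4 * Real.pi) := by ring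
          _ ≤ _ := h7

end Pair


/-! ### The norms of the double-layer operator -/

/-- The surface lies in the `2n` planes of the sides, the `n` planes of the ends, the top plane and
the bottom plane. -/
theorem doubleLayer_bookSurface_ne_top (hA : Admissible θ n) {w : bookSurface θ n → ℝ}
    (hw : IsWeight (bookSurface θ n) w) :
    weightedOpNorm (bookSurface θ n) w (doubleLayer (bookSurface θ n)) ≠ ⊤ := by
  -- The gradient of the end form; it is not a unit vector, but its component `1` along the bisector
  -- shows that it is nonzero.
  set e : ℕ → E3 := fun j =>
    ofCoords (mid θ n j) 1 0 (Real.cos (half θ n + eta θ n) - Real.cos (half θ n)) with he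
  have hend : ∀ j x, endForm θ n j x = inner ℝ x (e j) - Real.cos (half θ n) := fun j x => by
    rw [inner_eq_coords (mid θ n j), he, along_ofCoords, across_ofCoords, ofCoords_apply_two, endForm]
    ring
  have he0 : ∀ j, e j ≠ 0 := fun j h => by
    have := congrArg (along (mid θ n j)) h
    rw [he, along_ofCoords, along_zero] at this
    exact one_ne_zero this
  set N : (Fin n × Bool) ⊕ (Fin n ⊕ Bool) → E3 := Sum.elim (fun i => sideNormal θ n (i.1 + 1) i.2)
    (Sum.elim (fun j => ‖e (j + 1)‖⁻¹ • e (j + 1)) fun _ => ofCoords 0 0 0 1) with hN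
  set c : (Fin n × Bool) ⊕ (Fin n ⊕ Bool) → ℝ := Sum.elim (fun _ => 0)
    (Sum.elim (fun j => ‖e (j + 1)‖⁻¹ * Real.cos (half θ n)) fun b => if b then -1 else 0) with hc
  refine weightedOpNorm_ne_top (isCompact_bookSurface hA).isClosed (N := N) (c := c) ?_ ?_ hw
  · rintro (i | j | b)
    · exact norm_sideNormal θ n _ _
    · simp only [hN, Sum.elim_inr, Sum.elim_inl, norm_smul, norm_inv, norm_norm]
      exact inv_mul_cancel₀ (norm_ne_zero_iff.2 (he0 _))
    · have h : ‖ofCoords 0 0 0 1‖ ^ 2 = 1 := by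
        rw [norm_sq_eq_coords 0, along_ofCoords, across_ofCoords, ofCoords_apply_two]; norm_num
      exact (pow_eq_one_iff_of_nonneg (norm_nonneg _) two_ne_zero).1 h
  · intro x hx
    rw [bookSurface_eq hA] at hx
    obtain ⟨j, hj, -, hor⟩ := Set.mem_iUnion₂.1 hx
    obtain ⟨k, rfl⟩ : ∃ k : Fin n, j = k + 1 :=
      ⟨⟨j - 1, by have := hj.1; have := hj.2; omega⟩, by have := hj.1; simp; omega⟩
    have hz : ∀ b, inner ℝ x (N (Sum.inr (Sum.inr b))) = x 2 := fun b => by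
      simp only [hN, Sum.elim_inr]
      rw [inner_eq_coords 0, along_ofCoords, across_ofCoords, ofCoords_apply_two]; ring
    rcases hor with h | h | h | ⟨b, h⟩
    · exact ⟨Sum.inr (Sum.inr false), by rw [hz, h]; simp [hc]⟩
    · exact ⟨Sum.inr (Sum.inr true), by rw [hz, h]; simp [hc]⟩
    · refine ⟨Sum.inr (Sum.inl k), ?_⟩
      simp only [hN, hc, Sum.elim_inr, Sum.elim_inl, inner_smul_right]
      rw [hend] at h
      rw [sub_eq_zero.1 h]
    · refine ⟨Sum.inl (k, b), ?_⟩
      rw [sideForm_eq_inner] at h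
      exact (mul_eq_zero.1 h).resolve_left (by positivity)

/-- The scale of the `k`-th patches. -/
def patchScale (k : ℕ) : ℝ := 1 / 16 * (1 / 4) ^ k

theorem patchScale_pos (k : ℕ) : 0 < patchScale k := by unfold patchScale; positivity

theorem patchScale_le (k : ℕ) : patchScale k ≤ 1 / 16 :=
  mul_le_of_le_one_right (by norm_num) (pow_le_one₀ (by norm_num) (by norm_num))

/-- A ratio of four suffices to separate consecutive scales, since `2 * (1 + τ) < 4 * (1 - τ)` for
`τ ≤ 1/10`. -/
theorem four_mul_patchScale_le {k l : ℕ} (h : k < l) : 4 * patchScale l ≤ patchScale k := by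
  have : ((1 : ℝ) / 4) ^ l ≤ (1 / 4) ^ (k + 1) :=
    pow_le_pow_of_le_one (by norm_num) (by norm_num) h
  rw [pow_succ] at this
  unfold patchScale
  linarith

theorem le_essNorm_bookSurface (hA : Admissible θ n) {τ : ℝ} (hτ : τ ≤ 1 / 10) (hθ : θ ≤ τ) {R₀ : ℝ}
    (hR₀ : 0 < R₀) (hR : ∀ R ≥ R₀, Real.pi - τ ≤ ∫ v in Metric.ball (R : ℂ) R, poisson 1 v)
    (hθR : θ ≤ τ / (2 * R₀)) {μ : ℝ} (hμ : 0 < μ)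
    (hμτ : μ ≤ (2 * n - 1) * (tiltLoss τ * (Real.pi - τ) / (4 * Real.pi)))
    {w : bookSurface θ n → ℝ} (hw : IsWeight (bookSurface θ n) w) :
    ENNReal.ofReal μ ≤ essNorm (bookSurface θ n) w (doubleLayer (bookSurface θ n)) := by
  have hn := hA.two_le
  have hτ0 : 0 < τ := hA.pos.trans_le hθ
  have ht := patchScale_pos
  have ht' := patchScale_le
  have hcl := (isCompact_bookSurface hA).isClosed
  refine ofReal_le_essNorm (isCompact_bookSurface hA) hw (fun k => patch θ n τ (patchScale k))
    (fun i => sideNormal θ n (i.1 + 1) i.2) (patchSign θ n) hμ (⟨0, by omega⟩, false)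
    (fun k i => isOpen_patch hA hτ (ht k) (ht' k) i) ?_ ?_ ?_ ?_ ?_ ?_ (abs_patchSign_le θ n) ?_ ?_ ?_
  · intro k l i j x hxi hxj
    have h1 := norm_bounds_of_mem_patch (ht k) hxi
    have h2 := norm_bounds_of_mem_patch (ht l) hxj
    have hk := mul_le_mul_of_nonneg_left hτ (ht k).le
    have hl := mul_le_mul_of_nonneg_left hτ (ht l).le
    have hkl : k = l := by
      rcases lt_trichotomy k l with h | h | h
      · have := four_mul_patchScale_le h
        have := ht l
        linarith [h1.1, h2.2]
      · exact h
      · have := four_mul_patchScale_le h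
        have := ht k
        linarith [h2.1, h1.2]
    refine ⟨hkl, ?_⟩
    subst hkl
    by_contra hij
    obtain ⟨q, hq, hqx⟩ := hxi
    obtain ⟨p, hp, hpx⟩ := hxj
    have h3 := le_norm_sideChart_sub (p := p) hA hτ hθ (ht k) hij (patchBall_subset _ _ hq)
    rw [hqx, hpx, sub_self, norm_zero] at h3
    have := loss_pos hτ
    have := hA.half_pos
    have := ht k
    exact absurd h3 (not_le.2 (by positivity))
  · intro k i
    rw [surf_patch hA hτ (ht k) (ht' k)]
    exact measure_ball_lt_top.ne
  · intro k i
    rw [surf_patch hA hτ (ht k) (ht' k)]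
    exact (Metric.measure_ball_pos volume _ (mul_pos hτ0 (ht k))).ne'
  -- The origin, to which the patches accumulate, lies in none of them.
  · refine ⟨⟨cyl 0 0 0, axis_mem_bookSurface hA (by norm_num) le_rfl⟩, fun k i hx => ?_⟩
    have h1 := (norm_bounds_of_mem_patch (ht k) hx).1
    have h2 : ‖cyl 0 0 0‖ = 0 := by simp [cyl, EuclideanSpace.norm_eq, Fin.sum_univ_three]
    rw [h2] at h1
    have := mul_pos (ht k) (show 0 < 1 - τ by linarith)
    linarith
  · rintro k i x ⟨q, hq, hx⟩
    have h := sideChart_patchBall_subset hA hτ (ht k) (ht' k) (i.1 + 1) i.2 ⟨q, hq, rfl⟩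
    rw [← hx]
    exact isOutwardUnitNormal_sideNormal hA (page_mem i) h (sideForm_sideChart θ n _ _ q)
  · rintro k i x ⟨q, -, hx⟩ y ⟨p, -, hy⟩
    rw [← hx, ← hy, inner_sub_left, sideNormal, inner_smul_right, inner_smul_right, sideChart,
      inner_chart_chartNormal, inner_chart_chartNormal, sub_self]
  · rintro i j hij k x ⟨q, hq, hx⟩ y ⟨p, -, hy⟩
    rw [← hx, ← hy]
    exact abs_inner_eq_patchSign_mul hA hτ hθ (ht k) hij (patchBall_subset _ _ hq)
  · intro k
    have h1 := loss_pos hτ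
    have h2 := hA.half_pos
    have h3 := ht k
    refine ⟨patchScale k * (2 * half θ n) * ((1 - τ) ^ 3 - 4 * τ), by positivity, ?_⟩
    rintro i j hij x ⟨q, hq, hx⟩ y ⟨p, -, hy⟩
    rw [← hx, ← hy]
    exact le_norm_sideChart_sub hA hτ hθ (ht k) hij (patchBall_subset _ _ hq)
  · rintro k j y ⟨p, hp, hy⟩
    have hterm : ∀ i ∈ Finset.univ.erase j, tiltLoss τ * (Real.pi - τ) / (4 * Real.pi) ≤
        ∫ x in patch θ n τ (patchScale k) i,
          |inner ℝ ((x : E3) - y) (sideNormal θ n (j.1 + 1) j.2)| /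
            (4 * Real.pi * ‖(x : E3) - y‖ ^ 3) ∂(surf (bookSurface θ n)) := by
      intro i hi
      have hij : i ≠ j := (Finset.mem_erase.1 hi).1
      have e := setIntegral_preimage_image hcl (isometry_sideChart θ n (i.1 + 1) i.2)
        (B := patchBall τ (patchScale k)) Metric.isOpen_ball.measurableSet
        (sideChart_patchBall_subset_bookSurface hA hτ (ht k) (ht' k) i)
        (fun z => |inner ℝ (z - (y : E3)) (sideNormal θ n (j.1 + 1) j.2)| /
            (4 * Real.pi * ‖z - (y : E3)‖ ^ 3))
      refine le_of_le_of_eq ?_ e.symm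
      rw [← hy]
      exact le_setIntegral_kernel hA hτ hθ (ht k) hij hR₀ hR hθR hp
    -- The point `y` is on one of `2n` sides and sees the patches of the `2n - 1` others; its own
    -- patch contributes nothing.
    refine le_trans hμτ (le_of_eq_of_le ?_ (Finset.card_nsmul_le_sum _ _ _ hterm))
    rw [Finset.card_erase_of_mem (Finset.mem_univ j), Finset.card_univ, Fintype.card_prod,
      Fintype.card_fin, Fintype.card_bool, nsmul_eq_mul, Nat.cast_sub (by omega)]
    push_cast
    ring

/-- The order of choices is what makes the estimate work: `ε` determines `τ`, then `τ` determines
the relative disc size `R₀`, and only then is `θ₀` taken below `τ` and `τ / (2 * R₀)`. In the limit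
`τ → 0` each patch gives exactly `1/4`. -/
theorem exists_forall_le_essNorm (hn : 2 ≤ n) {ε : ℝ} (hε : 0 < ε) :
    ∃ θ₀ : ℝ, 0 < θ₀ ∧ θ₀ ≤ Real.pi / 4 ∧ ∀ θ : ℝ, 0 < θ → θ ≤ θ₀ →
      ∀ w : bookSurface θ n → ℝ, IsWeight (bookSurface θ n) w →
        weightedOpNorm (bookSurface θ n) w (doubleLayer (bookSurface θ n)) ≠ ⊤ ∧
          ENNReal.ofReal ((2 * (n : ℝ) - 1) / 4 - ε) ≤
            essNorm (bookSurface θ n) w (doubleLayer (bookSurface θ n)) := by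
  have hπ := Real.pi_pos
  have hlim : Tendsto (fun τ => (2 * (n : ℝ) - 1) * (tiltLoss τ * (Real.pi - τ) / (4 * Real.pi)))
      (𝓝 0) (𝓝 ((2 * n - 1) / 4)) := by
    have h1 : Tendsto (fun τ : ℝ => Real.pi - τ) (𝓝 0) (𝓝 (Real.pi - 0)) :=
      tendsto_const_nhds.sub tendsto_id
    have h2 := ((tendsto_tiltLoss.mul h1).div_const (4 * Real.pi)).const_mul (2 * (n : ℝ) - 1)
    have e : (2 * (n : ℝ) - 1) * (1 * (Real.pi - 0) / (4 * Real.pi)) = (2 * n - 1) / 4 := by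
      field_simp; ring
    rwa [e] at h2
  have hev : ∀ᶠ τ in 𝓝[>] (0 : ℝ), (2 * (n : ℝ) - 1) / 4 - ε ≤
      (2 * (n : ℝ) - 1) * (tiltLoss τ * (Real.pi - τ) / (4 * Real.pi)) :=
    ((hlim.mono_left nhdsWithin_le_nhds).eventually_const_lt (by linarith)).mono fun _ h => h.le
  obtain ⟨τ, hτ, hτ0, hτ1⟩ := (hev.and (Ioc_mem_nhdsGT (show (0 : ℝ) < 1 / 10 by norm_num))).exists
  obtain ⟨R₀, hR₀, hR⟩ := exists_forall_le_setIntegral_poisson hτ0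
  refine ⟨min (Real.pi / 4) (min τ (τ / (2 * R₀))), by positivity, min_le_left _ _, ?_⟩
  intro θ hθ hθ' w hw
  have h1 := hθ'.trans (min_le_left _ _)
  have h2 := (hθ'.trans (min_le_right _ _)).trans (min_le_left _ _)
  have h3 := (hθ'.trans (min_le_right _ _)).trans (min_le_right _ _)
  have hA : Admissible θ n := ⟨hθ, h1, hn⟩
  refine ⟨doubleLayer_bookSurface_ne_top hA hw, ?_⟩
  rcases le_or_gt ((2 * (n : ℝ) - 1) / 4 - ε) 0 with hμ | hμ
  · rw [ENNReal.ofReal_of_nonpos hμ]; exact zero_le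
  · exact le_essNorm_bookSurface hA hτ1 h2 hR₀ hR h3 hμ hτ hw

end OpenBook

theorem theorem1p6 (n : ℕ) (hn : 2 ≤ n) :
    (∀ ε : ℝ, 0 < ε → ∃ θ₀ : ℝ, 0 < θ₀ ∧ θ₀ ≤ Real.pi / 4 ∧
      ∀ θ : ℝ, 0 < θ → θ ≤ θ₀ →
        ∀ w : OpenBook.bookSurface θ n → ℝ, OpenBook.IsWeight (OpenBook.bookSurface θ n) w →
          OpenBook.weightedOpNorm (OpenBook.bookSurface θ n) w
              (OpenBook.doubleLayer (OpenBook.bookSurface θ n)) ≠ ⊤ ∧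
            ENNReal.ofReal ((2 * (n : ℝ) - 1) / 4 - ε) ≤
              OpenBook.essNorm (OpenBook.bookSurface θ n) w
                (OpenBook.doubleLayer (OpenBook.bookSurface θ n))) ∧
    (∃ θ₀ : ℝ, 0 < θ₀ ∧ θ₀ ≤ Real.pi / 4 ∧
      ∀ θ : ℝ, 0 < θ → θ ≤ θ₀ →
        ∀ w : OpenBook.bookSurface θ n → ℝ, OpenBook.IsWeight (OpenBook.bookSurface θ n) w →
          ¬ OpenBook.essNorm (OpenBook.bookSurface θ n) w
              (OpenBook.doubleLayer (OpenBook.bookSurface θ n)) < 1 / 2) := by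
  refine ⟨fun ε hε => OpenBook.exists_forall_le_essNorm hn hε, ?_⟩
  have hn' : (2 : ℝ) ≤ n := by exact_mod_cast hn
  -- The excess of `(2n - 1) / 4` over `1/2` serves as `ε`; it is positive because `(2n - 1) / 4 ≥
  -- 3/4`.
  obtain ⟨θ₀, h0, h1, h⟩ := OpenBook.exists_forall_le_essNorm hn
    (show 0 < (2 * (n : ℝ) - 1) / 4 - 1 / 2 by linarith)
  refine ⟨θ₀, h0, h1, fun θ hθ hθ' w hw => not_lt.2 ?_⟩
  have h2 := (h θ hθ hθ' w hw).2
  rwa [sub_sub_cancel, ENNReal.ofReal_div_of_pos two_pos, ENNReal.ofReal_one, ENNReal.ofReal_ofNat] at h2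

end
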